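/- Let $k$ be a perfect field of characteristic $2$, let $a,b\in k$, and let $X$ be the supersingular elliptic curve over $k$ with affine model $y^2+y=x^3+ax+b$; write $K=k(X)$. *Definitions.* Let $R_X$ be the set of finite separable nonconstant morphisms $X\to\mathbb P^1_k$, identified with $\{f\in K: df\neq 0\}$. Such an $f$ is *tame* if its ramification index at every point of $X$ is odd. It is *pseudotame* at a closed point $P$ if, for a uniformizer $t$ of $\mathbb P^1_k$ at $f(P)$, there is $h\in K$ such that $f^*t+h^4$ has odd order at $P$. For $f,g\in R_X$ write $f=f_0^4+f_1^4g+f_2^4g^2+f_3^4g^3$ with (unique) $f_i\in K$ and put $$\mathrm{SY}(f,g)=\Bigl(\frac{f_1f_3+f_2^2}{f_1^2+f_3^2g}\Bigr)^2dg\in\Omega_{K/k}.$$ Let $X^{(i)}$ be the base change of $X$ along the $i$-th power of the Frobenius of $k$, and let $B$ be the sheaf on $X^{(1)}$ that is the image of $d:\pi_*\mathcal O_X\to\pi_*\omega_{X/k}$, where $\pi:X\to X^{(1)}$ is the relative Frobenius. Let $U_1,\dots,U_n$ be a cover of $X$ by nonempty affine open subsets, and let $f_i\in R_X$ be pseudotame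 at every point of $U_i$. An *SY cochain* is a family $\omega_i\in H^0(U_i^{(1)},B)\subset\Omega_{K/k}$ with $\mathrm{SY}(f_i,f_j)=\omega_i+\omega_j$ for all $i,j$; it represents an element of the SY torsor of $X$. The function field of $X^{(2)}$ is identified with $K^4$ by the relative Frobenius, and then with $K$ by extracting fourth roots. For $g\in R_X$ and $\omega=\beta^2dg$ with $\beta\in K$, let $C_{g,\omega}$ be the conic $$T_1T_3+T_2^2+\beta\,(T_1^2+gT_3^2)=0$$ over the function field of $X^{(2)}$, where a point $[s_1:s_2:s_3]$ stands for $s=s_0^4+s_1^4g+s_2^4g^2+s_3^4g^3\in K$ modulo adding fourth powers and scaling by nonzero fourth powers. The *SY bundle* of an SY cochain is the conic bundle over $X^{(2)}$ whose generic fibre, in the coordinates given by each $f_i$, is $C_{f_i,\omega_i}$. Its sections are the same as the rational points of its generic fibre. The corresponding *SY class* in $\mathrm{Br}(X^{(2)})[2]$ is the Brauer class of this conic bundle; it vanishes if and only if its restriction to the generic point does, that is, if and only if the class of the even Clifford algebra of the quadratic form defining the generic fibre is trivial. *Theorem.* 1. Every SY class of $X$ vanishes, and every SY bundle of $X$ has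 a section. 2. For every cover $(U_i,f_i)_i$ as above, a family $(\omega_i)_i$ in $\Omega_{K/k}$ is an SY cochain if and only if there is $c\in k$ with $\omega_i=d(x^3+c^2x)+\mathrm{SY}(f_i,x)$ for all $i$. 3. Let $c,d_0\in k$ with $d_0^4=c$. Then $d(x^3+c^2x)=(x+c)^2dx$, and the conic $C_{x,\,d(x^3+c^2x)}$, that is, $$T_1T_3+T_2^2+(x+c)T_1^2+(x^2+cx)T_3^2=0,$$ has the rational point $(T_1:T_2:T_3)=(d_0^2: d_0+c+x: 1)$. For every cover $(U_i,f_i)_i$ as above, the function $s=d_0^8x+(d_0+c+x)^4x^2+x^3$ represents a rational point of the generic fibre of the SY bundle of the SY cochain $\omega_i=d(x^3+c^2x)+\mathrm{SY}(f_i,x)$. 4. The curve $X$ admits a tame morphism $X\to\mathbb P^1_k$. -/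

import Mathlib

open scoped KaehlerDifferential IntermediateField

noncomputable section

namespace SYCurve

section Curve

variable (k K : Type*) [Field k] [Field K] [Algebra k K]

/-- A closed point of the smooth projective curve `X` over `k` with function field `K`: a discrete
valuation ring of `K` containing `k`, with fraction field `K`; it is the local ring of `X` at the
point.  So `X` is the abstract nonsingular curve of the function field `K / k`, and a property of
all closed points of `X` is a property of all elements of `Place k K`. -/
structure Place extends ValuationSubring K where
  algebraMap_mem' : ∀ c : k, algebraMap k K c ∈ carrier
  isDVR' : IsDiscreteValuationRing toValuationSubring

variable {K}

/-- `R_X`: the finite separable nonconstant morphisms `X → ℙ¹`, identified with the elements of the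
function field whose differential is nonzero (by pulling back the coordinate of `ℙ¹`). -/
def separableMorphisms : Set K := {f | KaehlerDifferential.D k K f ≠ 0}

variable {k}

/-- The local ring of `X` at the point `x`. -/
abbrev Place.localRing (x : Place k K) : ValuationSubring K := x.toValuationSubring

/-- The order of `z` at `x` is `n`: `z` has the valuation of `ϖ ^ n` for a uniformizer `ϖ` at `x`.
(This never holds for `z = 0`.) -/
def Place.HasOrder (x : Place k K) (z : K) (n : ℤ) : Prop :=
  ∃ ϖ : x.localRing, IsLocalRing.maximalIdeal x.localRing = Ideal.span {ϖ} ∧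
    x.localRing.valuation z = x.localRing.valuation (ϖ : K) ^ n

/-- The ideal of the local ring at `x` generated by the pullback along `f : X → ℙ¹` of the maximal
ideal of the local ring of `ℙ¹` at `f(x)`.  The function field of `ℙ¹` is `k(f)`, and the local ring
of `ℙ¹` at `f(x)` is the intersection of `k(f)` with the local ring of `X` at `x`. -/
def Place.pullbackIdeal (x : Place k K) (f : K) : Ideal x.localRing :=
  Ideal.span {s | (s : K) ∈ k⟮f⟯ ∧ s ∈ IsLocalRing.maximalIdeal x.localRing}

/-- `f` is tamely ramified at `x`: the ramification index `e`, defined by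
`f⁻¹ 𝔪_{f(x)} · 𝒪_x = 𝔪_x ^ e`, is not divisible by the characteristic.
Over a perfect field `k` the ramification index at a closed point of `X` is the ramification index
at each of the geometric points above it. -/
def IsTameAt (x : Place k K) (f : K) : Prop :=
  ∃ e : ℕ, x.pullbackIdeal f = IsLocalRing.maximalIdeal x.localRing ^ e ∧ ¬ ringChar k ∣ e

variable (k) in
/-- `f` is a tame (finite separable) morphism `X → ℙ¹`. -/
def IsTame (f : K) : Prop :=
  f ∈ separableMorphisms k (K := K) ∧ ∀ x : Place k K, IsTameAt x f

/-- `t` is (the pullback to `X` of) a uniformizer of `ℙ¹` at `f(x)`: an element of `k(f)` that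
generates the maximal ideal of the discrete valuation ring `k(f) ∩ 𝒪_x`. -/
def Place.IsTargetUniformizer (x : Place k K) (f t : K) : Prop :=
  t ∈ k⟮f⟯ ∧ (∃ s : x.localRing, (s : K) = t ∧ s ∈ IsLocalRing.maximalIdeal x.localRing) ∧
    ∀ s : x.localRing, (s : K) ∈ k⟮f⟯ → s ∈ IsLocalRing.maximalIdeal x.localRing →
      ∃ r : x.localRing, (r : K) ∈ k⟮f⟯ ∧ (s : K) = r * t

/-- `f` is pseudotame at `x` (for `k` perfect of characteristic two): after adding a fourth power,
the pullback of a uniformizer of `ℙ¹` at `f(x)` has odd order at `x`. -/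
def IsPseudotameAt (x : Place k K) (f : K) : Prop :=
  ∃ t h : K, x.IsTargetUniformizer f t ∧ ∃ n : ℤ, Odd n ∧ x.HasOrder (t + h ^ 4) n

/-- `U` is the set of closed points of a nonempty affine open subset of the projective curve `X`:
the complement of a nonempty finite set of closed points. -/
def IsAffineOpen (U : Set (Place k K)) : Prop := Uᶜ.Finite ∧ Uᶜ.Nonempty

end Curve

section Symbol

variable {k K : Type*} [Field k] [Field K] [Algebra k K]

/-- `f = c₀⁴ + c₁⁴ g + c₂⁴ g² + c₃⁴ g³`. -/
def IsExpansion (f g : K) (c : Fin 4 → K) : Prop :=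
  f = c 0 ^ 4 + c 1 ^ 4 * g + c 2 ^ 4 * g ^ 2 + c 3 ^ 4 * g ^ 3

/-- The coefficients of such an expansion are unique when `dg ≠ 0`. -/
theorem IsExpansion.unique [CharP k 2] {f g : K} (hg : g ∈ separableMorphisms k (K := K))
    {c c' : Fin 4 → K} (hc : IsExpansion f g c) (hc' : IsExpansion f g c') : c = c' := by
  have : CharP K 2 := charP_of_injective_algebraMap (algebraMap k K).injective 2
  have h2 : (2 : K) = 0 := CharP.cast_eq_zero K 2
  have key : ∀ u v : K, u ^ 2 + v ^ 2 * g = 0 → u = 0 ∧ v = 0 := by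
    intro u v h
    have h1 := congrArg (KaehlerDifferential.D k K) h
    have h3 : v ^ 2 • KaehlerDifferential.D k K g = 0 := by
      have hz : ∀ m : Ω[K⁄k], (2 : ℕ) • m = 0 := fun m => by
        rw [← Nat.cast_smul_eq_nsmul K]; simp [h2]
      simpa [pow_two, ← two_smul ℕ, hz] using h1
    have hv : v = 0 := by
      rcases smul_eq_zero.1 h3 with h | h
      · simpa using h
      · exact absurd h hg
    subst hv
    exact ⟨by simpa using h, rfl⟩
  have e : ((c 0 - c' 0) ^ 2 + (c 2 - c' 2) ^ 2 * g) ^ 2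
      + ((c 1 - c' 1) ^ 2 + (c 3 - c' 3) ^ 2 * g) ^ 2 * g = 0 := by
    have p : ∀ u v : K, (u - v) ^ 4 = u ^ 4 - v ^ 4 := fun u v => by
      have := sub_pow_char_pow (R := K) (p := 2) (n := 2) u v
      simpa using this
    have q : ∀ u v : K, (u + v) ^ 2 = u ^ 2 + v ^ 2 := fun u v => add_pow_char u v 2
    unfold IsExpansion at hc hc'
    have r : ((c 0 - c' 0) ^ 2 + (c 2 - c' 2) ^ 2 * g) ^ 2
        + ((c 1 - c' 1) ^ 2 + (c 3 - c' 3) ^ 2 * g) ^ 2 * g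
        = (c 0 - c' 0) ^ 4 + (c 2 - c' 2) ^ 4 * g ^ 2
          + ((c 1 - c' 1) ^ 4 + (c 3 - c' 3) ^ 4 * g ^ 2) * g := by
      rw [q, q]; ring
    rw [r, p, p, p, p]
    linear_combination hc' - hc
  obtain ⟨e1, e2⟩ := key _ _ e
  obtain ⟨h0, h2'⟩ := key _ _ e1
  obtain ⟨h1, h3⟩ := key _ _ e2
  funext i
  fin_cases i
  · exact sub_eq_zero.1 h0
  · exact sub_eq_zero.1 h1
  · exact sub_eq_zero.1 h2'
  · exact sub_eq_zero.1 h3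

open Classical in
/-- The Sugiyama-Yasuda symbol `((f₁ f₃ + f₂²) / (f₁² + f₃² g))² dg`, where
`f = f₀⁴ + f₁⁴ g + f₂⁴ g² + f₃⁴ g³`, for `k` perfect of characteristic two (so that
`k^{1/4} · K = K`) and `f`, `g` with nonzero differential.  The expansion exists because
`1, g, g², g³` is a basis of the function field `K` over `K⁴`, and it is unique by
`IsExpansion.unique`. -/
def symbol (f g : K) : Ω[K⁄k] :=
  if h : ∃ c, IsExpansion f g c then
    ((h.choose 1 * h.choose 3 + h.choose 2 ^ 2) / (h.choose 1 ^ 2 + h.choose 3 ^ 2 * g)) ^ 2 •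
      KaehlerDifferential.D k K g
  else 0

/-- The sections over `U` of the sheaf `B`, the image of `d : π_* 𝒪_X → π_* ω_X` for the relative
Frobenius `π : X → X⁽¹⁾`: the rational differentials that are, near every point of `U`, the
differential of a regular function. -/
def sectionsB (U : Set (Place k K)) : Set Ω[K⁄k] :=
  {ω | ∀ x ∈ U, ∃ s ∈ x.localRing, KaehlerDifferential.D k K s = ω}

end Symbol

section Bundle

variable (k K : Type*) [Field k] [Field K] [Algebra k K]

/-- A finite cover of `X` by affine open subsets `U i` with, for each `i`, a morphism `f i` in `R_X`
that is pseudotame on `U i`. -/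
structure PseudotameCover (n : ℕ) where
  U : Fin n → Set (Place k K)
  isAffineOpen : ∀ i, IsAffineOpen (U i)
  covers : ∀ x, ∃ i, x ∈ U i
  f : Fin n → K
  mem_separable : ∀ i, f i ∈ separableMorphisms k (K := K)
  pseudotame : ∀ i, ∀ x ∈ U i, IsPseudotameAt x (f i)

variable {k K}

/-- The family `ω i = da_i` is an SY cochain on the cover, i.e. represents an element of the
SY torsor of `X`: it is a 0-cochain with values in `B` whose coboundary is `SY(f_i, f_j)`. -/
def IsSYCochain {n : ℕ} (P : PseudotameCover k K n) (ω : Fin n → Ω[K⁄k]) : Prop :=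
  (∀ i, ω i ∈ sectionsB (P.U i)) ∧ ∀ i j, symbol (P.f i) (P.f j) = ω i + ω j

/-- The ternary quadratic form `T₁ T₃ + T₂² + b (T₁² + g T₃²)` (the coordinates `T₁, T₂, T₃` are
numbered `0, 1, 2`).

For `da = b² dg` its zero locus is the generic fibre of the conic bundle `C_{g, da}`. The function
field of `X⁽²⁾` is identified with `K`: the relative Frobenius `X → X⁽²⁾` identifies it with `K⁴`,
and `K⁴` is identified with `K` by extracting fourth roots. In this way the `K`-points
`[f₁ : f₂ : f₃]` of the zero locus are the solutions `f = f₀⁴ + f₁⁴ g + f₂⁴ g² + f₃⁴ g³`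
of `SY(f, g) = da`, up to scaling by and adding fourth powers. -/
def conicForm (b g : K) : QuadraticForm K (Fin 3 → K) :=
  QuadraticMap.linMulLin (LinearMap.proj 0) (LinearMap.proj 2)
    + QuadraticMap.linMulLin (LinearMap.proj 1) (LinearMap.proj 1)
    + b • (QuadraticMap.linMulLin (LinearMap.proj 0) (LinearMap.proj 0)
      + g • QuadraticMap.linMulLin (LinearMap.proj 2) (LinearMap.proj 2))

theorem conicForm_apply (b g : K) (T : Fin 3 → K) :
    conicForm b g T = T 0 * T 2 + T 1 ^ 2 + b * (T 0 ^ 2 + g * T 2 ^ 2) := by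
  simp [conicForm]
  ring

/-- `s` represents a rational point of the generic fibre of the SY bundle defined by the cochain
`ω`.  The SY bundle lies in the `ℙ²`-bundle with generic fibre the projective space of lines in
`K / K⁴`, and `s` spans a line there: in the coordinates given by each `f i`, the coefficients
`[c₁ : c₂ : c₃]` of `s` are a point of the conic `C_{f_i, ω_i}`.  As `X⁽²⁾` is a smooth curve and the
SY bundle is proper over it, such rational points are the same as sections over `X⁽²⁾`. -/
def IsSYSection {n : ℕ} (P : PseudotameCover k K n) (ω : Fin n → Ω[K⁄k]) (s : K) : Prop :=
  ∀ i, ∃ (b : K) (c : Fin 4 → K), b ^ 2 • KaehlerDifferential.D k K (P.f i) = ω i ∧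
    IsExpansion s (P.f i) c ∧ ![c 1, c 2, c 3] ≠ 0 ∧ conicForm b (P.f i) ![c 1, c 2, c 3] = 0

end Bundle

section Brauer

universe u

/-- The field `K` as a central simple algebra over itself; its class is the neutral element of the
Brauer group. -/
def trivialCSA (K : Type u) [Field K] : CSA.{u, u} K where
  toAlgCat := AlgCat.of K K
  isCentral := inferInstanceAs (Algebra.IsCentral K K)
  isSimple := inferInstanceAs (IsSimpleRing K)
  fin_dim := inferInstanceAs (FiniteDimensional K K)

/-- The `K`-algebra `A` is central simple, with neutral class in the Brauer group of `K`. -/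
def HasTrivialBrauerClass (K A : Type u) [Field K] [Ring A] [Algebra K A] : Prop :=
  ∃ A' : CSA.{u, u} K, Nonempty (A' ≃ₐ[K] A) ∧
    (Quotient.mk (Brauer.CSA_Setoid K) A' : BrauerGroup K) = Quotient.mk _ (trivialCSA K)

/-- The SY class defined by the cochain `ω` vanishes.  The Brauer class of a smooth conic `q = 0`
is the class of the even Clifford algebra of `q`, which is a quaternion algebra.  As `X⁽²⁾` is a
regular integral scheme, its Brauer group embeds into the Brauer group of its function field, so a
class may be tested on the generic fibre; this fibre is the same conic `C_{f_i, ω_i}` for all `i`,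
up to the choice of coordinates. -/
def SYClassVanishes {k K : Type u} [Field k] [Field K] [Algebra k K] {n : ℕ}
    (P : PseudotameCover k K n) (ω : Fin n → Ω[K⁄k]) : Prop :=
  ∀ i, ∃ b : K, b ^ 2 • KaehlerDifferential.D k K (P.f i) = ω i ∧
    HasTrivialBrauerClass K (CliffordAlgebra.even (conicForm b (P.f i)))

end Brauer

section Elliptic

variable {k : Type*} [Field k]

/-- The curve `y² + y = x³ + a x + b`. -/
def curve (a b : k) : WeierstrassCurve.Affine k where
  a₁ := 0
  a₂ := 0
  a₃ := 1
  a₄ := a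
  a₆ := b

/-- The function field of `y² + y = x³ + a x + b`. -/
abbrev FunField (a b : k) : Type _ := (curve a b).FunctionField

/-- The coordinate function `x`. -/
def xCoord (a b : k) : FunField a b :=
  algebraMap (curve a b).CoordinateRing (FunField a b)
    (WeierstrassCurve.Affine.CoordinateRing.mk (curve a b) (Polynomial.C Polynomial.X))

end Elliptic

end SYCurve

end

open SYCurve

/-! As `k` is perfect of characteristic two, `1, x` is a basis of `K` over its subfield of squares,
so every exact differential has the form `β² dx`. The symbol is an additive cocycle, SY(f,g) +
SY(g,h) = SY(f,h) (`symbol_add_symbol`), and it is symmetric. Hence for a cochain the differential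
ω_i + SY(f_i,x) does not depend on `i`; call it `β² dx`. The problem is to find which `β` give every
ω_i a regular local potential.

The local analysis rests on one remark: if `t` is a uniformizer, `u²` has even order and `w² t` has
odd order, so the order of `u² + w² t` determines bounds on both `u` and `w`. It follows that
SY(f,τ) lies in `B` at `P` when `f` is pseudotame at `P` and τ is a uniformizer
(`isExactAt_symbol_of_pseudotame`). Moreover `dx` has neither zeros nor poles on `X`, so `β² dx`
lies in `B` at `P` exactly when `β` is regular there. At affine points `x` is as good as a
uniformizer and the condition is that `β` be regular. At infinity `x` has order -2 and is replaced
by `y`, of order -3; as SY(y,x) = (x + regular)² dx, the condition becomes that `β + x` be regular.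
Functions without affine poles are p(x) + q(x)y, and the two terms cannot cancel at infinity, so `β
= x + c` (`exists_eq_xCoord_add`).

For this `β` the conic is the equation SY(s,x) = (x+c)² dx with denominators cleared. It has an
explicit point, and the cocycle relation carries the same `s` to the coordinates given by each
`f_i`. A rational point gives 2 by 2 matrices satisfying the relations of the even Clifford algebra,
which is therefore split (`hasTrivialBrauerClass_even`).

The tame function is another solution, for `c = 0`: SY(f,x) = x² dx. Its symbol is regular at affine
points and its differential (x³+1)² dx vanishes there to order at most two, which forces
ramification index 1 or 3 (`exists_odd_order`); a fourth power is added to make the pole at infinity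
of order 11. -/

namespace SYCurve

/-! ### Sums `u² + w² g` in characteristic two. -/

section CharTwo

variable {K : Type*} [Field K] [CharP K 2]

theorem sq_add_sq_mul_add (u w u' w' g : K) :
    (u ^ 2 + w ^ 2 * g) + (u' ^ 2 + w' ^ 2 * g) = (u + u') ^ 2 + (w + w') ^ 2 * g := by
  rw [add_pow_char u u' 2, add_pow_char w w' 2]; ring

theorem sq_add_sq_mul_mul (u w u' w' g : K) :
    (u ^ 2 + w ^ 2 * g) * (u' ^ 2 + w' ^ 2 * g) =
      (u * u' + w * w' * g) ^ 2 + (u * w' + w * u') ^ 2 * g := by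
  rw [add_pow_char _ _ 2, add_pow_char _ _ 2]; ring

theorem sum_fourth_eq (c₀ c₁ c₂ c₃ g : K) :
    c₀ ^ 4 + c₁ ^ 4 * g + c₂ ^ 4 * g ^ 2 + c₃ ^ 4 * g ^ 3 =
      (c₀ ^ 2 + c₂ ^ 2 * g) ^ 2 + (c₁ ^ 2 + c₃ ^ 2 * g) ^ 2 * g := by
  rw [add_pow_char _ _ 2, add_pow_char _ _ 2]; ring

end CharTwo

/-! ### Algebra of the symbol: cocycle relation, symmetry, bases over the squares. -/

section Algebra

variable {k K : Type*} [Field k] [Field K] [Algebra k K] [CharP K 2]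

local notation "d" => KaehlerDifferential.D k K

theorem two_smul_differential (m : Ω[K⁄k]) : m + m = 0 := by
  rw [← two_smul K m, CharTwo.two_eq_zero, zero_smul]

theorem differential_eq_of_add_eq_zero {m n : Ω[K⁄k]} (h : m + n = 0) : m = n := by
  have := two_smul_differential n
  rw [← h] at this
  exact (add_right_cancel this).symm

theorem D_sq (u : K) : d (u ^ 2) = 0 := by
  rw [pow_two, Derivation.leibniz]
  exact two_smul_differential _

theorem D_sq_mul (u g : K) : d (u ^ 2 * g) = u ^ 2 • d g := by
  rw [Derivation.leibniz, D_sq, smul_zero, add_zero]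

theorem D_sq_add_sq_mul (u w g : K) : d (u ^ 2 + w ^ 2 * g) = w ^ 2 • d g := by
  rw [map_add, D_sq, D_sq_mul, zero_add]

theorem sq_smul_add (u w : K) (m : Ω[K⁄k]) : u ^ 2 • m + w ^ 2 • m = (u + w) ^ 2 • m := by
  rw [add_pow_char u w 2, add_smul]

theorem sq_smul_D_injective {g : K} (hg : g ∈ separableMorphisms k (K := K)) {u w : K}
    (h : u ^ 2 • d g = w ^ 2 • d g) : u = w := by
  have h1 := smul_left_injective K (M := Ω[K⁄k]) (m := d g) hg h
  have h2 : (u - w) ^ 2 = 0 := by rw [sub_pow_char]; exact sub_eq_zero.2 h1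
  exact sub_eq_zero.1 (by simpa using h2)

/-- The square root of the coefficient of `dg` in the symbol. -/
def symbolCoeff (g : K) (c : Fin 4 → K) : K :=
  (c 1 * c 3 + c 2 ^ 2) / (c 1 ^ 2 + c 3 ^ 2 * g)

/-- The denominator of the symbol is thus the square root of `df/dg`; this makes it multiplicative
under composition and nonzero for separable `f`. -/
theorem IsExpansion.D_eq {f g : K} {c : Fin 4 → K} (h : IsExpansion f g c) :
    d f = (c 1 ^ 2 + c 3 ^ 2 * g) ^ 2 • d g := by
  rw [h, sum_fourth_eq, D_sq_add_sq_mul]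

theorem IsExpansion.denom_ne_zero {f g : K} {c : Fin 4 → K} (h : IsExpansion f g c)
    (hf : f ∈ separableMorphisms k (K := K)) : c 1 ^ 2 + c 3 ^ 2 * g ≠ 0 := by
  intro h0
  exact hf (by rw [h.D_eq (k := k), h0]; simp)

/-- Uniqueness of expansions allows the chosen expansion inside `symbol` to be replaced by any
expansion at hand. -/
theorem IsExpansion.symbol_eq {f g : K} {c : Fin 4 → K} (h : IsExpansion f g c)
    (hg : g ∈ separableMorphisms k (K := K)) :
    (symbol f g : Ω[K⁄k]) = symbolCoeff g c ^ 2 • d g := by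
  have : CharP k 2 := by
    rw [(algebraMap k K).charP_iff (algebraMap k K).injective 2]; infer_instance
  have h' : ∃ c, IsExpansion f g c := ⟨c, h⟩
  rw [symbol, dif_pos h', IsExpansion.unique hg h'.choose_spec h, symbolCoeff]

theorem symbol_self {f : K} (hf : f ∈ separableMorphisms k (K := K)) :
    (symbol f f : Ω[K⁄k]) = 0 := by
  have h : IsExpansion f f ![0, 1, 0, 0] := by simp [IsExpansion]
  rw [h.symbol_eq hf]
  simp [symbolCoeff]

/-- Composition of expansions. -/
theorem IsExpansion.comp {f g h : K} {p q : Fin 4 → K} (hf : IsExpansion f g p)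
    (hg : IsExpansion g h q) :
    IsExpansion f h
      ![p 0 + p 1 * q 0 + p 2 * (q 0 ^ 2 + q 2 ^ 2 * h) +
          p 3 * (q 0 * (q 0 ^ 2 + q 2 ^ 2 * h) + q 2 * (q 1 ^ 2 + q 3 ^ 2 * h) * h),
        p 1 * q 1 + p 3 * (q 1 * (q 0 ^ 2 + q 2 ^ 2 * h) + q 3 * (q 1 ^ 2 + q 3 ^ 2 * h) * h),
        p 1 * q 2 + p 2 * (q 1 ^ 2 + q 3 ^ 2 * h) +
          p 3 * (q 2 * (q 0 ^ 2 + q 2 ^ 2 * h) + q 0 * (q 1 ^ 2 + q 3 ^ 2 * h)),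
        p 1 * q 3 + p 3 * (q 3 * (q 0 ^ 2 + q 2 ^ 2 * h) + q 1 * (q 1 ^ 2 + q 3 ^ 2 * h))] := by
  have fourth : ∀ u v : K, (u + v) ^ 4 = u ^ 4 + v ^ 4 := fun u v => by
    simpa using add_pow_char_pow (R := K) (p := 2) (n := 2) u v
  have sq : ∀ u v : K, (u + v) ^ 2 = u ^ 2 + v ^ 2 := fun u v => add_pow_char u v 2
  -- With `A = q₀² + q₂² h` and `B = q₁² + q₃² h` one has `g = A² + B² h`, so `g² = A⁴ + B⁴ h²` has
  -- only two terms, and `g³ = g · g²`. The coefficients of the composite follow by additivity of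
  -- fourth powers.
  have h2 : g ^ 2 = (q 0 ^ 2 + q 2 ^ 2 * h) ^ 4 + (q 1 ^ 2 + q 3 ^ 2 * h) ^ 4 * h ^ 2 := by
    rw [hg, sum_fourth_eq, sq]; ring
  have h3 : g ^ 3 = (q 0 ^ 4 + q 1 ^ 4 * h + q 2 ^ 4 * h ^ 2 + q 3 ^ 4 * h ^ 3) *
      ((q 0 ^ 2 + q 2 ^ 2 * h) ^ 4 + (q 1 ^ 2 + q 3 ^ 2 * h) ^ 4 * h ^ 2) := by
    rw [← h2, ← hg]; ring
  unfold IsExpansion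
  rw [hf, h3, h2]
  nth_rewrite 1 [hg]
  generalize q 0 ^ 2 + q 2 ^ 2 * h = A
  generalize q 1 ^ 2 + q 3 ^ 2 * h = B
  simp only [Matrix.cons_val]
  simp only [fourth, mul_pow]
  ring

/-- Write N/D for the quotient in a symbol. By the chain rule the denominators multiply, D = D_p
D_q, and in characteristic two the numerators satisfy N = N_p D_q² + N_q D_p. Dividing, and using
`dg = D_q² dh`, gives the sum. -/
theorem symbol_add_symbol {f g h : K} {p q : Fin 4 → K} (hpf : IsExpansion f g p)
    (hqg : IsExpansion g h q) (hf : f ∈ separableMorphisms k (K := K))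
    (hg : g ∈ separableMorphisms k (K := K)) (hh : h ∈ separableMorphisms k (K := K)) :
    (symbol f g + symbol g h : Ω[K⁄k]) = symbol f h := by
  have hF := hpf.comp hqg
  have n1 := hpf.denom_ne_zero hf
  have n2 := hqg.denom_ne_zero hg
  have n3 := hF.denom_ne_zero hf
  rw [hpf.symbol_eq hg, hqg.symbol_eq hh, hF.symbol_eq hh, hqg.D_eq, smul_smul, ← mul_pow,
    sq_smul_add]
  congr 2
  have h2 : (2 : K) = 0 := CharTwo.two_eq_zero
  have e1 : ∀ u v : K, (u + v) ^ 2 = u ^ 2 + v ^ 2 := fun u v => add_pow_char u v 2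
  unfold IsExpansion at hqg
  unfold symbolCoeff
  have eden : (p 1 * q 1 + p 3 * (q 1 * (q 0 ^ 2 + q 2 ^ 2 * h) +
        q 3 * (q 1 ^ 2 + q 3 ^ 2 * h) * h)) ^ 2 + (p 1 * q 3 + p 3 * (q 3 * (q 0 ^ 2 + q 2 ^ 2 * h)
        + q 1 * (q 1 ^ 2 + q 3 ^ 2 * h))) ^ 2 * h =
      (p 1 ^ 2 + p 3 ^ 2 * g) * (q 1 ^ 2 + q 3 ^ 2 * h) := by
    rw [hqg, sum_fourth_eq]
    generalize q 0 ^ 2 + q 2 ^ 2 * h = A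
    simp only [e1, mul_pow]
    ring
  have enum : (p 1 * q 1 + p 3 * (q 1 * (q 0 ^ 2 + q 2 ^ 2 * h) +
        q 3 * (q 1 ^ 2 + q 3 ^ 2 * h) * h)) * (p 1 * q 3 + p 3 * (q 3 * (q 0 ^ 2 + q 2 ^ 2 * h)
        + q 1 * (q 1 ^ 2 + q 3 ^ 2 * h))) + (p 1 * q 2 + p 2 * (q 1 ^ 2 + q 3 ^ 2 * h) +
          p 3 * (q 2 * (q 0 ^ 2 + q 2 ^ 2 * h) + q 0 * (q 1 ^ 2 + q 3 ^ 2 * h))) ^ 2 =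
      (p 1 * p 3 + p 2 ^ 2) * (q 1 ^ 2 + q 3 ^ 2 * h) ^ 2 +
        (q 1 * q 3 + q 2 ^ 2) * (p 1 ^ 2 + p 3 ^ 2 * g) := by
    rw [hqg, sum_fourth_eq]
    simp only [e1, mul_pow]
    linear_combination (p 1 * p 3 * q 1 * q 3 * (q 0 ^ 2 + q 2 ^ 2 * h) +
      p 3 ^ 2 * q 0 ^ 2 * (q 1 ^ 2 + q 3 ^ 2 * h) ^ 2 + p 1 * q 1 ^ 2 * p 3 * h * q 3 ^ 2 +
      q 1 * p 3 ^ 2 * q 0 ^ 2 * q 2 ^ 2 * h * q 3 - q 1 ^ 2 * p 3 ^ 2 * q 0 ^ 2 * h * q 3 ^ 2 +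
      q 1 ^ 2 * p 3 ^ 2 * q 2 ^ 2 * h ^ 2 * q 3 ^ 2 + q 1 ^ 3 * p 3 ^ 2 * h ^ 2 * q 3 ^ 3) * h2
  simp only [Matrix.cons_val]
  rw [eden, enum]
  field_simp

theorem symbol_symm {f g : K} {p q : Fin 4 → K} (hp : IsExpansion f g p)
    (hq : IsExpansion g f q) (hf : f ∈ separableMorphisms k (K := K))
    (hg : g ∈ separableMorphisms k (K := K)) : (symbol f g : Ω[K⁄k]) = symbol g f := by
  apply differential_eq_of_add_eq_zero
  rw [symbol_add_symbol hp hq hf hg hf, symbol_self hf]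

/-- `1, g` generate the field `F` over its subfield of squares. -/
def SqGenerates (F : IntermediateField k K) (g : K) : Prop :=
  g ∈ F ∧ ∀ z ∈ F, ∃ u ∈ F, ∃ w ∈ F, z = u ^ 2 + w ^ 2 * g

theorem SqGenerates.expansion {F : IntermediateField k K} {g : K} (hg : SqGenerates F g) {z : K}
    (hz : z ∈ F) : ∃ c : Fin 4 → K, (∀ i, c i ∈ F) ∧ IsExpansion z g c := by
  obtain ⟨u, hu, w, hw, rfl⟩ := hg.2 z hz
  obtain ⟨c₀, h₀, c₂, h₂, rfl⟩ := hg.2 u hu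
  obtain ⟨c₁, h₁, c₃, h₃, rfl⟩ := hg.2 w hw
  refine ⟨![c₀, c₁, c₂, c₃], fun i => by fin_cases i <;> assumption, ?_⟩
  simp only [IsExpansion, Matrix.cons_val]
  rw [sum_fourth_eq]

/-- If `t = p² + q² g`, then `dt = q² dg`, so `q ≠ 0` and the relation can be solved for `g` in
terms of `t`. -/
theorem SqGenerates.of_D_ne_zero {F : IntermediateField k K} {g t : K} (hg : SqGenerates F g)
    (ht : t ∈ F) (hD : t ∈ separableMorphisms k (K := K)) : SqGenerates F t := by
  obtain ⟨p, hp, q, hq, e⟩ := hg.2 t ht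
  have hq0 : q ≠ 0 := by
    rintro rfl
    exact hD (by rw [e, D_sq_add_sq_mul]; simp)
  have e' : g = (p / q) ^ 2 + (1 / q) ^ 2 * t := by
    rw [e]
    field_simp
    linear_combination (-p ^ 2) * CharTwo.two_eq_zero (R := K)
  refine ⟨ht, fun z hz => ?_⟩
  obtain ⟨u, hu, w, hw, rfl⟩ := hg.2 z hz
  refine ⟨u + w * (p / q), add_mem hu (mul_mem hw (div_mem hp hq)), w / q, div_mem hw hq, ?_⟩
  rw [e', add_pow_char u _ 2]
  ring

/-- A field generated over the perfect field `k` by a set of elements of the form `u² + w² g` is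
generated by `1, g` over its squares. -/
theorem sqGenerates_adjoin [PerfectField k] {S : Set K} {g : K}
    (hg : g ∈ IntermediateField.adjoin k S)
    (hS : ∀ z ∈ S, ∃ u ∈ IntermediateField.adjoin k S, ∃ w ∈ IntermediateField.adjoin k S,
      z = u ^ 2 + w ^ 2 * g) : SqGenerates (IntermediateField.adjoin k S) g := by
  have : CharP k 2 := by
    rw [(algebraMap k K).charP_iff (algebraMap k K).injective 2]; infer_instance
  refine ⟨hg, fun z hz => ?_⟩
  set F := IntermediateField.adjoin k S
  induction hz using IntermediateField.adjoin_induction with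
  | mem z hz => exact hS z hz
  | algebraMap c =>
    have : ExpChar k 2 := .prime Nat.prime_two
    obtain ⟨e, rfl⟩ := (PerfectRing.bijective_frobenius (R := k) (p := 2)).2 c
    exact ⟨algebraMap k K e, F.algebraMap_mem e, 0, zero_mem _, by simp⟩
  | add z z' _ _ h h' =>
    obtain ⟨u, hu, w, hw, rfl⟩ := h
    obtain ⟨u', hu', w', hw', rfl⟩ := h'
    exact ⟨_, add_mem hu hu', _, add_mem hw hw', sq_add_sq_mul_add ..⟩
  | mul z z' _ _ h h' =>
    obtain ⟨u, hu, w, hw, rfl⟩ := h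
    obtain ⟨u', hu', w', hw', rfl⟩ := h'
    exact ⟨_, add_mem (mul_mem hu hu') (mul_mem (mul_mem hw hw') hg), _,
      add_mem (mul_mem hu hw') (mul_mem hw hu'), sq_add_sq_mul_mul ..⟩
  | inv z hz h =>
    obtain ⟨u, hu, w, hw, e⟩ := h
    rcases eq_or_ne z 0 with rfl | h0
    · exact ⟨0, zero_mem _, 0, zero_mem _, by simp⟩
    -- The inverse of `z` is `z / z²`, so dividing `u` and `w` by `z` suffices.
    · refine ⟨u / z, div_mem hu hz, w / z, div_mem hw hz, ?_⟩
      field_simp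
      exact e

theorem sqGenerates_adjoin_simple [PerfectField k] (f : K) : SqGenerates k⟮f⟯ f :=
  sqGenerates_adjoin (IntermediateField.mem_adjoin_simple_self k f) fun z hz =>
    ⟨0, zero_mem _, 1, one_mem _, by rw [Set.mem_singleton_iff.1 hz]; ring⟩

end Algebra
end SYCurve

namespace SYCurve

/-! ### Orders with respect to a uniformizer of a subfield. -/

section Uniformizer

variable {k K : Type*} [Field k] [Field K] [Algebra k K]

/-- `t ∈ F` generates the value group of the restriction to `F` of the valuation of `P`. -/
structure Place.IsUniformizerOn (P : Place k K) (F : IntermediateField k K) (t : K) : Prop where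
  mem : t ∈ F
  ne_zero : t ≠ 0
  lt_one : P.localRing.valuation t < 1
  exists_zpow : ∀ z ∈ F, z ≠ 0 → ∃ n : ℤ, P.localRing.valuation z = P.localRing.valuation t ^ n

variable {P : Place k K} {F : IntermediateField k K} {t : K}

theorem Place.mem_iff (P : Place k K) (z : K) :
    z ∈ P.localRing ↔ P.localRing.valuation z ≤ 1 :=
  (P.localRing.valuation_le_one_iff z).symm

theorem Place.algebraMap_mem (P : Place k K) (c : k) : algebraMap k K c ∈ P.localRing :=
  P.algebraMap_mem' c

theorem Place.valuation_algebraMap (P : Place k K) {c : k} (hc : c ≠ 0) :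
    P.localRing.valuation (algebraMap k K c) = 1 := by
  apply le_antisymm ((P.mem_iff _).1 (P.algebraMap_mem c))
  have := (P.mem_iff _).1 (P.algebraMap_mem c⁻¹)
  rw [map_inv₀, map_inv₀] at this
  have h0 : P.localRing.valuation (algebraMap k K c) ≠ 0 := by simpa using hc
  exact (inv_le_one₀ (zero_lt_iff.2 h0)).1 this

namespace Place.IsUniformizerOn

local notation "v" => P.localRing.valuation

variable (h : P.IsUniformizerOn F t)
include h

theorem val_pos : 0 < v t := zero_lt_iff.2 ((Valuation.ne_zero_iff _).2 h.ne_zero)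

theorem zpow_le_zpow_iff {m n : ℤ} : v t ^ m ≤ v t ^ n ↔ n ≤ m :=
  zpow_le_zpow_iff_right_of_lt_one₀ h.val_pos h.lt_one

theorem zpow_lt_zpow_iff {m n : ℤ} : v t ^ m < v t ^ n ↔ n < m :=
  zpow_lt_zpow_iff_right_of_lt_one₀ h.val_pos h.lt_one

theorem zpow_inj {m n : ℤ} : v t ^ m = v t ^ n ↔ m = n := by
  rw [le_antisymm_iff, h.zpow_le_zpow_iff, h.zpow_le_zpow_iff, le_antisymm_iff, and_comm]

theorem zpow_pos (n : ℤ) : 0 < v t ^ n := _root_.zpow_pos h.val_pos n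

theorem le_zpow_succ_iff {z : K} (hz : z ∈ F) (n : ℤ) : v z ≤ v t ^ (n + 1) ↔ v z < v t ^ n := by
  rcases eq_or_ne z 0 with rfl | h0
  · simp [h.zpow_pos]
  · obtain ⟨i, hi⟩ := h.exists_zpow z hz h0
    rw [hi, h.zpow_le_zpow_iff, h.zpow_lt_zpow_iff]
    omega

theorem sq_le_iff {z : K} (hz : z ∈ F) {m n : ℤ} (hm : m = 2 * n ∨ m + 1 = 2 * n) :
    v (z ^ 2) ≤ v t ^ m ↔ v z ≤ v t ^ n := by
  rcases eq_or_ne z 0 with rfl | h0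
  · simp [(h.zpow_pos _).le]
  · obtain ⟨i, hi⟩ := h.exists_zpow z hz h0
    rw [map_pow, hi, ← zpow_natCast, ← zpow_mul, h.zpow_le_zpow_iff, h.zpow_le_zpow_iff]
    push_cast
    omega

theorem sq_mul_le_iff {z : K} (hz : z ∈ F) {m n : ℤ} (hm : m = 2 * n ∨ m = 2 * n + 1) :
    v (z ^ 2 * t) ≤ v t ^ m ↔ v z ≤ v t ^ n := by
  rcases eq_or_ne z 0 with rfl | h0
  · simp [(h.zpow_pos _).le]
  · obtain ⟨i, hi⟩ := h.exists_zpow z hz h0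
    rw [map_mul, map_pow, hi, ← zpow_natCast, ← zpow_mul, ← zpow_add_one₀ h.val_pos.ne',
      h.zpow_le_zpow_iff, h.zpow_le_zpow_iff]
    push_cast
    omega

/-- In powers of `t` the first term has even order and the second odd order, so they never cancel.
All local estimates below depend on this. -/
theorem val_sq_add_sq_mul {u w : K} (hu : u ∈ F) (hw : w ∈ F) :
    v (u ^ 2 + w ^ 2 * t) = max (v (u ^ 2)) (v (w ^ 2 * t)) := by
  rcases eq_or_ne u 0 with rfl | hu0
  · simp
  rcases eq_or_ne w 0 with rfl | hw0
  · simp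
  obtain ⟨i, hi⟩ := h.exists_zpow u hu hu0
  obtain ⟨j, hj⟩ := h.exists_zpow w hw hw0
  apply Valuation.map_add_of_distinct_val
  rw [map_mul, map_pow, map_pow, hi, hj, ← zpow_natCast, ← zpow_natCast, ← zpow_mul, ← zpow_mul,
    ← zpow_add_one₀ h.val_pos.ne', Ne, h.zpow_inj]
  push_cast
  omega

theorem le_even_iff {u w : K} (hu : u ∈ F) (hw : w ∈ F) (n : ℤ) :
    v (u ^ 2 + w ^ 2 * t) ≤ v t ^ (2 * n) ↔ v u ≤ v t ^ n ∧ v w ≤ v t ^ n := by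
  rw [h.val_sq_add_sq_mul hu hw, max_le_iff, h.sq_le_iff hu (Or.inl rfl),
    h.sq_mul_le_iff hw (Or.inl rfl)]

theorem le_odd_iff {u w : K} (hu : u ∈ F) (hw : w ∈ F) (n : ℤ) :
    v (u ^ 2 + w ^ 2 * t) ≤ v t ^ (2 * n + 1) ↔ v u ≤ v t ^ (n + 1) ∧ v w ≤ v t ^ n := by
  rw [h.val_sq_add_sq_mul hu hw, max_le_iff, h.sq_le_iff hu (n := n + 1) (Or.inr (by ring)),
    h.sq_mul_le_iff hw (Or.inr rfl)]

theorem le_one_iff {u w : K} (hu : u ∈ F) (hw : w ∈ F) :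
    v (u ^ 2 + w ^ 2 * t) ≤ 1 ↔ v u ≤ 1 ∧ v w ≤ 1 := by
  simpa using h.le_even_iff hu hw 0

theorem val_mul_le {y z : K} {m n : ℤ} (hy : v y ≤ v t ^ m) (hz : v z ≤ v t ^ n) :
    v (y * z) ≤ v t ^ (m + n) := by
  rw [map_mul, zpow_add₀ h.val_pos.ne']
  exact mul_le_mul' hy hz

/-- The order `N` of the denominator bounds the orders of `c 1` and `c 3` so that `c 1 * c 3` has
order at least `N`. The quotient `(N + 1) / 2` is `N / 2` rounded up, which is what makes `c 2 ^ 2`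
have order at least `N`. -/
theorem val_symbolCoeff_le_one {c : Fin 4 → K} (hc : ∀ i, c i ∈ F) {N : ℤ}
    (hN : v (c 1 ^ 2 + c 3 ^ 2 * t) = v t ^ N)
    (h2 : v (c 2) ≤ v t ^ ((N + 1) / 2)) : v (symbolCoeff t c) ≤ 1 := by
  have key : v (c 1 * c 3 + c 2 ^ 2) ≤ v t ^ N := by
    obtain ⟨n, rfl | rfl⟩ := Int.even_or_odd' N
    · obtain ⟨h1, h3⟩ := (h.le_even_iff (hc 1) (hc 3) n).1 hN.le
      have e : (2 * n + 1) / 2 = n := by omega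
      rw [e] at h2
      exact Valuation.map_add_le _ (by simpa [two_mul] using h.val_mul_le h1 h3)
        ((h.sq_le_iff (hc 2) (Or.inl rfl)).2 h2)
    · obtain ⟨h1, h3⟩ := (h.le_odd_iff (hc 1) (hc 3) n).1 hN.le
      have e : (2 * n + 1 + 1) / 2 = n + 1 := by omega
      rw [e] at h2
      refine Valuation.map_add_le _ ?_ ((h.sq_le_iff (hc 2) (n := n + 1) (Or.inr (by ring))).2 h2)
      have := h.val_mul_le h1 h3
      rwa [show n + 1 + n = 2 * n + 1 by ring] at this
  rw [symbolCoeff, map_div₀, hN]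
  exact div_le_one_of_le₀ key (h.zpow_pos N).le

omit h in
theorem isUniformizerOn_top {ϖ : P.localRing}
    (hϖ : IsLocalRing.maximalIdeal P.localRing = Ideal.span {ϖ}) :
    P.IsUniformizerOn ⊤ (ϖ : K) := by
  have := P.isDVR'
  have hirr : Irreducible ϖ := (IsDiscreteValuationRing.irreducible_iff_uniformizer ϖ).2 hϖ
  have hlt : v (ϖ : K) < 1 := by
    rw [← ValuationSubring.valuation_lt_one_iff, hϖ]
    exact Ideal.mem_span_singleton_self ϖ
  have key : ∀ z : P.localRing, z ≠ 0 → ∃ n : ℕ, v (z : K) = v (ϖ : K) ^ n := by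
    intro z hz
    obtain ⟨n, u, rfl⟩ := IsDiscreteValuationRing.eq_unit_mul_pow_irreducible hz hirr
    refine ⟨n, ?_⟩
    have hu := P.localRing.valuation_eq_one_iff (u : P.localRing)
    simp [hu.1 u.isUnit]
  refine ⟨trivial, by simpa using hirr.ne_zero, hlt, fun z _ hz => ?_⟩
  rcases P.localRing.mem_or_inv_mem z with hm | hm
  · obtain ⟨n, hn⟩ := key ⟨z, hm⟩ fun h0 => hz (congrArg Subtype.val h0)
    exact ⟨n, by simpa using hn⟩
  · obtain ⟨n, hn⟩ := key ⟨z⁻¹, hm⟩ fun h0 => inv_ne_zero hz (congrArg Subtype.val h0)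
    refine ⟨-n, ?_⟩
    rw [map_inv₀] at hn
    rw [zpow_neg, zpow_natCast, ← hn, inv_inv]

omit h in
theorem exists_isUniformizerOn_top (P : Place k K) : ∃ τ, P.IsUniformizerOn ⊤ τ := by
  have := P.isDVR'
  obtain ⟨ϖ, hϖ⟩ := IsDiscreteValuationRing.exists_irreducible P.localRing
  exact ⟨_, isUniformizerOn_top ((IsDiscreteValuationRing.irreducible_iff_uniformizer ϖ).1 hϖ)⟩

/-- Each value is an integral power of the other; the exponents have product one and are positive.
-/
theorem val_eq_val {t' : K} (h' : P.IsUniformizerOn F t') : v t = v t' := by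
  obtain ⟨m, hm⟩ := h.exists_zpow t' h'.mem h'.ne_zero
  obtain ⟨n, hn⟩ := h'.exists_zpow t h.mem h.ne_zero
  have e : v t ^ (m * n) = v t ^ (1 : ℤ) := by rw [zpow_mul, ← hm, ← hn, zpow_one]
  have hmn := h.zpow_inj.1 e
  have hm1 : 0 < m := by
    have := h'.lt_one
    rw [hm, ← zpow_zero (v t), h.zpow_lt_zpow_iff] at this
    exact this
  have : m = 1 := Int.eq_one_of_mul_eq_one_right hm1.le hmn
  rw [hm, this, zpow_one]

end Place.IsUniformizerOn

theorem Place.hasOrder_iff {τ : K} (h : P.IsUniformizerOn ⊤ τ) (z : K) (n : ℤ) :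
    P.HasOrder z n ↔ P.localRing.valuation z = P.localRing.valuation τ ^ n := by
  constructor
  · rintro ⟨ϖ, hϖ, e⟩
    rw [e, (IsUniformizerOn.isUniformizerOn_top hϖ).val_eq_val h]
  · intro e
    have := P.isDVR'
    obtain ⟨ϖ, hϖ⟩ := IsDiscreteValuationRing.exists_irreducible P.localRing
    have hϖ' := (IsDiscreteValuationRing.irreducible_iff_uniformizer ϖ).1 hϖ
    exact ⟨ϖ, hϖ', by rw [e, (IsUniformizerOn.isUniformizerOn_top hϖ').val_eq_val h]⟩

end Uniformizer

/-! ### Which differentials have a regular potential at a point. -/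

section LocalExactness

variable {k K : Type*} [Field k] [Field K] [Algebra k K] [CharP K 2]

local notation "d" => KaehlerDifferential.D k K

/-- `ω` is the differential of a function that is regular at `P`. -/
def Place.IsExactAt (P : Place k K) (ω : Ω[K⁄k]) : Prop :=
  ∃ s ∈ P.localRing, d s = ω

omit [CharP K 2] in
theorem mem_sectionsB_iff {U : Set (Place k K)} {ω : Ω[K⁄k]} :
    ω ∈ sectionsB U ↔ ∀ P ∈ U, P.IsExactAt ω := Iff.rfl

omit [CharP K 2] in
theorem Place.IsExactAt.add {P : Place k K} {ω η : Ω[K⁄k]} (hω : P.IsExactAt ω)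
    (hη : P.IsExactAt η) : P.IsExactAt (ω + η) := by
  obtain ⟨s, hs, rfl⟩ := hω
  obtain ⟨s', hs', rfl⟩ := hη
  exact ⟨s + s', add_mem hs hs', map_add _ _ _⟩

theorem Place.IsExactAt.add_iff_left {P : Place k K} {ω η : Ω[K⁄k]} (hη : P.IsExactAt η) :
    P.IsExactAt (ω + η) ↔ P.IsExactAt ω := by
  refine ⟨fun h => ?_, fun h => h.add hη⟩
  have := h.add hη
  rwa [add_assoc, two_smul_differential, add_zero] at this

theorem Place.isExactAt_sq_smul {P : Place k K} {t γ : K} (ht : t ∈ P.localRing)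
    (hγ : P.localRing.valuation γ ≤ 1) : P.IsExactAt (γ ^ 2 • d t) :=
  ⟨γ ^ 2 * t, mul_mem (pow_mem ((P.mem_iff _).2 hγ) 2) ht, D_sq_mul _ _⟩

variable {P : Place k K} {F : IntermediateField k K} {t g : K}

namespace Place.IsUniformizerOn

omit [CharP K 2] in
theorem mem_localRing (h : P.IsUniformizerOn F t) : t ∈ P.localRing :=
  (P.mem_iff _).2 h.lt_one.le

/-- Otherwise `t` would be a square in `F`, hence of even order with respect to itself. -/
theorem mem_separableMorphisms (h : P.IsUniformizerOn F t) (hF : SqGenerates F g)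
    (hg : g ∈ separableMorphisms k (K := K)) : t ∈ separableMorphisms k (K := K) := by
  obtain ⟨p, hp, q, -, e⟩ := hF.2 t h.mem
  have hq0 : q ≠ 0 := by
    rintro rfl
    have ep : t = p ^ 2 := by simpa using e
    have hp0 : p ≠ 0 := by
      rintro rfl
      exact h.ne_zero (by simpa using ep)
    obtain ⟨n, hn⟩ := h.exists_zpow p hp hp0
    have e2 : P.localRing.valuation t ^ (1 : ℤ) = P.localRing.valuation t ^ (n * 2) := by
      rw [zpow_mul, ← hn, zpow_one]
      conv_lhs => rw [ep, map_pow]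
      rfl
    have := h.zpow_inj.1 e2
    omega
  change d t ≠ 0
  rw [e, D_sq_add_sq_mul]
  exact smul_ne_zero (pow_ne_zero _ hq0) hg

/-- A potential `u² + w² t` is regular only if `u` and `w` both are, and its differential is `w²
dt`; so γ is the regular function `w`. -/
theorem isExactAt_iff (h : P.IsUniformizerOn ⊤ t) (hK : SqGenerates (⊤ : IntermediateField k K) t)
    (ht : t ∈ separableMorphisms k (K := K)) (γ : K) :
    P.IsExactAt (γ ^ 2 • d t) ↔ P.localRing.valuation γ ≤ 1 := by
  refine ⟨?_, P.isExactAt_sq_smul h.mem_localRing⟩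
  rintro ⟨s, hs, e⟩
  obtain ⟨u, hu, w, hw, rfl⟩ := hK.2 s trivial
  rw [D_sq_add_sq_mul] at e
  rw [← sq_smul_D_injective (k := k) ht e]
  exact ((h.le_one_iff hu hw).1 ((P.mem_iff _).1 hs)).2

/-- A function that has odd order after adding a fourth power has a regular symbol. -/
theorem val_symbolCoeff_le_one_of_odd (h : P.IsUniformizerOn ⊤ t) {s z : K} {c : Fin 4 → K}
    (hc : IsExpansion s t c) {M : ℤ} (hM : Odd M)
    (hs : P.localRing.valuation (s + z ^ 4) = P.localRing.valuation t ^ M) :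
    P.localRing.valuation (symbolCoeff t c) ≤ 1 := by
  obtain ⟨N, rfl⟩ := hM
  have hfourth := add_pow_char_pow (R := K) (p := 2) (n := 2) (c 0) z
  norm_num at hfourth
  -- Write this as U² + W² t. Odd order `2N + 1` must come from the second term, so `W`, the
  -- denominator of the symbol, has order exactly `N`, while `U` has order at least `N + 1`, which
  -- bounds `c 2`.
  have e : s + z ^ 4 = ((c 0 + z) ^ 2 + c 2 ^ 2 * t) ^ 2 + (c 1 ^ 2 + c 3 ^ 2 * t) ^ 2 * t := by
    rw [← sum_fourth_eq, hfourth, hc]; ring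
  rw [e] at hs
  obtain ⟨h1, h2⟩ := (h.le_odd_iff trivial trivial N).1 hs.le
  have hN : P.localRing.valuation (c 1 ^ 2 + c 3 ^ 2 * t) = P.localRing.valuation t ^ N := by
    refine le_antisymm h2 (not_lt.1 fun hlt => ?_)
    have h3 := (h.le_even_iff trivial trivial (N + 1)).2
      ⟨h1, (h.le_zpow_succ_iff trivial N).2 hlt⟩
    rw [hs, h.zpow_le_zpow_iff] at h3
    omega
  refine h.val_symbolCoeff_le_one (fun _ => trivial) hN ?_
  obtain ⟨n, rfl | rfl⟩ := Int.even_or_odd' N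
  · rw [show (2 * n + 1) / 2 = n by omega]
    exact ((h.le_odd_iff trivial trivial n).1 h1).2
  · rw [show (2 * n + 1 + 1) / 2 = n + 1 by omega]
    rw [show 2 * n + 1 + 1 = 2 * (n + 1) by ring] at h1
    exact ((h.le_even_iff trivial trivial (n + 1)).1 h1).2

/-- If `dt` is a regular multiple of `df`, then `f` has a regular symbol. -/
theorem val_symbolCoeff_le_one_of_D_eq (h : P.IsUniformizerOn F t)
    (ht : t ∈ separableMorphisms k (K := K)) {f r : K} {c : Fin 4 → K} (hcF : ∀ i, c i ∈ F)
    (hc : IsExpansion f t c) (hf : f ∈ P.localRing) (hr : r ∈ P.localRing)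
    (hD : d t = r • d f) :
    P.localRing.valuation (c 1 ^ 2 + c 3 ^ 2 * t) = 1 ∧
      P.localRing.valuation (symbolCoeff t c) ≤ 1 := by
  have hm : ∀ i j, c i ^ 2 + c j ^ 2 * t ∈ F := fun i j =>
    add_mem (pow_mem (hcF i) 2) (mul_mem (pow_mem (hcF j) 2) h.mem)
  have e : f = (c 0 ^ 2 + c 2 ^ 2 * t) ^ 2 + (c 1 ^ 2 + c 3 ^ 2 * t) ^ 2 * t := by
    rw [← sum_fourth_eq, hc]
  have hf' := (P.mem_iff _).1 hf
  rw [e] at hf'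
  obtain ⟨h1, h2⟩ := (h.le_one_iff (hm 0 2) (hm 1 3)).1 hf'
  -- Comparing coefficients of `dt` gives `1 = r ρ²` with `r` and `ρ` regular, so `ρ` is a unit.
  have hρ : P.localRing.valuation (c 1 ^ 2 + c 3 ^ 2 * t) = 1 := by
    rw [hc.D_eq, smul_smul] at hD
    have h1 : (1 : K) = r * (c 1 ^ 2 + c 3 ^ 2 * t) ^ 2 :=
      smul_left_injective K (m := d t) ht (by simpa using hD)
    have h3 := congrArg P.localRing.valuation h1
    rw [map_one, map_mul, map_pow] at h3
    by_contra hne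
    have hlt := pow_lt_one₀ zero_le (lt_of_le_of_ne h2 hne) two_ne_zero
    have := mul_lt_one_of_nonneg_of_lt_one_right ((P.mem_iff _).1 hr) zero_le hlt
    exact this.ne h3.symm
  refine ⟨hρ, h.val_symbolCoeff_le_one hcF (N := 0) (by simpa using hρ) ?_⟩
  simpa using ((h.le_one_iff (hcF 0) (hcF 2)).1 h1).2

/-- If the symbol of `z` is regular and `dz` vanishes to order at most two, then the order of `z`
is odd, when it is positive. -/
theorem exists_odd_order (h : P.IsUniformizerOn ⊤ t) {z : K} {c : Fin 4 → K}
    (hc : IsExpansion z t c) (hz : P.localRing.valuation z < 1)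
    (hs : P.localRing.valuation (symbolCoeff t c) ≤ 1)
    (hρ : P.localRing.valuation t ≤ P.localRing.valuation (c 1 ^ 2 + c 3 ^ 2 * t)) :
    ∃ e : ℕ, Odd e ∧ P.localRing.valuation z = P.localRing.valuation t ^ e := by
  have e : z = (c 0 ^ 2 + c 2 ^ 2 * t) ^ 2 + (c 1 ^ 2 + c 3 ^ 2 * t) ^ 2 * t := by
    rw [← sum_fourth_eq, hc]
  have hz1 : P.localRing.valuation z ≤ P.localRing.valuation t ^ (2 * 0 + 1 : ℤ) := by
    have := (h.le_zpow_succ_iff (z := z) trivial 0).2 (by simpa using hz)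
    simpa using this
  rw [e] at hz1
  obtain ⟨h1, h2⟩ := (h.le_odd_iff trivial trivial 0).1 hz1
  rw [zpow_zero] at h2
  rcases h2.eq_or_lt with h2 | h2
  -- Here the coefficient `c 1 ^ 2 + c 3 ^ 2 * t` is a unit, so `z` has order one.
  · refine ⟨1, odd_one, ?_⟩
    rw [e]
    refine le_antisymm (by simpa using hz1) (not_lt.1 fun hlt => ?_)
    have h3 := (h.le_zpow_succ_iff (z := z) trivial 1).2 (by rw [e]; simpa using hlt)
    rw [e] at h3
    have h4 := ((h.le_even_iff trivial trivial 1).1 (by simpa using h3)).2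
    rw [h2, zpow_one] at h4
    exact absurd h.lt_one (not_lt.2 h4)
  -- Here that coefficient has order exactly one. Regularity of the symbol then forces `c 2` to
  -- vanish, so the square part of `z` has order at least four, and the order of `z` is that of the
  -- other part: 2 + 1 = 3.
  · have h2' := (h.le_zpow_succ_iff (z := c 1 ^ 2 + c 3 ^ 2 * t) trivial 0).2 (by simpa using h2)
    have hρ1 : P.localRing.valuation (c 1 ^ 2 + c 3 ^ 2 * t) = P.localRing.valuation t ^ (1 : ℤ) :=
      le_antisymm (by simpa using h2') (by simpa using hρ)
    obtain ⟨hc1, hc3⟩ := (h.le_odd_iff trivial trivial 0).1 (by simpa using hρ1.le)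
    have hρ0 : c 1 ^ 2 + c 3 ^ 2 * t ≠ 0 := by
      intro h0
      rw [h0, map_zero] at hρ1
      exact (h.zpow_pos 1).ne hρ1
    have hnum : P.localRing.valuation (c 1 * c 3 + c 2 ^ 2) ≤ P.localRing.valuation t ^ (1 : ℤ) := by
      have e2 : c 1 * c 3 + c 2 ^ 2 = symbolCoeff t c * (c 1 ^ 2 + c 3 ^ 2 * t) := by
        rw [symbolCoeff, div_mul_cancel₀ _ hρ0]
      rw [e2]
      simpa using h.val_mul_le (m := 0) (by simpa using hs) hρ1.le
    have hc2 : P.localRing.valuation (c 2) ≤ P.localRing.valuation t ^ (1 : ℤ) := by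
      rw [← h.sq_le_iff (z := c 2) trivial (m := 1) (n := 1) (Or.inr rfl)]
      have e3 : c 2 ^ 2 = (c 1 * c 3 + c 2 ^ 2) - c 1 * c 3 := by ring
      rw [e3]
      exact Valuation.map_sub_le _ hnum (by simpa using h.val_mul_le hc1 hc3)
    have hc0 := ((h.le_odd_iff trivial trivial 0).1 (by simpa using h1)).1
    have hu : P.localRing.valuation (c 0 ^ 2 + c 2 ^ 2 * t) ≤ P.localRing.valuation t ^ (2 : ℤ) :=
      (h.le_even_iff trivial trivial 1).2 ⟨by simpa using hc0, hc2⟩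
    refine ⟨3, by decide, ?_⟩
    rw [e]
    refine le_antisymm ?_ (not_lt.1 fun hlt => ?_)
    · have := (h.le_odd_iff trivial trivial 1).2 ⟨hu, hρ1.le⟩
      exact_mod_cast this
    · have h3 := (h.le_zpow_succ_iff (z := z) trivial 3).2 (by rw [e]; exact_mod_cast hlt)
      rw [e] at h3
      have h4 := ((h.le_even_iff trivial trivial 2).1 (by simpa using h3)).2
      rw [hρ1, h.zpow_le_zpow_iff] at h4
      omega

end Place.IsUniformizerOn

end LocalExactness
end SYCurve

namespace SYCurve

/-! ### The local ring of the projective line at the image point. -/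

section Target

variable {k K : Type*} [Field k] [Field K] [Algebra k K]

local notation "d" => KaehlerDifferential.D k K

theorem D_aeval (p : Polynomial k) (f : K) :
    d (Polynomial.aeval f p) = Polynomial.aeval f (Polynomial.derivative p) • d f := by
  simp

theorem Place.aeval_mem (P : Place k K) {f : K} (hf : f ∈ P.localRing) (p : Polynomial k) :
    Polynomial.aeval f p ∈ P.localRing := by
  induction p using Polynomial.induction_on' with
  | add p q hp hq => rw [map_add]; exact add_mem hp hq
  | monomial n c =>
    rw [Polynomial.aeval_monomial]
    exact mul_mem (P.algebraMap_mem c) (pow_mem hf n)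

theorem D_div (n s : K) (hs : s ≠ 0) : d (n / s) = (1 / s ^ 2) • (s • d n - n • d s) := by
  have h : d n = s • d (n / s) + (n / s) • d s := by
    rw [← Derivation.leibniz, mul_div_cancel₀ _ hs]
  rw [h, smul_add, smul_smul, smul_smul, mul_div_cancel₀ _ hs, add_sub_cancel_right, smul_smul]
  field_simp
  simp

/-- If `n`, `s` are regular at `P` with regular derivatives with respect to `g`, and `s` does not
vanish at `P`, then `n / s` has a regular derivative with respect to `g`. -/
theorem Place.exists_D_div (P : Place k K) {n s g n' s' : K} (hn : n ∈ P.localRing)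
    (hs : P.localRing.valuation s = 1) (hn' : n' ∈ P.localRing) (hs' : s' ∈ P.localRing)
    (hdn : d n = n' • d g) (hds : d s = s' • d g) :
    ∃ r ∈ P.localRing, d (n / s) = r • d g := by
  have hs0 : s ≠ 0 := by
    rintro rfl
    simp at hs
  have hsO : s ∈ P.localRing := (P.mem_iff s).2 hs.le
  refine ⟨1 / s ^ 2 * (s * n' - n * s'), mul_mem ?_ (sub_mem (mul_mem hsO hn') (mul_mem hn hs')), ?_⟩
  · rw [P.mem_iff]
    simp [hs]
  · rw [D_div n s hs0, hdn, hds, smul_smul, smul_smul, ← sub_smul, smul_smul]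

/-- A rational function of `f` is a quotient of coprime polynomials in `f`. -/
theorem exists_coprime_of_mem_adjoin_simple {f t : K} (ht : t ∈ k⟮f⟯) (ht0 : t ≠ 0) :
    ∃ p q : Polynomial k, IsCoprime p q ∧ Polynomial.aeval f q ≠ 0 ∧
      t = Polynomial.aeval f p / Polynomial.aeval f q := by
  classical
  obtain ⟨r, s, rfl⟩ := (IntermediateField.mem_adjoin_simple_iff k t).1 ht
  have hs : Polynomial.aeval f s ≠ 0 := fun h => ht0 (by rw [h, div_zero])
  have hs0 : s ≠ 0 := by
    rintro rfl
    simp at hs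
  obtain ⟨r', hr'⟩ := EuclideanDomain.gcd_dvd_left r s
  obtain ⟨s', hs'⟩ := EuclideanDomain.gcd_dvd_right r s
  have hg : EuclideanDomain.gcd r s ≠ 0 := fun h => hs0 (EuclideanDomain.gcd_eq_zero_iff.1 h).2
  refine ⟨r', s', ?_, ?_, ?_⟩
  · refine ⟨EuclideanDomain.gcdA r s, EuclideanDomain.gcdB r s, ?_⟩
    have := EuclideanDomain.gcd_eq_gcd_ab r s
    apply mul_left_cancel₀ hg
    linear_combination -this + EuclideanDomain.gcdA r s * (-hr') - EuclideanDomain.gcdB r s * hs'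
  · intro h
    apply hs
    rw [hs', map_mul, h, mul_zero]
  · have hg' : Polynomial.aeval f (EuclideanDomain.gcd r s) ≠ 0 := by
      intro h
      apply hs
      rw [hs', map_mul, h, zero_mul]
    have e1 := congrArg (Polynomial.aeval f) hr'
    have e2 := congrArg (Polynomial.aeval f) hs'
    rw [map_mul] at e1 e2
    conv_lhs => rw [e1, e2, mul_div_mul_left _ _ hg']

theorem Place.valuation_lt_one_of_dvd (P : Place k K) {y z : K} (hy : P.localRing.valuation y < 1)
    (hz : z ∈ P.localRing) : P.localRing.valuation (z * y) < 1 := by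
  rw [map_mul]
  exact mul_lt_one_of_nonneg_of_lt_one_right ((P.mem_iff z).1 hz) zero_le hy

/-- If the denominator vanished at `P`, so would the numerator `p(f) = t q(f)`, and hence also `1`
by the Bézout relation. -/
theorem Place.valuation_eq_one_of_coprime (P : Place k K) {f t : K} (hf : f ∈ P.localRing)
    (ht : t ∈ P.localRing) {p q : Polynomial k} (hpq : IsCoprime p q)
    (hq : Polynomial.aeval f q ≠ 0) (e : t = Polynomial.aeval f p / Polynomial.aeval f q) :
    P.localRing.valuation (Polynomial.aeval f q) = 1 := by
  have hqO := P.aeval_mem hf q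
  by_contra hne
  have hlt := lt_of_le_of_ne ((P.mem_iff _).1 hqO) hne
  have hp : P.localRing.valuation (Polynomial.aeval f p) < 1 := by
    have : Polynomial.aeval f p = t * Polynomial.aeval f q := by rw [e, div_mul_cancel₀ _ hq]
    rw [this]
    exact P.valuation_lt_one_of_dvd hlt ht
  obtain ⟨u, w, huw⟩ := hpq
  have h1 := congrArg (Polynomial.aeval f) huw
  rw [map_add, map_mul, map_mul, map_one] at h1
  have := Valuation.map_add_lt P.localRing.valuation
    (P.valuation_lt_one_of_dvd hp (P.aeval_mem hf u))
    (P.valuation_lt_one_of_dvd hlt (P.aeval_mem hf w))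
  rw [h1, map_one] at this
  exact lt_irrefl _ this

/-- A coprime representation of `t` has a denominator that is a unit at `P`, and derivatives of
polynomials in `f` are again polynomials in `f`. -/
theorem Place.exists_D_eq_smul (P : Place k K) {f t : K} (hf : f ∈ P.localRing) (ht : t ∈ k⟮f⟯)
    (htO : t ∈ P.localRing) : ∃ r ∈ P.localRing, d t = r • d f := by
  rcases eq_or_ne t 0 with rfl | ht0
  · exact ⟨0, zero_mem _, by simp⟩
  obtain ⟨p, q, hpq, hq, e⟩ := exists_coprime_of_mem_adjoin_simple ht ht0
  have h1 := P.valuation_eq_one_of_coprime hf htO hpq hq e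
  rw [e]
  exact P.exists_D_div (P.aeval_mem hf p) h1 (P.aeval_mem hf _) (P.aeval_mem hf _)
    (D_aeval p f) (D_aeval q f)

/-- Strong induction on the order at `P`: an element of `k(f)` vanishing at `P` is divisible by `t`
within `k(f)`, and the quotient has smaller order. The hypothesis `t ≠ 0` excludes the degenerate
case in which no nonzero element of `k(f)` vanishes at `P`. -/
theorem Place.IsTargetUniformizer.isUniformizerOn {P : Place k K} {f t : K}
    (h : P.IsTargetUniformizer f t) (ht0 : t ≠ 0) : P.IsUniformizerOn k⟮f⟯ t := by
  obtain ⟨htF, ⟨s, hst, hs⟩, hdvd⟩ := h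
  have hlt : P.localRing.valuation t < 1 := by
    rw [← hst, ← ValuationSubring.valuation_lt_one_iff]; exact hs
  obtain ⟨τ, hτ⟩ := Place.IsUniformizerOn.exists_isUniformizerOn_top P
  obtain ⟨e, he⟩ := hτ.exists_zpow t trivial ht0
  have he0 : 0 < e := by
    rw [he, ← zpow_zero (P.localRing.valuation τ), hτ.zpow_lt_zpow_iff] at hlt
    exact hlt
  have key : ∀ n : ℕ, ∀ z ∈ k⟮f⟯, P.localRing.valuation z = P.localRing.valuation τ ^ (n : ℤ) →
      ∃ m : ℤ, P.localRing.valuation z = P.localRing.valuation t ^ m := by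
    intro n
    induction n using Nat.strong_induction_on with
    | _ n ih =>
      intro z hz hzn
      rcases Nat.eq_zero_or_pos n with rfl | hn
      · exact ⟨0, by simpa using hzn⟩
      have hz1 : P.localRing.valuation z < 1 := by
        rw [hzn, ← zpow_zero (P.localRing.valuation τ), hτ.zpow_lt_zpow_iff]
        exact_mod_cast hn
      obtain ⟨r, hrF, hr⟩ := hdvd ⟨z, (P.mem_iff z).2 hz1.le⟩ hz
        ((ValuationSubring.valuation_lt_one_iff _ _).2 hz1)
      change z = r * t at hr
      have hr0 : (r : K) ≠ 0 := by
        intro h0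
        rw [hr, h0, zero_mul, map_zero] at hzn
        exact (hτ.zpow_pos n).ne hzn
      obtain ⟨i, hi⟩ := hτ.exists_zpow r trivial hr0
      have hi0 : 0 ≤ i := by
        have := P.localRing.valuation_le_one r
        rw [hi, ← zpow_zero (P.localRing.valuation τ), hτ.zpow_le_zpow_iff] at this
        exact this
      have hsum : (n : ℤ) = i + e := by
        rw [hr, map_mul, hi, he, ← zpow_add₀ hτ.val_pos.ne', hτ.zpow_inj] at hzn
        exact hzn.symm
      obtain ⟨m, hm⟩ := ih i.toNat (by omega) r hrF (by rw [hi, Int.toNat_of_nonneg hi0])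
      refine ⟨m + 1, ?_⟩
      have hv0 : P.localRing.valuation t ≠ 0 := by simpa using ht0
      rw [hr, map_mul, hm, zpow_add_one₀ hv0]
  refine ⟨htF, ht0, hlt, fun z hz hz0 => ?_⟩
  obtain ⟨i, hi⟩ := hτ.exists_zpow z trivial hz0
  rcases le_total 0 i with h0 | h0
  · exact key i.toNat z hz (by rw [hi, Int.toNat_of_nonneg h0])
  · obtain ⟨m, hm⟩ := key (-i).toNat z⁻¹ (inv_mem hz) (by
      rw [map_inv₀, hi, Int.toNat_of_nonneg (by omega), zpow_neg])
    exact ⟨-m, by rw [zpow_neg, ← hm, map_inv₀, inv_inv]⟩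

/-- If `k(f)` contains a nonzero function vanishing at `P`, then it contains a uniformizer of the
target at `f(P)`. -/
theorem Place.exists_isTargetUniformizer (P : Place k K) {f s : K} (hs : s ∈ k⟮f⟯) (hs0 : s ≠ 0)
    (hlt : P.localRing.valuation s < 1) : ∃ t, t ≠ 0 ∧ P.IsTargetUniformizer f t := by
  classical
  obtain ⟨τ, hτ⟩ := Place.IsUniformizerOn.exists_isUniformizerOn_top P
  have hnat : ∀ z : K, z ≠ 0 → P.localRing.valuation z < 1 →
      ∃ n : ℕ, P.localRing.valuation z = P.localRing.valuation τ ^ (n : ℤ) := by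
    intro z hz0 hz
    obtain ⟨i, hi⟩ := hτ.exists_zpow z trivial hz0
    rw [hi, ← zpow_zero (P.localRing.valuation τ), hτ.zpow_lt_zpow_iff] at hz
    exact ⟨i.toNat, by rw [hi, Int.toNat_of_nonneg hz.le]⟩
  have hex : ∃ n : ℕ, ∃ z ∈ k⟮f⟯, z ≠ 0 ∧ P.localRing.valuation z < 1 ∧
      P.localRing.valuation z = P.localRing.valuation τ ^ (n : ℤ) := by
    obtain ⟨n, hn⟩ := hnat s hs0 hlt
    exact ⟨n, s, hs, hs0, hlt, hn⟩
  -- The uniformizer is an element of `k(f)` of least positive order at `P`.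
  obtain ⟨t, htF, ht0, ht1, hte⟩ := Nat.find_spec hex
  refine ⟨t, ht0, htF, ⟨⟨t, (P.mem_iff t).2 ht1.le⟩, rfl,
    (ValuationSubring.valuation_lt_one_iff _ _).2 ht1⟩, fun z hz hzm => ?_⟩
  have hle : P.localRing.valuation z ≤ P.localRing.valuation t := by
    rcases eq_or_ne (z : K) 0 with h0 | h0
    · rw [h0, map_zero]; exact zero_le
    have hz1 := (ValuationSubring.valuation_lt_one_iff _ _).1 hzm
    obtain ⟨m, hm⟩ := hnat z h0 hz1
    rw [hm, hte, hτ.zpow_le_zpow_iff]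
    exact_mod_cast Nat.find_min' hex ⟨z, hz, h0, hz1, hm⟩
  refine ⟨⟨z / t, (P.mem_iff _).2 ?_⟩, div_mem hz htF, (div_mul_cancel₀ _ ht0).symm⟩
  rw [map_div₀]
  exact div_le_one_of_le₀ hle zero_le

/-- This turns tameness into a computation: the ramification index is the order at `P` of a
uniformizer of the target. -/
theorem Place.IsTargetUniformizer.pullbackIdeal_eq {P : Place k K} {f t τ : K}
    (h : P.IsTargetUniformizer f t) (hτ : P.IsUniformizerOn ⊤ τ) {e : ℕ}
    (he : P.localRing.valuation t = P.localRing.valuation τ ^ e) :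
    P.pullbackIdeal f = IsLocalRing.maximalIdeal P.localRing ^ e := by
  have := P.isDVR'
  obtain ⟨ϖ, hϖ⟩ := IsDiscreteValuationRing.exists_irreducible P.localRing
  have hϖ' := (IsDiscreteValuationRing.irreducible_iff_uniformizer ϖ).1 hϖ
  have hu := Place.IsUniformizerOn.isUniformizerOn_top hϖ'
  obtain ⟨htF, ⟨s, hst, hs⟩, hdvd⟩ := h
  have e1 : P.pullbackIdeal f = Ideal.span {s} := by
    apply le_antisymm
    · refine Ideal.span_le.2 fun z hz => ?_
      obtain ⟨r, -, hr⟩ := hdvd z hz.1 hz.2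
      refine Ideal.mem_span_singleton'.2 ⟨r, ?_⟩
      apply Subtype.ext
      rw [hr, ← hst]
      rfl
    · rw [Ideal.span_singleton_le_iff_mem]
      exact Ideal.subset_span ⟨by rw [hst]; exact htF, hs⟩
  rw [e1, hϖ', Ideal.span_singleton_pow]
  have hv : P.localRing.valuation s = P.localRing.valuation ((ϖ ^ e : P.localRing) : K) := by
    rw [hst, he, hτ.val_eq_val hu]
    simp
  have hϖe : ((ϖ ^ e : P.localRing) : K) ≠ 0 := by
    simpa using pow_ne_zero e hu.ne_zero
  have hs0 : (s : K) ≠ 0 := by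
    intro h0
    rw [h0, map_zero] at hv
    exact hϖe (by simpa using hv.symm)
  have hdiv : ∀ y z : P.localRing, (y : K) ≠ 0 →
      P.localRing.valuation z = P.localRing.valuation y → y ∣ z := by
    intro y z hy hyz
    refine ⟨⟨z / y, (P.mem_iff _).2 ?_⟩, ?_⟩
    · rw [map_div₀, hyz]
      exact div_self_le_one _
    · apply Subtype.ext
      change (z : K) = y * (z / y)
      rw [mul_div_cancel₀ _ hy]
  exact le_antisymm (Ideal.span_singleton_le_span_singleton.2 (hdiv _ _ hϖe hv))
    (Ideal.span_singleton_le_span_singleton.2 (hdiv _ _ hs0 hv.symm))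

theorem adjoin_simple_inv (f : K) : k⟮f⁻¹⟯ = k⟮f⟯ := by
  apply le_antisymm
  · rw [IntermediateField.adjoin_simple_le_iff]
    exact inv_mem (IntermediateField.mem_adjoin_simple_self k f)
  · rw [IntermediateField.adjoin_simple_le_iff]
    simpa using inv_mem (IntermediateField.mem_adjoin_simple_self k f⁻¹)

/-- At a pole of `f`, the function `1 / f` is a uniformizer of the target. -/
theorem Place.isTargetUniformizer_inv (P : Place k K) {f : K} (hf : f ∉ P.localRing) :
    P.IsTargetUniformizer f f⁻¹ := by
  have hf1 : 1 < P.localRing.valuation f := by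
    rw [← not_le, ← P.mem_iff]; exact hf
  have hf0 : f ≠ 0 := by
    rintro rfl
    exact hf (zero_mem _)
  have hlt : P.localRing.valuation f⁻¹ < 1 := by
    rw [map_inv₀]; exact inv_lt_one_of_one_lt₀ hf1
  have hmem : f⁻¹ ∈ k⟮f⟯ := inv_mem (IntermediateField.mem_adjoin_simple_self k f)
  have hO : f⁻¹ ∈ P.localRing := (P.mem_iff _).2 hlt.le
  refine ⟨hmem, ⟨⟨f⁻¹, hO⟩, rfl, (ValuationSubring.valuation_lt_one_iff _ _).2 hlt⟩,
    fun s hs hsm => ?_⟩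
  have hs1 := (ValuationSubring.valuation_lt_one_iff _ _).1 hsm
  rcases eq_or_ne (s : K) 0 with h0 | h0
  · exact ⟨0, by simp, by simp [h0]⟩
  rw [← adjoin_simple_inv] at hs
  obtain ⟨p, q, hpq, hq, e⟩ := exists_coprime_of_mem_adjoin_simple hs h0
  have hq1 := P.valuation_eq_one_of_coprime hO s.2 hpq hq e
  have hp : Polynomial.aeval f⁻¹ p = f⁻¹ * Polynomial.aeval f⁻¹ p.divX +
      algebraMap k K (p.coeff 0) := by
    have := congrArg (Polynomial.aeval f⁻¹) (Polynomial.X_mul_divX_add p).symm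
    rwa [map_add, map_mul, Polynomial.aeval_X, Polynomial.aeval_C] at this
  have hp1 : P.localRing.valuation (Polynomial.aeval f⁻¹ p) < 1 := by
    rw [e, map_div₀, hq1, div_one] at hs1
    exact hs1
  -- As `p(1/f)` and `1/f` vanish at `P`, so does the constant term, which would otherwise be a
  -- unit; hence `1/f` can be factored out.
  have hc : p.coeff 0 = 0 := by
    by_contra hc
    have h2 : algebraMap k K (p.coeff 0) =
        Polynomial.aeval f⁻¹ p - Polynomial.aeval f⁻¹ p.divX * f⁻¹ := by rw [hp]; ring
    have h3 := P.valuation_algebraMap hc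
    rw [h2] at h3
    have := Valuation.map_sub_lt P.localRing.valuation hp1
      (P.valuation_lt_one_of_dvd hlt (P.aeval_mem hO p.divX))
    exact this.ne h3
  rw [hc, map_zero, add_zero] at hp
  refine ⟨⟨Polynomial.aeval f⁻¹ p.divX / Polynomial.aeval f⁻¹ q, ?_⟩, ?_, ?_⟩
  · rw [P.mem_iff, map_div₀, hq1, div_one, ← P.mem_iff]
    exact P.aeval_mem hO _
  · rw [← adjoin_simple_inv]
    have hin : ∀ g : Polynomial k, Polynomial.aeval f⁻¹ g ∈ k⟮f⁻¹⟯ := fun g =>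
      IntermediateField.algebra_adjoin_le_adjoin k _ (Polynomial.aeval_mem_adjoin_singleton k _)
    exact div_mem (hin _) (hin _)
  · change (s : K) = Polynomial.aeval f⁻¹ p.divX / Polynomial.aeval f⁻¹ q * f⁻¹
    rw [e, hp]
    ring

end Target

/-! ### Pseudotame functions have exact symbols at the point. -/

section Pseudotame

variable {k K : Type*} [Field k] [Field K] [Algebra k K] [CharP K 2] [PerfectField k] {x : K}

omit [PerfectField k] in
theorem SqGenerates.exists_expansion (hK : SqGenerates (⊤ : IntermediateField k K) x) {g : K}
    (hg : g ∈ separableMorphisms k (K := K)) (f : K) : ∃ c, IsExpansion f g c := by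
  obtain ⟨c, -, hc⟩ := (hK.of_D_ne_zero (t := g) trivial hg).expansion (z := f) trivial
  exact ⟨c, hc⟩

variable (hK : SqGenerates (⊤ : IntermediateField k K) x)
  (hx : x ∈ separableMorphisms k (K := K))
include hK

omit [PerfectField k] in
theorem SqGenerates.cocycle {f g h : K} (hf : f ∈ separableMorphisms k (K := K))
    (hg : g ∈ separableMorphisms k (K := K)) (hh : h ∈ separableMorphisms k (K := K)) :
    (symbol f g + symbol g h : Ω[K⁄k]) = symbol f h := by
  obtain ⟨p, hp⟩ := hK.exists_expansion hg f
  obtain ⟨q, hq⟩ := hK.exists_expansion hh g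
  exact symbol_add_symbol hp hq hf hg hh

omit [PerfectField k] in
theorem SqGenerates.symm {f g : K} (hf : f ∈ separableMorphisms k (K := K))
    (hg : g ∈ separableMorphisms k (K := K)) : (symbol f g : Ω[K⁄k]) = symbol g f := by
  obtain ⟨p, hp⟩ := hK.exists_expansion hg f
  obtain ⟨q, hq⟩ := hK.exists_expansion hf g
  exact symbol_symm hp hq hf hg

include hx

omit [PerfectField k] in
theorem Place.IsUniformizerOn.mem_separableMorphisms_top {P : Place k K} {τ : K}
    (hτ : P.IsUniformizerOn ⊤ τ) : τ ∈ separableMorphisms k (K := K) :=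
  hτ.mem_separableMorphisms hK hx

omit [PerfectField k] in
theorem Place.IsUniformizerOn.isExactAt_symbol_of_odd {P : Place k K} {τ : K}
    (hτ : P.IsUniformizerOn ⊤ τ) {s z : K} {M : ℤ} (hM : Odd M)
    (hs : P.localRing.valuation (s + z ^ 4) = P.localRing.valuation τ ^ M) :
    P.IsExactAt (symbol s τ) := by
  have hτD := hτ.mem_separableMorphisms_top hK hx
  obtain ⟨c, hc⟩ := hK.exists_expansion hτD s
  rw [hc.symbol_eq hτD]
  exact P.isExactAt_sq_smul hτ.mem_localRing (hτ.val_symbolCoeff_le_one_of_odd hc hM hs)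

omit [CharP K 2] hK hx [PerfectField k] in
theorem inv_mem_separableMorphisms {f : K} (hf : f ∈ separableMorphisms k (K := K)) :
    f⁻¹ ∈ separableMorphisms k (K := K) := by
  have hf0 : f ≠ 0 := by
    rintro rfl
    exact hf (map_zero _)
  change KaehlerDifferential.D k K f⁻¹ ≠ 0
  rw [Derivation.leibniz_inv]
  exact smul_ne_zero (by simpa using hf0) hf

omit hK hx [PerfectField k] in
-- The expansion is `f = f⁴ (1/f)³`, with a single nonzero coefficient, so the numerator of the
-- symbol vanishes. This reduces poles of `f` to regular points of `1/f`.
theorem symbol_inv {f : K} (hf : f ∈ separableMorphisms k (K := K)) :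
    (symbol f f⁻¹ : Ω[K⁄k]) = 0 := by
  have hf0 : f ≠ 0 := by
    rintro rfl
    exact hf (map_zero _)
  have h : IsExpansion f f⁻¹ ![0, 0, 0, f] := by
    simp only [IsExpansion, Matrix.cons_val]
    field_simp
    simp
  rw [h.symbol_eq (inv_mem_separableMorphisms hf)]
  simp [symbolCoeff]

omit hK hx in
/-- The symbol of a rational function with respect to a uniformizer of the target is exact. -/
theorem Place.isExactAt_symbol_target (P : Place k K) {f t : K}
    (hf : f ∈ separableMorphisms k (K := K)) (hfO : f ∈ P.localRing)
    (ht : P.IsUniformizerOn k⟮f⟯ t) : P.IsExactAt (symbol f t) := by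
  have hF : SqGenerates k⟮f⟯ f := sqGenerates_adjoin_simple f
  have htD := ht.mem_separableMorphisms hF hf
  obtain ⟨c, hcF, hc⟩ := (hF.of_D_ne_zero ht.mem htD).expansion
    (IntermediateField.mem_adjoin_simple_self k f)
  obtain ⟨r, hr, hD⟩ := P.exists_D_eq_smul hfO ht.mem ht.mem_localRing
  rw [hc.symbol_eq htD]
  exact P.isExactAt_sq_smul ht.mem_localRing
    (ht.val_symbolCoeff_le_one_of_D_eq htD hcF hc hfO hr hD).2

/-- Split SY(f,τ) = SY(f,t) + SY(t,τ) at a uniformizer `t` of the target. The first term only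
concerns the projective line; the second is exact because `t` has odd order modulo fourth powers. -/
theorem Place.IsUniformizerOn.isExactAt_symbol_of_pseudotame {P : Place k K} {τ : K}
    (hτ : P.IsUniformizerOn ⊤ τ) {f : K} (hf : f ∈ separableMorphisms k (K := K))
    (h : IsPseudotameAt P f) : P.IsExactAt (symbol f τ) := by
  obtain ⟨t, z, ht, n, hn, hord⟩ := h
  rw [Place.hasOrder_iff hτ] at hord
  have hτD := hτ.mem_separableMorphisms_top hK hx
  -- For `t = 0` a fourth power would have odd order.
  have ht0 : t ≠ 0 := by
    rintro rfl
    rw [zero_add] at hord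
    rcases eq_or_ne z 0 with rfl | hz
    · have := hτ.zpow_pos n
      rw [← hord] at this
      simp at this
    · obtain ⟨i, hi⟩ := hτ.exists_zpow z trivial hz
      rw [map_pow, hi, ← zpow_natCast, ← zpow_mul, hτ.zpow_inj] at hord
      obtain ⟨m, hm⟩ := hn
      push_cast at hord
      omega
  have hu := ht.isUniformizerOn ht0
  have htD := hu.mem_separableMorphisms (sqGenerates_adjoin_simple f) hf
  rw [← hK.cocycle hf htD hτD]
  refine Place.IsExactAt.add ?_ (hτ.isExactAt_symbol_of_odd hK hx hn hord)
  by_cases hfO : f ∈ P.localRing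
  · exact P.isExactAt_symbol_target hf hfO hu
  · have hi := inv_mem_separableMorphisms hf
    rw [← hK.cocycle hf hi htD, symbol_inv hf, zero_add]
    have hiO : f⁻¹ ∈ P.localRing := (P.localRing.mem_or_inv_mem f).resolve_left hfO
    rw [← adjoin_simple_inv] at hu
    exact P.isExactAt_symbol_target hi hiO hu

end Pseudotame
end SYCurve

namespace SYCurve

/-! ### The even Clifford algebra of a conic with a rational point is split. -/

section Clifford

universe u

variable {K : Type u} [Field K]

/-- Brauer equivalence is witnessed by 1 by 1 matrices over `M₂(K)` and 2 by 2 matrices over `K`. -/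
theorem hasTrivialBrauerClass_of_matrix {A : Type u} [Ring A] [Algebra K A]
    (e : Matrix (Fin 2) (Fin 2) K ≃ₐ[K] A) : HasTrivialBrauerClass K A := by
  let A' : CSA.{u, u} K :=
    { toAlgCat := AlgCat.of K (Matrix (Fin 2) (Fin 2) K)
      isCentral := inferInstanceAs (Algebra.IsCentral K (Matrix (Fin 2) (Fin 2) K))
      isSimple := inferInstanceAs (IsSimpleRing (Matrix (Fin 2) (Fin 2) K))
      fin_dim := inferInstanceAs (FiniteDimensional K (Matrix (Fin 2) (Fin 2) K)) }
  refine ⟨A', ⟨e⟩, Quotient.sound ?_⟩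
  exact ⟨1, 2, one_ne_zero, two_ne_zero,
    ⟨(Matrix.compAlgEquiv (Fin 1) (Fin 2) K K).trans
      (Matrix.reindexAlgEquiv K K (Equiv.uniqueProd (Fin 2) (Fin 1)))⟩⟩

section EvenConic

variable [CharP K 2] (b g : K)

local notation "Cl" => CliffordAlgebra (conicForm b g)

/-- The images in the Clifford algebra of the vectors of the standard basis. -/
def conicGen (i : Fin 3) : CliffordAlgebra (conicForm b g) :=
  CliffordAlgebra.ι (conicForm b g) (Pi.single i 1)

omit [CharP K 2] in
theorem ι_eq_sum (m : Fin 3 → K) : CliffordAlgebra.ι (conicForm b g) m =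
    m 0 • conicGen b g 0 + m 1 • conicGen b g 1 + m 2 • conicGen b g 2 := by
  have : m = m 0 • Pi.single 0 1 + m 1 • Pi.single 1 1 + m 2 • Pi.single 2 1 := by
    funext i
    fin_cases i <;> simp
  conv_lhs => rw [this]
  simp only [map_add, map_smul, conicGen]

omit [CharP K 2] in
theorem conicGen_mul_self (i : Fin 3) : conicGen b g i * conicGen b g i =
    algebraMap K Cl (conicForm b g (Pi.single i 1)) :=
  CliffordAlgebra.ι_sq_scalar _ _

/-- In characteristic two `e₁` is orthogonal to every vector for the polar form, hence central in
the Clifford algebra. Since also `e₁² = 1`, multiplication by `e₁` turns vectors into even elements.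
-/
theorem conicGen_mul_comm (i : Fin 3) :
    conicGen b g i * conicGen b g 1 = conicGen b g 1 * conicGen b g i := by
  have h := CliffordAlgebra.ι_mul_ι_add_swap (Q := conicForm b g) (Pi.single i 1) (Pi.single 1 1)
  have h0 : QuadraticMap.polar (conicForm b g) (Pi.single i 1) (Pi.single 1 1) = 0 := by
    have h2 : (2 : K) = 0 := CharTwo.two_eq_zero
    fin_cases i
    · simp [QuadraticMap.polar, conicForm_apply]
    · simp [QuadraticMap.polar, conicForm_apply]
      linear_combination h2
    · simp [QuadraticMap.polar, conicForm_apply]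
  rw [h0, map_zero] at h
  have h2 : conicGen b g 1 * conicGen b g i + conicGen b g 1 * conicGen b g i = 0 := by
    rw [← two_smul K, CharTwo.two_eq_zero, zero_smul]
  exact add_right_cancel (h.trans h2.symm)

omit [CharP K 2] in
theorem conicGen_zero_mul_two : conicGen b g 0 * conicGen b g 2 +
    conicGen b g 2 * conicGen b g 0 = 1 := by
  have h := CliffordAlgebra.ι_mul_ι_add_swap (Q := conicForm b g) (Pi.single 0 1) (Pi.single 2 1)
  have h0 : QuadraticMap.polar (conicForm b g) (Pi.single 0 1) (Pi.single 2 1) = 1 := by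
    simp [QuadraticMap.polar, conicForm_apply]
    ring
  rw [h0, map_one] at h
  exact h

omit [CharP K 2] in
theorem conicGen_one_sq : conicGen b g 1 * conicGen b g 1 = 1 := by
  rw [conicGen_mul_self]
  simp [conicForm_apply]

/-- The even elements `e₀ e₁` and `e₂ e₁`. -/
def evenGen₀ : CliffordAlgebra (conicForm b g) := conicGen b g 0 * conicGen b g 1
def evenGen₂ : CliffordAlgebra (conicForm b g) := conicGen b g 2 * conicGen b g 1

theorem mul_one_mul_one (i j : Fin 3) :
    conicGen b g i * conicGen b g 1 * (conicGen b g j * conicGen b g 1) =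
      conicGen b g i * conicGen b g j := by
  rw [mul_assoc, ← mul_assoc (conicGen b g 1), ← conicGen_mul_comm, mul_assoc, conicGen_one_sq,
    mul_one]

theorem evenGen₀_sq : evenGen₀ b g * evenGen₀ b g = algebraMap K Cl b := by
  rw [evenGen₀, mul_one_mul_one, conicGen_mul_self]
  simp [conicForm_apply]

theorem evenGen₂_sq : evenGen₂ b g * evenGen₂ b g = algebraMap K Cl (b * g) := by
  rw [evenGen₂, mul_one_mul_one, conicGen_mul_self]
  simp [conicForm_apply]

theorem evenGen₂_mul_evenGen₀ :
    evenGen₂ b g * evenGen₀ b g = 1 - evenGen₀ b g * evenGen₂ b g := by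
  rw [evenGen₂, evenGen₀, mul_one_mul_one, mul_one_mul_one, eq_sub_iff_add_eq, add_comm,
    conicGen_zero_mul_two]

theorem ι_mul_ι_eq (m n : Fin 3 → K) :
    CliffordAlgebra.ι (conicForm b g) m * CliffordAlgebra.ι (conicForm b g) n =
      (m 0 • evenGen₀ b g + m 1 • 1 + m 2 • evenGen₂ b g) *
        (n 0 • evenGen₀ b g + n 1 • 1 + n 2 • evenGen₂ b g) := by
  have h : ∀ m : Fin 3 → K, m 0 • evenGen₀ b g + m 1 • 1 + m 2 • evenGen₂ b g =
      CliffordAlgebra.ι (conicForm b g) m * conicGen b g 1 := by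
    intro m
    rw [ι_eq_sum, add_mul, add_mul, smul_mul_assoc, smul_mul_assoc, smul_mul_assoc,
      conicGen_one_sq, evenGen₀, evenGen₂]
  have hc : conicGen b g 1 * CliffordAlgebra.ι (conicForm b g) n =
      CliffordAlgebra.ι (conicForm b g) n * conicGen b g 1 := by
    rw [ι_eq_sum, add_mul, add_mul, mul_add, mul_add]
    simp only [smul_mul_assoc, mul_smul_comm, conicGen_mul_comm]
  rw [h, h, mul_assoc, ← mul_assoc (conicGen b g 1), hc, mul_assoc, conicGen_one_sq, mul_one]

/-- The even Clifford algebra of the conic is spanned by `1`, `e₀ e₁`, `e₂ e₁` and their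
product. -/
theorem exists_coeff_of_mem_even {z : CliffordAlgebra (conicForm b g)}
    (hz : z ∈ CliffordAlgebra.evenOdd (conicForm b g) 0) :
    ∃ α β γ δ : K, z = α • 1 + β • evenGen₀ b g + γ • evenGen₂ b g +
      δ • (evenGen₀ b g * evenGen₂ b g) := by
  have hp : ∀ z, (∃ α β γ δ : K, z = α • 1 + β • evenGen₀ b g + γ • evenGen₂ b g +
      δ • (evenGen₀ b g * evenGen₂ b g)) → ∀ l m n : K, ∃ α β γ δ : K,
      (l • evenGen₀ b g + m • 1 + n • evenGen₂ b g) * z =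
        α • 1 + β • evenGen₀ b g + γ • evenGen₂ b g + δ • (evenGen₀ b g * evenGen₂ b g) := by
    rintro z ⟨α, β, γ, δ, rfl⟩ l m n
    refine ⟨l * β * b + m * α + n * β + n * γ * (b * g), l * α + m * β - n * δ * (b * g),
      l * δ * b + m * γ + n * α + n * δ, l * γ + m * δ - n * β, ?_⟩
    have h3 : evenGen₀ b g * (evenGen₀ b g * evenGen₂ b g) = b • evenGen₂ b g := by
      rw [← mul_assoc, evenGen₀_sq, Algebra.smul_def]
    have h4 : evenGen₂ b g * (evenGen₀ b g * evenGen₂ b g) =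
        evenGen₂ b g - (b * g) • evenGen₀ b g := by
      rw [← mul_assoc, evenGen₂_mul_evenGen₀, sub_mul, one_mul, mul_assoc, evenGen₂_sq,
        Algebra.smul_def, Algebra.commutes]
    simp only [add_mul, mul_add, smul_mul_assoc, mul_smul_comm, mul_one, one_mul, h3, h4,
      evenGen₀_sq, evenGen₂_sq, evenGen₂_mul_evenGen₀, Algebra.algebraMap_eq_smul_one, smul_sub]
    module
  induction z, hz using CliffordAlgebra.even_induction with
  | algebraMap r => exact ⟨r, 0, 0, 0, by simp [Algebra.algebraMap_eq_smul_one]⟩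
  | add x y _ _ hx hy =>
    obtain ⟨α, β, γ, δ, rfl⟩ := hx
    obtain ⟨α', β', γ', δ', rfl⟩ := hy
    exact ⟨α + α', β + β', γ + γ', δ + δ', by module⟩
  | ι_mul_ι_mul m n x _ hx =>
    rw [ι_mul_ι_eq, mul_assoc]
    exact hp _ (hp _ hx _ _ _) _ _ _

/-- Sending `e₀, e₁, e₂` to `I, 1, J` respects the quadratic form, since the other cross terms occur
twice and vanish. On the even part the map is bijective: the source is spanned by four elements
whose images are independent in a space of dimension four. -/
theorem nonempty_matrix_algEquiv_even {I J : Matrix (Fin 2) (Fin 2) K} (hI : I * I = b • 1)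
    (hJ : J * J = (b * g) • 1) (hIJ : I * J + J * I = 1) :
    Nonempty (Matrix (Fin 2) (Fin 2) K ≃ₐ[K] CliffordAlgebra.even (conicForm b g)) := by
  have h2 : (2 : K) = 0 := CharTwo.two_eq_zero
  let f : (Fin 3 → K) →ₗ[K] Matrix (Fin 2) (Fin 2) K :=
    (LinearMap.proj 0).smulRight I + (LinearMap.proj 1).smulRight 1 +
      (LinearMap.proj 2).smulRight J
  have hf : ∀ m, f m = m 0 • I + m 1 • 1 + m 2 • J := fun m => by simp [f]
  have hfQ : ∀ m, f m * f m = algebraMap K (Matrix (Fin 2) (Fin 2) K) (conicForm b g m) := by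
    intro m
    have hJI : J * I = 1 - I * J := by rw [← hIJ]; abel
    rw [hf, conicForm_apply, Algebra.algebraMap_eq_smul_one]
    simp only [add_mul, mul_add, smul_mul_assoc, mul_smul_comm, mul_one, one_mul, hI, hJ, hJI,
      smul_sub]
    have e1 : (m 0 * m 1 * 2) • I = 0 := by rw [h2]; simp
    have e2 : (m 2 * m 1 * 2) • J = 0 := by rw [h2]; simp
    linear_combination (norm := module) e1 + e2
  let Φ := CliffordAlgebra.lift (conicForm b g) ⟨f, hfQ⟩
  have hgen : ∀ i, Φ (conicGen b g i) = f (Pi.single i 1) := fun i => by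
    simp [Φ, conicGen]
  have hp : Φ (evenGen₀ b g) = I := by
    rw [evenGen₀, map_mul, hgen, hgen, hf, hf]; simp
  have hq : Φ (evenGen₂ b g) = J := by
    rw [evenGen₂, map_mul, hgen, hgen, hf, hf]; simp
  have hind : ∀ α β γ δ : K, α • (1 : Matrix (Fin 2) (Fin 2) K) + β • I + γ • J +
      δ • (I * J) = 0 → α = 0 ∧ β = 0 ∧ γ = 0 ∧ δ = 0 := by
    have hJI : J * I = 1 - I * J := by rw [← hIJ]; abel
    intro α β γ δ h
    have hz : ∀ M : Matrix (Fin 2) (Fin 2) K, M + M = 0 := fun M => by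
      rw [← two_smul K, h2, zero_smul]
    have h1 : ∀ a : K, a • (1 : Matrix (Fin 2) (Fin 2) K) = 0 → a = 0 := fun a ha =>
      (smul_eq_zero.1 ha).resolve_right one_ne_zero
    have hIIJ : I * (I * J) = b • J := by rw [← mul_assoc, hI, smul_mul_assoc, one_mul]
    have hIJI : I * J * I = I - b • J := by
      rw [mul_assoc, hJI, mul_sub, mul_one, hIIJ]
    -- Taking the commutator with `I` kills `1` and `I` and sends `J` to `1`, `I J` to `I`.
    -- Commutators with `J` then isolate the remaining coefficients.
    have c1 : γ • (1 : Matrix (Fin 2) (Fin 2) K) + δ • I = 0 := by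
      have e : I * (α • (1 : Matrix (Fin 2) (Fin 2) K) + β • I + γ • J + δ • (I * J)) +
          (α • (1 : Matrix (Fin 2) (Fin 2) K) + β • I + γ • J + δ • (I * J)) * I = 0 := by
        rw [h]; simp
      simp only [add_mul, mul_add, smul_mul_assoc, mul_smul_comm, mul_one, one_mul, hI, hJI,
        hIIJ, hIJI, smul_sub] at e
      linear_combination (norm := module) e - hz (α • I) - hz ((β * b) • 1)
    have hδ : δ = 0 := by
      have e : J * (γ • (1 : Matrix (Fin 2) (Fin 2) K) + δ • I) +
          (γ • (1 : Matrix (Fin 2) (Fin 2) K) + δ • I) * J = 0 := by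
        rw [c1]; simp
      simp only [add_mul, mul_add, smul_mul_assoc, mul_smul_comm, mul_one, one_mul, hJI,
        smul_sub] at e
      apply h1
      linear_combination (norm := module) e - hz (γ • J)
    subst hδ
    have hγ : γ = 0 := h1 _ (by simpa using c1)
    subst hγ
    simp only [zero_smul, add_zero] at h
    have hβ : β = 0 := by
      have e : J * (α • (1 : Matrix (Fin 2) (Fin 2) K) + β • I) +
          (α • (1 : Matrix (Fin 2) (Fin 2) K) + β • I) * J = 0 := by
        rw [h]; simp
      simp only [add_mul, mul_add, smul_mul_assoc, mul_smul_comm, mul_one, one_mul, hJI,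
        smul_sub] at e
      apply h1
      linear_combination (norm := module) e - hz (α • J)
    subst hβ
    exact ⟨h1 _ (by simpa using h), rfl, rfl, rfl⟩
  have hΦ : ∀ α β γ δ : K, Φ (α • 1 + β • evenGen₀ b g + γ • evenGen₂ b g +
      δ • (evenGen₀ b g * evenGen₂ b g)) = α • 1 + β • I + γ • J + δ • (I * J) := by
    intro α β γ δ
    simp only [map_add, map_smul, map_mul, map_one, hp, hq]
  let φ := Φ.comp (CliffordAlgebra.even (conicForm b g)).val
  have hφ : ∀ z, φ z = Φ (z : CliffordAlgebra (conicForm b g)) := fun z =>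
    AlgHom.comp_apply _ _ _
  have hinj : Function.Injective φ := by
    rw [injective_iff_map_eq_zero]
    rintro ⟨z, hz⟩ h0
    obtain ⟨α, β, γ, δ, rfl⟩ := exists_coeff_of_mem_even b g hz
    rw [hφ, hΦ] at h0
    obtain ⟨rfl, rfl, rfl, rfl⟩ := hind _ _ _ _ h0
    apply Subtype.ext
    simp
  have hsurj : Function.Surjective φ := by
    let ψ : (Fin 4 → K) →ₗ[K] Matrix (Fin 2) (Fin 2) K :=
      (LinearMap.proj 0).smulRight 1 + (LinearMap.proj 1).smulRight I +
        (LinearMap.proj 2).smulRight J + (LinearMap.proj 3).smulRight (I * J)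
    have hψ : ∀ m, ψ m = m 0 • 1 + m 1 • I + m 2 • J + m 3 • (I * J) := fun m => by simp [ψ]
    have hψi : Function.Injective ψ := by
      rw [injective_iff_map_eq_zero]
      intro m hm
      rw [hψ] at hm
      obtain ⟨h0, h1, h2, h3⟩ := hind _ _ _ _ hm
      funext i
      fin_cases i <;> assumption
    have hψs : Function.Surjective ψ :=
      (LinearMap.injective_iff_surjective_of_finrank_eq_finrank (by
        rw [Module.finrank_matrix]; simp)).1 hψi
    intro M
    obtain ⟨m, rfl⟩ := hψs M
    have h₀ : evenGen₀ b g ∈ CliffordAlgebra.even (conicForm b g) :=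
      CliffordAlgebra.ι_mul_ι_mem_evenOdd_zero _ _ _
    have h₂ : evenGen₂ b g ∈ CliffordAlgebra.even (conicForm b g) :=
      CliffordAlgebra.ι_mul_ι_mem_evenOdd_zero _ _ _
    refine ⟨⟨m 0 • 1 + m 1 • evenGen₀ b g + m 2 • evenGen₂ b g +
      m 3 • (evenGen₀ b g * evenGen₂ b g), ?_⟩, ?_⟩
    · exact add_mem (add_mem (add_mem (Subalgebra.smul_mem _ (one_mem _) _)
        (Subalgebra.smul_mem _ h₀ _)) (Subalgebra.smul_mem _ h₂ _))
        (Subalgebra.smul_mem _ (mul_mem h₀ h₂) _)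
    · rw [hφ, hΦ, hψ]
  exact ⟨(AlgEquiv.ofBijective φ ⟨hinj, hsurj⟩).symm⟩

/-- The even Clifford algebra of the conic is split when the conic has a rational point. -/
theorem hasTrivialBrauerClass_even {T : Fin 3 → K} (hT : T ≠ 0) (h : conicForm b g T = 0) :
    HasTrivialBrauerClass K (CliffordAlgebra.even (conicForm b g)) := by
  have h2 : (2 : K) = 0 := CharTwo.two_eq_zero
  rw [conicForm_apply] at h
  have key : ∃ I J : Matrix (Fin 2) (Fin 2) K, I * I = b • 1 ∧ J * J = (b * g) • 1 ∧
      I * J + J * I = 1 := by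
    by_cases h2' : T 2 = 0
    · have h0' : T 0 ≠ 0 := by
        intro h0
        rw [h0, h2'] at h
        have h1 : T 1 = 0 := by simpa using h
        exact hT (by funext i; fin_cases i <;> assumption)
      rw [h2'] at h
      -- When `T 2 = 0` the conic equation says that `b` is the square of `T 1 / T 0`.
      refine ⟨!![T 1 / T 0, 1; 0, T 1 / T 0], !![0, b * g; 1, 0], ?_, ?_, ?_⟩
      · ext i j
        fin_cases i <;> fin_cases j <;> simp [Matrix.mul_apply, Fin.sum_univ_two]
        · field_simp
          linear_combination h - b * T 0 ^ 2 * h2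
        · linear_combination (T 1 / T 0) * h2
        · field_simp
          linear_combination h - b * T 0 ^ 2 * h2
      · ext i j
        fin_cases i <;> fin_cases j <;> simp
      · ext i j
        fin_cases i <;> fin_cases j <;> simp
        · linear_combination (T 1 / T 0 * (b * g)) * h2
        · linear_combination (T 1 / T 0) * h2
    -- With `p = T 1 / T 2` and `q = T 0 / T 2`, the matrix `J = p + q I + E₁₂` satisfies `I J + J I
    -- = 1`, and `J² = b g` is the conic equation at `[q : p : 1]`.
    · refine ⟨!![0, b; 1, 0], !![T 1 / T 2, 1 + T 0 / T 2 * b; T 0 / T 2, T 1 / T 2], ?_, ?_, ?_⟩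
      · ext i j
        fin_cases i <;> fin_cases j <;> simp
      · have e : T 1 / T 2 * (T 1 / T 2) + (1 + T 0 / T 2 * b) * (T 0 / T 2) = b * g := by
          field_simp
          linear_combination h - b * g * T 2 ^ 2 * h2
        ext i j
        fin_cases i <;> fin_cases j <;> simp [Matrix.mul_apply, Fin.sum_univ_two]
        · exact e
        · linear_combination (T 1 / T 2 * (1 + T 0 / T 2 * b)) * h2
        · linear_combination (T 1 / T 2 * (T 0 / T 2)) * h2
        · linear_combination e
      · ext i j
        fin_cases i <;> fin_cases j <;> simp
        · linear_combination (T 0 / T 2 * b) * h2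
        · linear_combination (T 1 / T 2 * b) * h2
        · linear_combination (T 1 / T 2) * h2
        · linear_combination (T 0 / T 2 * b) * h2
  obtain ⟨I, J, hI, hJ, hIJ⟩ := key
  obtain ⟨e⟩ := nonempty_matrix_algEquiv_even b g hI hJ hIJ
  exact hasTrivialBrauerClass_of_matrix e

end EvenConic
end Clifford
end SYCurve

namespace SYCurve

/-! ### The function field of `y² + y = x³ + a x + b`. -/

section FunctionField

variable {k : Type*} [Field k] (a b : k)

/-- The coordinate ring of `y² + y = x³ + a x + b`. -/
abbrev CoordRing : Type _ := (curve a b).CoordinateRing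

/-- The coordinate function `y`. -/
noncomputable def yCoord : FunField a b :=
  algebraMap (CoordRing a b) (FunField a b)
    (WeierstrassCurve.Affine.CoordinateRing.mk (curve a b) Polynomial.X)

theorem algebraMap_polynomial (p : Polynomial k) :
    algebraMap (Polynomial k) (FunField a b) p = Polynomial.aeval (xCoord a b) p := by
  have h : xCoord a b = algebraMap (Polynomial k) (FunField a b) Polynomial.X := rfl
  rw [h, Polynomial.aeval_algebraMap_apply, Polynomial.aeval_X_left_apply]

theorem aeval_xCoord_injective :
    Function.Injective (Polynomial.aeval (xCoord a b) : Polynomial k →ₐ[k] FunField a b) := by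
  have h : Function.Injective (algebraMap (Polynomial k) (FunField a b)) :=
    FaithfulSMul.algebraMap_injective _ _
  intro p q hpq
  apply h
  rwa [algebraMap_polynomial, algebraMap_polynomial]

theorem aeval_xCoord_ne_zero {p : Polynomial k} (hp : p ≠ 0) :
    Polynomial.aeval (xCoord a b) p ≠ 0 :=
  (map_ne_zero_iff _ (aeval_xCoord_injective a b)).2 hp

theorem algebraMap_smul_basis (p q : Polynomial k) :
    algebraMap (CoordRing a b) (FunField a b)
      (p • 1 + q • WeierstrassCurve.Affine.CoordinateRing.mk (curve a b) Polynomial.X) =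
      Polynomial.aeval (xCoord a b) p + Polynomial.aeval (xCoord a b) q * yCoord a b := by
  rw [map_add, Algebra.smul_def, Algebra.smul_def, mul_one, map_mul,
    ← IsScalarTower.algebraMap_apply, ← IsScalarTower.algebraMap_apply, algebraMap_polynomial,
    algebraMap_polynomial]
  rfl

theorem exists_algebraMap_coordRing_eq (z : CoordRing a b) : ∃ p q : Polynomial k,
    algebraMap (CoordRing a b) (FunField a b) z =
      Polynomial.aeval (xCoord a b) p + Polynomial.aeval (xCoord a b) q * yCoord a b := by
  obtain ⟨p, q, rfl⟩ := WeierstrassCurve.Affine.CoordinateRing.exists_smul_basis_eq z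
  exact ⟨p, q, algebraMap_smul_basis a b p q⟩

theorem aeval_add_mul_yCoord_eq_zero {p q : Polynomial k}
    (h : Polynomial.aeval (xCoord a b) p + Polynomial.aeval (xCoord a b) q * yCoord a b = 0) :
    p = 0 ∧ q = 0 := by
  rw [← algebraMap_smul_basis] at h
  exact WeierstrassCurve.Affine.CoordinateRing.smul_basis_eq_zero
    (IsFractionRing.injective (CoordRing a b) (FunField a b) (h.trans (map_zero _).symm))

theorem weierstrass_equation : yCoord a b ^ 2 + yCoord a b =
    xCoord a b ^ 3 + algebraMap k _ a * xCoord a b + algebraMap k _ b := by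
  let φ := (algebraMap (CoordRing a b) (FunField a b)).comp
    (WeierstrassCurve.Affine.CoordinateRing.mk (curve a b))
  have hpoly : (curve a b).polynomial = Polynomial.X ^ 2 + Polynomial.X -
      (Polynomial.C Polynomial.X ^ 3 + Polynomial.C (Polynomial.C a) * Polynomial.C Polynomial.X +
        Polynomial.C (Polynomial.C b)) := by
    simp [WeierstrassCurve.Affine.polynomial, curve]
  have h : φ (curve a b).polynomial = 0 := by
    rw [RingHom.comp_apply, AdjoinRoot.mk_self, map_zero]
  have h' := (congrArg φ hpoly).symm.trans h
  simp only [map_add, map_sub, map_mul, map_pow] at h'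
  exact sub_eq_zero.1 h'

instance [CharP k 2] : CharP (FunField a b) 2 :=
  charP_of_injective_algebraMap (algebraMap k (FunField a b)).injective 2

variable [CharP k 2]

/-- The norm from `k(x, y)` to `k(x)` of `p + q y`. -/
theorem conj_mul (p q : Polynomial k) :
    (Polynomial.aeval (xCoord a b) p + Polynomial.aeval (xCoord a b) q * yCoord a b) *
      (Polynomial.aeval (xCoord a b) (p + q) + Polynomial.aeval (xCoord a b) q * yCoord a b) =
    Polynomial.aeval (xCoord a b) (p ^ 2 + p * q + q ^ 2 *
      (Polynomial.X ^ 3 + Polynomial.C a * Polynomial.X + Polynomial.C b)) := by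
  have h2 : (2 : FunField a b) = 0 := CharTwo.two_eq_zero
  simp only [map_add, map_mul, map_pow, Polynomial.aeval_X, Polynomial.aeval_C]
  rw [← weierstrass_equation]
  linear_combination (Polynomial.aeval (xCoord a b) p * Polynomial.aeval (xCoord a b) q *
    yCoord a b) * h2

/-- The denominator is cleared by the conjugate `p + q + q y` of `p + q y`, whose product with it
lies in `k[x]`. -/
theorem exists_eq_div (z : FunField a b) : ∃ p q r : Polynomial k, r ≠ 0 ∧
    z = (Polynomial.aeval (xCoord a b) p + Polynomial.aeval (xCoord a b) q * yCoord a b) /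
      Polynomial.aeval (xCoord a b) r := by
  obtain ⟨n, s, hs, rfl⟩ := IsFractionRing.div_surjective (A := CoordRing a b) z
  have hs0 := nonZeroDivisors.ne_zero hs
  obtain ⟨p, q, hpq⟩ := exists_algebraMap_coordRing_eq a b s
  have hs1 : Polynomial.aeval (xCoord a b) p + Polynomial.aeval (xCoord a b) q * yCoord a b ≠ 0 := by
    rw [← hpq]
    exact (map_ne_zero_iff _ (IsFractionRing.injective (CoordRing a b) (FunField a b))).2 hs0
  have hs2 : Polynomial.aeval (xCoord a b) (p + q) +
      Polynomial.aeval (xCoord a b) q * yCoord a b ≠ 0 := by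
    intro h
    obtain ⟨h1, h2⟩ := aeval_add_mul_yCoord_eq_zero a b h
    rw [h2, add_zero] at h1
    apply hs1
    simp [h1, h2]
  obtain ⟨u, w, huw⟩ := exists_algebraMap_coordRing_eq a b
    (n * ((p + q) • 1 + q • WeierstrassCurve.Affine.CoordinateRing.mk (curve a b) Polynomial.X))
  rw [map_mul, algebraMap_smul_basis] at huw
  refine ⟨u, w, p ^ 2 + p * q + q ^ 2 *
    (Polynomial.X ^ 3 + Polynomial.C a * Polynomial.X + Polynomial.C b), fun h0 => ?_, ?_⟩
  · have := conj_mul a b p q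
    rw [h0, map_zero] at this
    exact mul_ne_zero hs1 hs2 this
  · rw [← huw, hpq, ← conj_mul a b p q, mul_div_mul_right _ _ hs2]

theorem adjoin_xCoord_yCoord :
    IntermediateField.adjoin k {xCoord a b, yCoord a b} = ⊤ := by
  rw [eq_top_iff]
  intro z _
  obtain ⟨p, q, r, -, rfl⟩ := exists_eq_div a b z
  have hy : yCoord a b ∈ IntermediateField.adjoin k {xCoord a b, yCoord a b} :=
    IntermediateField.subset_adjoin _ _ (by simp)
  have hp : ∀ p : Polynomial k, Polynomial.aeval (xCoord a b) p ∈
      IntermediateField.adjoin k {xCoord a b, yCoord a b} := fun p =>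
    IntermediateField.algebra_adjoin_le_adjoin k _ (Algebra.adjoin_mono (by simp)
      (Polynomial.aeval_mem_adjoin_singleton k _))
  exact div_mem (add_mem (hp p) (mul_mem (hp q) hy)) (hp r)

variable [PerfectField k]

omit [CharP k 2] in
theorem exists_sq_eq [CharP k 2] (c : k) : ∃ e : k, e ^ 2 = c := by
  have : ExpChar k 2 := .prime Nat.prime_two
  exact (PerfectRing.bijective_frobenius (R := k) (p := 2)).2 c

theorem exists_fourth_eq (c : k) : ∃ e : k, e ^ 4 = c := by
  obtain ⟨e, rfl⟩ := exists_sq_eq c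
  obtain ⟨f, rfl⟩ := exists_sq_eq e
  exact ⟨f, by ring⟩

theorem sqGenerates_xCoord : SqGenerates (⊤ : IntermediateField k (FunField a b)) (xCoord a b) := by
  rw [← adjoin_xCoord_yCoord]
  have hx : xCoord a b ∈ IntermediateField.adjoin k {xCoord a b, yCoord a b} :=
    IntermediateField.subset_adjoin _ _ (by simp)
  have hy : yCoord a b ∈ IntermediateField.adjoin k {xCoord a b, yCoord a b} :=
    IntermediateField.subset_adjoin _ _ (by simp)
  refine sqGenerates_adjoin hx ?_
  rintro z (rfl | rfl)
  · exact ⟨0, zero_mem _, 1, one_mem _, by ring⟩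
  · obtain ⟨α, rfl⟩ := exists_sq_eq a
    obtain ⟨β, rfl⟩ := exists_sq_eq b
    have h2 : (2 : FunField (α ^ 2) (β ^ 2)) = 0 := CharTwo.two_eq_zero
    -- With `α² = a` and `β² = b`, the curve equation reads `y = (y + β)² + (x + α)² x`.
    refine ⟨yCoord _ _ + algebraMap k _ β, add_mem hy (IntermediateField.algebraMap_mem _ _),
      xCoord _ _ + algebraMap k _ α, add_mem hx (IntermediateField.algebraMap_mem _ _), ?_⟩
    have h := weierstrass_equation (α ^ 2) (β ^ 2)
    rw [map_pow, map_pow] at h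
    rw [add_pow_char _ _ 2, add_pow_char _ _ 2]
    linear_combination h - yCoord (α ^ 2) (β ^ 2) ^ 2 * h2

/-- All differentials are multiples of `dx`. If `dx` were zero, `K` would be unramified over `k`,
hence separable algebraic, although `x` is transcendental. -/
theorem xCoord_mem_separableMorphisms :
    xCoord a b ∈ separableMorphisms k (K := FunField a b) := by
  intro h0
  have hall : ∀ z : FunField a b, KaehlerDifferential.D k (FunField a b) z = 0 := by
    intro z
    obtain ⟨u, -, w, -, rfl⟩ := (sqGenerates_xCoord a b).2 z trivial
    rw [D_sq_add_sq_mul, h0, smul_zero]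
  have hsub : Subsingleton (Ω[FunField a b⁄k]) := by
    rw [← Submodule.subsingleton_iff (FunField a b), ← subsingleton_iff_bot_eq_top,
      ← KaehlerDifferential.span_range_derivation]
    symm
    rw [Submodule.span_eq_bot]
    rintro _ ⟨z, rfl⟩
    exact hall z
  have : Algebra.FormallyUnramified k (FunField a b) := ⟨hsub⟩
  have : Algebra.FiniteType k (CoordRing a b) :=
    Algebra.FiniteType.trans (S := Polynomial k) inferInstance inferInstance
  have : Algebra.EssFiniteType k (FunField a b) :=
    Algebra.EssFiniteType.comp k (CoordRing a b) (FunField a b)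
  have : Algebra.IsSeparable k (FunField a b) :=
    (Algebra.FormallyUnramified.iff_isSeparable k (FunField a b)).1 inferInstance
  have hint : IsIntegral k (xCoord a b) := Algebra.IsIntegral.isIntegral _
  exact aeval_xCoord_ne_zero a b (minpoly.ne_zero hint) (minpoly.aeval k _)

omit [PerfectField k] in
theorem D_yCoord : KaehlerDifferential.D k (FunField a b) (yCoord a b) =
    (xCoord a b ^ 2 + algebraMap k _ a) • KaehlerDifferential.D k (FunField a b) (xCoord a b) := by
  have h := congrArg (KaehlerDifferential.D k (FunField a b)) (weierstrass_equation a b)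
  rw [map_add, D_sq, zero_add, map_add, map_add, Derivation.map_algebraMap, add_zero,
    show xCoord a b ^ 3 = xCoord a b ^ 2 * xCoord a b by ring, D_sq_mul, Derivation.leibniz,
    Derivation.map_algebraMap, smul_zero, add_zero, ← add_smul] at h
  exact h

end FunctionField
end SYCurve

namespace SYCurve

/-! ### Recognizing discrete valuation rings from their value group. -/

section DiscreteValuation

variable {K : Type*} [Field K]

theorem isDiscreteValuationRing_of_zpow {V : ValuationSubring K} {t : K} (ht : t ≠ 0)
    (hlt : V.valuation t < 1) (h : ∀ z : K, z ≠ 0 → ∃ n : ℤ, V.valuation z = V.valuation t ^ n) :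
    IsDiscreteValuationRing V := by
  have hpos : 0 < V.valuation t := zero_lt_iff.2 ((Valuation.ne_zero_iff _).2 ht)
  have hnat : ∀ z : V, z ≠ 0 → ∃ n : ℕ, V.valuation z = V.valuation t ^ n := by
    intro z hz
    obtain ⟨n, hn⟩ := h z (fun h0 => hz (Subtype.ext h0))
    have h1 := V.valuation_le_one z
    rw [hn, ← zpow_zero (V.valuation t), zpow_le_zpow_iff_right_of_lt_one₀ hpos hlt] at h1
    exact ⟨n.toNat, by rw [hn, ← zpow_natCast, Int.toNat_of_nonneg h1]⟩
  apply IsDiscreteValuationRing.ofHasUnitMulPowIrreducibleFactorization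
  have hinj := pow_right_injective₀ hpos hlt.ne
  have hunit : ∀ z : V, IsUnit z ↔ V.valuation z = 1 := fun z => V.valuation_eq_one_iff z
  refine ⟨⟨t, (V.valuation_le_one_iff t).1 hlt.le⟩, ⟨?_, ?_⟩, ?_⟩
  · rw [hunit]
    exact hlt.ne
  · intro y z e
    have e' : t = y * z := congrArg Subtype.val e
    have hyz : (y : K) ≠ 0 ∧ (z : K) ≠ 0 := by
      rw [e'] at ht
      exact mul_ne_zero_iff.1 ht
    obtain ⟨m, hm⟩ := hnat y (fun h0 => hyz.1 (congrArg Subtype.val h0))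
    obtain ⟨n, hn⟩ := hnat z (fun h0 => hyz.2 (congrArg Subtype.val h0))
    have : V.valuation t ^ 1 = V.valuation t ^ (m + n) := by
      conv_lhs => rw [pow_one, e', map_mul, hm, hn]
      rw [pow_add]
    have hmn : 1 = m + n := hinj this
    rw [hunit, hunit, hm, hn]
    rcases Nat.eq_zero_or_pos m with rfl | h0
    · left; simp
    · right
      rw [show n = 0 by omega, pow_zero]
  · intro z hz
    obtain ⟨n, hn⟩ := hnat z hz
    refine ⟨n, ?_⟩
    have hz0 : (z : K) ≠ 0 := fun h0 => hz (Subtype.ext h0)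
    have hv : V.valuation (z / t ^ n) = 1 := by
      rw [map_div₀, hn, map_pow, div_self (pow_ne_zero _ hpos.ne')]
    have hu : IsUnit (⟨z / t ^ n, (V.valuation_le_one_iff _).1 hv.le⟩ : V) := (hunit _).2 hv
    refine ⟨hu.unit, ?_⟩
    apply Subtype.ext
    change t ^ n * (z / t ^ n) = z
    rw [mul_div_cancel₀ _ (pow_ne_zero _ ht)]

end DiscreteValuation

/-! ### The point at infinity, with uniformizer `x / y`. -/

section Infinity

variable {k : Type*} [Field k] (a b : k)

theorem valuation_isTrivialOn {K : Type*} [Field K] [Algebra k K] {V : ValuationSubring K}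
    (hV : ∀ c : k, algebraMap k K c ∈ V) : V.valuation.IsTrivialOn k := by
  refine ⟨fun c hc => le_antisymm ((V.valuation_le_one_iff _).2 (hV c)) ?_⟩
  have := (V.valuation_le_one_iff _).2 (hV c⁻¹)
  rw [map_inv₀, map_inv₀] at this
  have h0 : V.valuation (algebraMap k K c) ≠ 0 := by simpa using hc
  exact (inv_le_one₀ (zero_lt_iff.2 h0)).1 this

variable {a b} {V : ValuationSubring (FunField a b)}
  (hV : ∀ c : k, algebraMap k (FunField a b) c ∈ V) (hx : xCoord a b ∉ V)
include hV hx

local notation "v" => V.valuation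

/-- The leading term dominates the cubic in `x`, so `y² + y` has the value of `x³`; then `y` has a
pole and `y²` dominates `y`. -/
theorem valuation_xCoord_yCoord : 1 < v (xCoord a b) ∧ 1 < v (yCoord a b) ∧
    v (yCoord a b) ^ 2 = v (xCoord a b) ^ 3 := by
  have htriv := valuation_isTrivialOn hV
  have h1 : 1 < v (xCoord a b) := by
    rw [← not_le, V.valuation_le_one_iff]; exact hx
  have hpoly : v (xCoord a b ^ 3 + algebraMap k _ a * xCoord a b + algebraMap k _ b) =
      v (xCoord a b) ^ 3 := by
    have hdeg : (Polynomial.X ^ 3 + Polynomial.C a * Polynomial.X +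
        Polynomial.C b : Polynomial k).natDegree = 3 := by compute_degree!
    have := Polynomial.valuation_aeval_eq_valuation_X_pow_natDegree_of_one_lt_valuation_X
      (xCoord a b) h1 (p := Polynomial.X ^ 3 + Polynomial.C a * Polynomial.X +
        Polynomial.C b) (by
          intro h0
          rw [h0] at hdeg
          simp at hdeg)
    rw [hdeg] at this
    simpa using this
  rw [← weierstrass_equation] at hpoly
  have hy : 1 < v (yCoord a b) := by
    rw [← not_le]
    intro hle
    have : v (yCoord a b ^ 2 + yCoord a b) ≤ 1 :=
      Valuation.map_add_le _ (by rw [map_pow]; exact pow_le_one₀ zero_le hle) hle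
    rw [hpoly] at this
    exact absurd (one_lt_pow₀ h1 (by norm_num : 3 ≠ 0)) (not_lt.2 this)
  refine ⟨h1, hy, ?_⟩
  rw [← hpoly, Valuation.map_add_eq_of_lt_left, map_pow]
  rw [map_pow]
  exact lt_self_pow₀ hy (by norm_num)

theorem valuation_uniformizer_infinity :
    v (xCoord a b / yCoord a b) < 1 ∧ 0 < v (xCoord a b / yCoord a b) ∧
    v (xCoord a b) = v (xCoord a b / yCoord a b) ^ (-2 : ℤ) ∧
    v (yCoord a b) = v (xCoord a b / yCoord a b) ^ (-3 : ℤ) := by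
  obtain ⟨hx1, hy1, he⟩ := valuation_xCoord_yCoord hV hx
  have hx0 : v (xCoord a b) ≠ 0 := (zero_lt_one.trans hx1).ne'
  have hy0 : v (yCoord a b) ≠ 0 := (zero_lt_one.trans hy1).ne'
  generalize hX : v (xCoord a b) = X at *
  generalize hY : v (yCoord a b) = Y at *
  have hX2 : X = (X / Y) ^ (-2 : ℤ) := by
    rw [zpow_neg, show ((X / Y) ^ (2 : ℤ)) = (X / Y) ^ 2 from zpow_natCast _ 2, div_pow, he, inv_div]
    field_simp
  have hY3 : Y = (X / Y) ^ (-3 : ℤ) := by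
    rw [zpow_neg, show ((X / Y) ^ (3 : ℤ)) = (X / Y) ^ 3 from zpow_natCast _ 3, div_pow, ← he, inv_div]
    field_simp
  rw [map_div₀, hX, hY]
  refine ⟨?_, zero_lt_iff.2 (div_ne_zero hx0 hy0), hX2, hY3⟩
  by_contra hge
  rw [not_lt] at hge
  have := zpow_le_one_of_nonpos₀ hge (by norm_num : (-2 : ℤ) ≤ 0)
  rw [← hX2] at this
  exact absurd hx1 (not_lt.2 this)

theorem valuation_aeval_infinity {p : Polynomial k} (hp : p ≠ 0) :
    v (Polynomial.aeval (xCoord a b) p) =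
      v (xCoord a b / yCoord a b) ^ (-2 * (p.natDegree : ℤ)) := by
  have htriv := valuation_isTrivialOn hV
  rw [Polynomial.valuation_aeval_eq_valuation_X_pow_natDegree_of_one_lt_valuation_X
    (xCoord a b) (valuation_xCoord_yCoord hV hx).1 hp,
    (valuation_uniformizer_infinity hV hx).2.2.1, ← zpow_natCast, ← zpow_mul]

theorem valuation_aeval_mul_yCoord_infinity {q : Polynomial k} (hq : q ≠ 0) :
    v (Polynomial.aeval (xCoord a b) q * yCoord a b) =
      v (xCoord a b / yCoord a b) ^ (-2 * (q.natDegree : ℤ) - 3) := by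
  obtain ⟨-, h0, -, hy⟩ := valuation_uniformizer_infinity hV hx
  rw [map_mul, valuation_aeval_infinity hV hx hq, sub_eq_add_neg, zpow_add₀ h0.ne', ← hy]

/-- The orders `-2 deg p` and `-2 deg q - 3` have different parity, so the two terms never cancel.
-/
theorem valuation_add_infinity (p q : Polynomial k) :
    v (Polynomial.aeval (xCoord a b) p + Polynomial.aeval (xCoord a b) q * yCoord a b) =
      max (v (Polynomial.aeval (xCoord a b) p))
        (v (Polynomial.aeval (xCoord a b) q * yCoord a b)) := by
  rcases eq_or_ne p 0 with rfl | hp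
  · simp
  rcases eq_or_ne q 0 with rfl | hq
  · simp
  apply Valuation.map_add_of_distinct_val
  obtain ⟨h1, h0, -, -⟩ := valuation_uniformizer_infinity hV hx
  rw [valuation_aeval_infinity hV hx hp, valuation_aeval_mul_yCoord_infinity hV hx hq]
  intro h
  have := zpow_right_injective₀ h0 h1.ne h
  omega

theorem exists_zpow_infinity [CharP k 2] (z : FunField a b) (hz : z ≠ 0) :
    ∃ n : ℤ, v z = v (xCoord a b / yCoord a b) ^ n := by
  obtain ⟨h1, h0, -, -⟩ := valuation_uniformizer_infinity hV hx
  obtain ⟨p, q, r, hr, rfl⟩ := exists_eq_div a b z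
  have hn : ∃ n : ℤ, v (Polynomial.aeval (xCoord a b) p +
      Polynomial.aeval (xCoord a b) q * yCoord a b) = v (xCoord a b / yCoord a b) ^ n := by
    rw [valuation_add_infinity hV hx]
    rcases eq_or_ne p 0 with rfl | hp
    · rcases eq_or_ne q 0 with rfl | hq
      · simp at hz
      · exact ⟨_, by rw [map_zero, map_zero, max_eq_right zero_le,
          valuation_aeval_mul_yCoord_infinity hV hx hq]⟩
    · rcases eq_or_ne q 0 with rfl | hq
      · exact ⟨_, by rw [map_zero, zero_mul, map_zero, max_eq_left zero_le,
          valuation_aeval_infinity hV hx hp]⟩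
      · rcases max_choice (v (Polynomial.aeval (xCoord a b) p))
          (v (Polynomial.aeval (xCoord a b) q * yCoord a b)) with h | h
        · exact ⟨_, by rw [h, valuation_aeval_infinity hV hx hp]⟩
        · exact ⟨_, by rw [h, valuation_aeval_mul_yCoord_infinity hV hx hq]⟩
  obtain ⟨n, hn⟩ := hn
  refine ⟨n - -2 * r.natDegree, ?_⟩
  rw [map_div₀, hn, valuation_aeval_infinity hV hx hr, zpow_sub₀ h0.ne']

omit hV hx in
theorem Place.isUniformizerOn_infinity [CharP k 2] {P : Place k (FunField a b)}
    (hx : xCoord a b ∉ P.localRing) :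
    P.IsUniformizerOn ⊤ (xCoord a b / yCoord a b) := by
  obtain ⟨h1, h0, -, -⟩ := valuation_uniformizer_infinity P.algebraMap_mem hx
  exact ⟨trivial, fun h => by simp [h] at h0, h1, fun z _ hz =>
    exists_zpow_infinity P.algebraMap_mem hx z hz⟩

variable (a b) in
omit hV hx in
-- As `1/x` is transcendental, it generates a proper ideal of `k[1/x]`, and some valuation ring
-- containing `k[1/x]` has it as a nonunit. The preceding computation shows this ring to be
-- discrete.
theorem exists_place_infinity [CharP k 2] :
    ∃ P : Place k (FunField a b), xCoord a b ∉ P.localRing := by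
  let A := (Algebra.adjoin k {(xCoord a b)⁻¹}).toSubring
  have hmem : (xCoord a b)⁻¹ ∈ A := Algebra.self_mem_adjoin_singleton k _
  have htr : Transcendental k (xCoord a b)⁻¹ := by
    have h := transcendental_iff_injective.2 (aeval_xCoord_injective a b)
    intro halg
    exact h (by simpa using halg.inv)
  have hI : Ideal.span {(⟨(xCoord a b)⁻¹, hmem⟩ : A)} ≠ ⊤ := by
    intro htop
    rw [Ideal.eq_top_iff_one, Ideal.mem_span_singleton'] at htop
    obtain ⟨⟨g, hg⟩, e⟩ := htop
    have hg' : g ∈ Algebra.adjoin k {(xCoord a b)⁻¹} := hg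
    rw [Algebra.adjoin_singleton_eq_range_aeval] at hg'
    obtain ⟨p, rfl⟩ := hg'
    have e' : Polynomial.aeval (xCoord a b)⁻¹ p * (xCoord a b)⁻¹ = 1 := congrArg Subtype.val e
    have h0 : Polynomial.aeval (xCoord a b)⁻¹ (p * Polynomial.X - 1) = 0 := by
      simp [e']
    have h1 := (transcendental_iff_injective.1 htr) (h0.trans (map_zero _).symm)
    have h2 := congrArg (Polynomial.coeff · 0) h1
    simp at h2
  obtain ⟨V, hAV, hIV⟩ := Ideal.image_subset_nonunits_valuationSubring _ hI
  have hnon : (xCoord a b)⁻¹ ∈ V.nonunits := hIV ⟨_, Ideal.mem_span_singleton_self _, rfl⟩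
  have hx0 : xCoord a b ≠ 0 := by
    have := aeval_xCoord_ne_zero a b (p := Polynomial.X) Polynomial.X_ne_zero
    simpa using this
  have hx : xCoord a b ∉ V := (V.inv_mem_nonunits_iff.1 hnon).resolve_left hx0
  have hV : ∀ c : k, algebraMap k (FunField a b) c ∈ V := fun c =>
    hAV (Subalgebra.algebraMap_mem (Algebra.adjoin k {(xCoord a b)⁻¹}) c)
  obtain ⟨h1, h0, -, -⟩ := valuation_uniformizer_infinity hV hx
  exact ⟨⟨V, hV, isDiscreteValuationRing_of_zpow (fun h => by simp [h] at h0) h1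
    (exists_zpow_infinity hV hx)⟩, hx⟩

end Infinity
end SYCurve

namespace SYCurve

/-! ### Valuation rings above a Dedekind domain. -/

section Dedekind

/-- Valuation rings above a Dedekind domain are localizations of it. -/
theorem ValuationSubring.exists_eq_div_of_dedekind {A K : Type*} [CommRing A] [IsDedekindDomain A]
    [Field K] [Algebra A K] [IsFractionRing A K] {V : ValuationSubring K}
    (hA : ∀ n : A, algebraMap A K n ∈ V) {w : K} (hw : w ∉ V) :
    IsDiscreteValuationRing V ∧ ∀ z ∈ V, ∃ n s : A,
      V.valuation (algebraMap A K s) = 1 ∧ z = algebraMap A K n / algebraMap A K s := by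
  let f : A →+* V := (algebraMap A K).codRestrict V.toSubring hA
  let p : Ideal A := (IsLocalRing.maximalIdeal V).comap f
  have hpp : p.IsPrime := inferInstance
  have hp : ∀ s : A, s ∉ p ↔ V.valuation (algebraMap A K s) = 1 := by
    intro s
    have h1 : s ∈ p ↔ V.valuation (algebraMap A K s) < 1 :=
      V.valuation_lt_one_iff (f s)
    rw [h1, not_lt]
    exact ⟨fun h => le_antisymm (V.valuation_le_one (f s)) h, fun h => h.ge⟩
  -- The element `w` outside `V` ensures that `V` is not all of `K`, so its centre on `A` is nonzero
  -- and the localization `B` there is a discrete valuation ring.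
  have hp0 : p ≠ ⊥ := by
    intro h0
    apply hw
    obtain ⟨n, s, hs, rfl⟩ := IsFractionRing.div_surjective (A := A) w
    have hs' : V.valuation (algebraMap A K s) = 1 := by
      rw [← hp, h0, Ideal.mem_bot]
      exact nonZeroDivisors.ne_zero hs
    rw [← V.valuation_le_one_iff, map_div₀, hs', div_one]
    exact (V.valuation_le_one_iff _).2 (hA n)
  let B := Localization.subalgebra.ofField K p.primeCompl p.primeCompl_le_nonZeroDivisors
  have hB : ∀ z, z ∈ B ↔ ∃ (n s : A) (_ : s ∈ p.primeCompl),
      z = algebraMap A K n * (algebraMap A K s)⁻¹ := fun z => Iff.rfl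
  have : IsLocalization.AtPrime B p :=
    Localization.subalgebra.isLocalization_ofField K p.primeCompl _
  have hdvr : IsDiscreteValuationRing B :=
    IsLocalization.AtPrime.isDiscreteValuationRing_of_dedekind_domain A hp0 B
  have hBV : ∀ z ∈ B, z ∈ V := by
    intro z hz
    obtain ⟨n, s, hs, rfl⟩ := (hB z).1 hz
    rw [← V.valuation_le_one_iff, map_mul, map_inv₀, (hp s).1 hs, inv_one, mul_one]
    exact (V.valuation_le_one_iff _).2 (hA n)
  have hVB : ∀ z ∈ V, z ∈ B := by
    intro z hz
    rcases ValuationRing.isInteger_or_isInteger B z with ⟨y, hy⟩ | ⟨y, hy⟩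
    · rw [← hy]; exact y.2
    -- If only `z⁻¹ = n / s` is known to lie in `B`, then `z = s / n` being in `V` forces `n` to be
    -- a unit of `V`, so `z` lies in `B` as well.
    · obtain ⟨n, s, hs, e⟩ := (hB y).1 y.2
      have hs1 := (hp s).1 hs
      have e' : z⁻¹ = algebraMap A K n * (algebraMap A K s)⁻¹ := hy.symm.trans e
      rcases eq_or_ne z 0 with rfl | hz0
      · exact zero_mem _
      have hs0 : algebraMap A K s ≠ 0 := fun h => by simp [h] at hs1
      have hn0 : algebraMap A K n ≠ 0 := by
        intro h
        rw [h, zero_mul] at e'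
        exact inv_ne_zero hz0 e'
      have ez : z = algebraMap A K s * (algebraMap A K n)⁻¹ := by
        rw [← inv_inv z, e', mul_inv, inv_inv, mul_comm]
      refine (hB z).2 ⟨s, n, ?_, ez⟩
      apply (hp n).2
      apply le_antisymm ((V.valuation_le_one_iff _).2 (hA n))
      have h1 := (V.valuation_le_one_iff _).2 hz
      rw [ez, map_mul, hs1, one_mul, map_inv₀] at h1
      exact (inv_le_one₀ (zero_lt_iff.2 ((Valuation.ne_zero_iff _).2 hn0))).1 h1
  refine ⟨?_, fun z hz => ?_⟩
  · let e : B ≃+* V :=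
      { toFun := fun z => ⟨z, hBV z z.2⟩
        invFun := fun z => ⟨z, hVB z z.2⟩
        left_inv := fun _ => rfl
        right_inv := fun _ => rfl
        map_mul' := fun _ _ => rfl
        map_add' := fun _ _ => rfl }
    exact IsDiscreteValuationRing.RingEquivClass.isDiscreteValuationRing e
  · obtain ⟨n, s, hs, e⟩ := (hB z).1 (hVB z hz)
    exact ⟨n, s, (hp s).1 hs, by rw [e, div_eq_mul_inv]⟩

end Dedekind

/-! ### The coordinate ring is Dedekind; affine points of the curve. -/

section Affine

variable {k : Type*} [Field k] (a b : k)

theorem exists_aeval_eq_of_isIntegral {q r : Polynomial k}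
    (h : IsIntegral (Polynomial k)
      (Polynomial.aeval (xCoord a b) q / Polynomial.aeval (xCoord a b) r)) :
    ∃ p : Polynomial k, Polynomial.aeval (xCoord a b) q / Polynomial.aeval (xCoord a b) r =
      Polynomial.aeval (xCoord a b) p := by
  have hinj : Function.Injective (Algebra.ofId (Polynomial k) (FunField a b)) :=
    FaithfulSMul.algebraMap_injective _ _
  let ψ : FractionRing (Polynomial k) →ₐ[Polynomial k] FunField a b :=
    IsFractionRing.liftAlgHom hinj
  have hψ : ∀ p : Polynomial k, ψ (algebraMap _ _ p) = Polynomial.aeval (xCoord a b) p := fun p => by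
    rw [AlgHom.commutes, algebraMap_polynomial]
  have e : Polynomial.aeval (xCoord a b) q / Polynomial.aeval (xCoord a b) r =
      ψ (algebraMap _ _ q / algebraMap _ _ r) := by rw [map_div₀, hψ, hψ]
  rw [e, isIntegral_algHom_iff ψ ψ.injective, IsIntegrallyClosed.isIntegral_iff] at h
  obtain ⟨p, hp⟩ := h
  exact ⟨p, by rw [e, ← hp, hψ]⟩

variable [CharP k 2]

theorem exists_conj : ∃ σ : FunField a b →ₐ[Polynomial k] FunField a b,
    σ (yCoord a b) = yCoord a b + 1 := by
  have h2 : (2 : FunField a b) = 0 := CharTwo.two_eq_zero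
  have hw := weierstrass_equation a b
  have hroot : (curve a b).polynomial.eval₂
      (Algebra.ofId (Polynomial k) (FunField a b) : Polynomial k →+* FunField a b)
      (yCoord a b + 1) = 0 := by
    have hC : ∀ p : Polynomial k, (Algebra.ofId (Polynomial k) (FunField a b) :
        Polynomial k →+* FunField a b) p = Polynomial.aeval (xCoord a b) p :=
      algebraMap_polynomial a b
    simp only [WeierstrassCurve.Affine.polynomial, curve, Polynomial.eval₂_sub,
      Polynomial.eval₂_add, Polynomial.eval₂_mul, Polynomial.eval₂_pow, Polynomial.eval₂_X,
      Polynomial.eval₂_C, hC, map_add, map_mul, map_pow, Polynomial.aeval_X, Polynomial.aeval_C,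
      map_zero, map_one, Polynomial.eval₂_zero, Polynomial.eval₂_one]
    linear_combination hw + (yCoord a b + 1) * h2
  let σ₀ : CoordRing a b →ₐ[Polynomial k] FunField a b :=
    AdjoinRoot.liftAlgHom _ (Algebra.ofId (Polynomial k) (FunField a b)) (yCoord a b + 1) hroot
  have hσY : σ₀ (WeierstrassCurve.Affine.CoordinateRing.mk (curve a b) Polynomial.X) =
      yCoord a b + 1 := AdjoinRoot.lift_root hroot
  have hinj : Function.Injective σ₀ := by
    rw [injective_iff_map_eq_zero]
    intro z hz
    obtain ⟨p, q, rfl⟩ := WeierstrassCurve.Affine.CoordinateRing.exists_smul_basis_eq z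
    rw [map_add, map_smul, map_smul, map_one, hσY, Algebra.smul_def, Algebra.smul_def,
      algebraMap_polynomial, algebraMap_polynomial] at hz
    obtain ⟨h1, h2⟩ := aeval_add_mul_yCoord_eq_zero a b (p := p + q) (q := q) (by
      rw [map_add]; linear_combination hz)
    rw [h2, add_zero] at h1
    rw [h1, h2]
    simp
  refine ⟨IsFractionRing.liftAlgHom hinj, ?_⟩
  rw [IsFractionRing.liftAlgHom_apply, yCoord, IsFractionRing.lift_algebraMap]
  exact hσY

/-- For `z = (p + q y) / r` the conjugation `y ↦ y + 1` gives the trace `q / r`, without any factor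
to divide out. It is integral over `k[x]`, hence a polynomial; then so is `p / r = z - (q / r) y`.
-/
theorem exists_algebraMap_eq_of_isIntegral {z : FunField a b} (hz : IsIntegral (Polynomial k) z) :
    ∃ n : CoordRing a b, algebraMap (CoordRing a b) (FunField a b) n = z := by
  obtain ⟨p, q, r, hr, rfl⟩ := exists_eq_div a b z
  have hr0 := aeval_xCoord_ne_zero a b hr
  obtain ⟨σ, hσ⟩ := exists_conj a b
  have hσp : ∀ p : Polynomial k, σ (Polynomial.aeval (xCoord a b) p) =
      Polynomial.aeval (xCoord a b) p := fun p => by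
    rw [← algebraMap_polynomial, AlgHom.commutes]
  have hy : IsIntegral (Polynomial k) (yCoord a b) := by
    have : Algebra.IsIntegral (Polynomial k) (CoordRing a b) := by
      have : Module.Finite (Polynomial k) (CoordRing a b) :=
        Module.Finite.of_basis (WeierstrassCurve.Affine.CoordinateRing.basis (curve a b))
      infer_instance
    exact (Algebra.IsIntegral.isIntegral (R := Polynomial k)
      (WeierstrassCurve.Affine.CoordinateRing.mk (curve a b) Polynomial.X)).algebraMap
  have h2 : (2 : FunField a b) = 0 := CharTwo.two_eq_zero
  have hsum : IsIntegral (Polynomial k)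
      (Polynomial.aeval (xCoord a b) q / Polynomial.aeval (xCoord a b) r) := by
    have := hz.add (hz.map σ)
    rw [map_div₀, map_add, map_mul, hσ, hσp, hσp, hσp] at this
    refine (congrArg (IsIntegral (Polynomial k)) ?_).mp this
    linear_combination ((Polynomial.aeval (xCoord a b) p +
      Polynomial.aeval (xCoord a b) q * yCoord a b) / Polynomial.aeval (xCoord a b) r) * h2
  obtain ⟨q', hq'⟩ := exists_aeval_eq_of_isIntegral a b hsum
  have hp : IsIntegral (Polynomial k)
      (Polynomial.aeval (xCoord a b) p / Polynomial.aeval (xCoord a b) r) := by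
    have := hz.sub (hsum.mul hy)
    refine (congrArg (IsIntegral (Polynomial k)) ?_).mp this
    ring
  obtain ⟨p', hp'⟩ := exists_aeval_eq_of_isIntegral a b hp
  refine ⟨p' • 1 + q' • WeierstrassCurve.Affine.CoordinateRing.mk (curve a b) Polynomial.X, ?_⟩
  rw [algebraMap_smul_basis, ← hp', ← hq']
  field_simp

instance : Module.Finite (Polynomial k) (CoordRing a b) :=
  Module.Finite.of_basis (WeierstrassCurve.Affine.CoordinateRing.basis (curve a b))

theorem isIntegrallyClosed_coordRing : IsIntegrallyClosed (CoordRing a b) := by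
  rw [isIntegrallyClosed_iff (FunField a b)]
  intro z hz
  exact exists_algebraMap_eq_of_isIntegral a b (isIntegral_trans z hz)

instance : IsDedekindDomain (CoordRing a b) := by
  have := isIntegrallyClosed_coordRing a b
  have : Ring.DimensionLEOne (CoordRing a b) := .of_isIntegral (Polynomial k) _
  have : IsNoetherianRing (CoordRing a b) := .of_finite (Polynomial k) _
  exact {}

variable {a b}

omit [CharP k 2] in
theorem Place.yCoord_mem {P : Place k (FunField a b)} (hx : xCoord a b ∈ P.localRing) :
    yCoord a b ∈ P.localRing := by
  rw [P.mem_iff]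
  by_contra! h
  have h1 : P.localRing.valuation (yCoord a b ^ 2 + yCoord a b) ≤ 1 := by
    rw [weierstrass_equation, ← P.mem_iff]
    exact add_mem (add_mem (pow_mem hx 3) (mul_mem (P.algebraMap_mem a) hx)) (P.algebraMap_mem b)
  rw [Valuation.map_add_eq_of_lt_left, map_pow] at h1
  · exact absurd (one_lt_pow₀ h two_ne_zero) (not_lt.2 h1)
  · rw [map_pow]
    exact lt_self_pow₀ h (by norm_num)

omit [CharP k 2] in
theorem Place.coordRing_mem {P : Place k (FunField a b)} (hx : xCoord a b ∈ P.localRing)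
    (n : CoordRing a b) : algebraMap (CoordRing a b) (FunField a b) n ∈ P.localRing := by
  obtain ⟨p, q, e⟩ := exists_algebraMap_coordRing_eq a b n
  rw [e]
  exact add_mem (P.aeval_mem hx p) (mul_mem (P.aeval_mem hx q) (Place.yCoord_mem hx))

omit [CharP k 2] in
theorem Place.exists_notMem {K : Type*} [Field K] [Algebra k K] (P : Place k K) :
    ∃ w : K, w ∉ P.localRing := by
  obtain ⟨τ, hτ⟩ := Place.IsUniformizerOn.exists_isUniformizerOn_top P
  refine ⟨τ⁻¹, ?_⟩
  rw [P.mem_iff, map_inv₀, not_le]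
  exact (one_lt_inv₀ hτ.val_pos).2 hτ.lt_one

theorem Place.exists_eq_div {P : Place k (FunField a b)} (hx : xCoord a b ∈ P.localRing)
    {z : FunField a b} (hz : z ∈ P.localRing) : ∃ n s : CoordRing a b,
      P.localRing.valuation (algebraMap (CoordRing a b) (FunField a b) s) = 1 ∧
      z = algebraMap _ _ n / algebraMap _ _ s := by
  obtain ⟨w, hw⟩ := P.exists_notMem
  exact (ValuationSubring.exists_eq_div_of_dedekind (Place.coordRing_mem hx) hw).2 z hz

/-- `x` is a local parameter at the affine points, up to constants. -/
theorem Place.exists_D_eq_smul_xCoord {P : Place k (FunField a b)}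
    (hx : xCoord a b ∈ P.localRing) {z : FunField a b} (hz : z ∈ P.localRing) :
    ∃ r ∈ P.localRing, KaehlerDifferential.D k (FunField a b) z =
      r • KaehlerDifferential.D k (FunField a b) (xCoord a b) := by
  have hD : ∀ n : CoordRing a b, ∃ r ∈ P.localRing,
      KaehlerDifferential.D k (FunField a b) (algebraMap (CoordRing a b) (FunField a b) n) =
        r • KaehlerDifferential.D k (FunField a b) (xCoord a b) := by
    intro n
    obtain ⟨p, q, e⟩ := exists_algebraMap_coordRing_eq a b n
    refine ⟨Polynomial.aeval (xCoord a b) (Polynomial.derivative p) +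
      (Polynomial.aeval (xCoord a b) q * (xCoord a b ^ 2 + algebraMap k _ a) +
        yCoord a b * Polynomial.aeval (xCoord a b) (Polynomial.derivative q)), ?_, ?_⟩
    · exact add_mem (P.aeval_mem hx _) (add_mem (mul_mem (P.aeval_mem hx _)
        (add_mem (pow_mem hx 2) (P.algebraMap_mem a)))
        (mul_mem (Place.yCoord_mem hx) (P.aeval_mem hx _)))
    · rw [e, map_add, Derivation.leibniz, D_aeval, D_aeval, D_yCoord, smul_smul, smul_smul,
        ← add_smul, ← add_smul]
  obtain ⟨n, s, hs, rfl⟩ := Place.exists_eq_div hx hz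
  obtain ⟨n', hn', en⟩ := hD n
  obtain ⟨s', hs', es⟩ := hD s
  exact P.exists_D_div (Place.coordRing_mem hx n) hs hn' hs' en es

/-- A function that is regular at all affine points belongs to the coordinate ring. -/
theorem exists_algebraMap_eq_of_forall_mem {z : FunField a b}
    (hz : ∀ P : Place k (FunField a b), xCoord a b ∈ P.localRing → z ∈ P.localRing) :
    ∃ n : CoordRing a b, algebraMap (CoordRing a b) (FunField a b) n = z := by
  by_contra hne
  let R : Subring (FunField a b) := (algebraMap (CoordRing a b) (FunField a b)).range
  have := isIntegrallyClosed_coordRing a b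
  have hR : IsIntegrallyClosedIn R (FunField a b) := by
    rw [Subring.isIntegrallyClosedIn_iff]
    intro w hw
    let S : Subalgebra (CoordRing a b) (FunField a b) := ⊥
    have hS : IsIntegral S w := by
      have e : R = S.toSubring := by
        ext u
        exact Algebra.mem_bot.symm
      rw [e] at hw
      exact hw
    have : Algebra.IsIntegral (CoordRing a b) S :=
      Algebra.IsIntegral.of_surjective (Algebra.ofId (CoordRing a b) S) fun u => by
        obtain ⟨n, hn⟩ := Algebra.mem_bot.1 u.2
        exact ⟨n, Subtype.ext hn⟩
    exact IsIntegrallyClosed.isIntegral_iff.1 (isIntegral_trans (R := CoordRing a b) w hS)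
  -- An integrally closed subring is the intersection of the valuation rings containing it. The one
  -- found here omits `z` and contains the Dedekind coordinate ring, so it is discrete and defines
  -- an affine point.
  obtain ⟨V, hRV, hzV⟩ := Subring.exists_le_valuationSubring_of_isIntegrallyClosedIn
    (R := R) (x := z) hne
  have hA : ∀ n : CoordRing a b, algebraMap (CoordRing a b) (FunField a b) n ∈ V := fun n =>
    hRV ⟨n, rfl⟩
  let P : Place k (FunField a b) :=
    { toValuationSubring := V
      algebraMap_mem' := fun c => hA (algebraMap k (CoordRing a b) c)
      isDVR' := (ValuationSubring.exists_eq_div_of_dedekind hA hzV).1 }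
  exact hzV (hz P (hA _))

/-- At an affine point, every regular function satisfies a polynomial equation over `k` modulo
the maximal ideal. -/
theorem Place.exists_polynomial_valuation_lt_one {P : Place k (FunField a b)}
    (hx : xCoord a b ∈ P.localRing) (n : CoordRing a b) : ∃ q : Polynomial k, q ≠ 0 ∧
      P.localRing.valuation
        (Polynomial.aeval (algebraMap (CoordRing a b) (FunField a b) n) q) < 1 := by
  let f : CoordRing a b →+* P.localRing :=
    (algebraMap (CoordRing a b) (FunField a b)).codRestrict P.localRing.toSubring
      (Place.coordRing_mem hx)
  let p : Ideal (CoordRing a b) := (IsLocalRing.maximalIdeal P.localRing).comap f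
  have hp : ∀ s : CoordRing a b, s ∈ p ↔
      P.localRing.valuation (algebraMap (CoordRing a b) (FunField a b) s) < 1 := fun s =>
    P.localRing.valuation_lt_one_iff (f s)
  have hpp : p.IsPrime := inferInstance
  have hp0 : p ≠ ⊥ := by
    intro h0
    obtain ⟨w, hw⟩ := P.exists_notMem
    obtain ⟨m, s, hs, rfl⟩ := IsFractionRing.div_surjective (A := CoordRing a b) w
    apply hw
    have hs' : s ∉ p := by
      rw [h0, Ideal.mem_bot]
      exact nonZeroDivisors.ne_zero hs
    rw [hp, not_lt] at hs'
    rw [P.mem_iff, map_div₀]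
    exact div_le_one_of_le₀ (((P.mem_iff _).1 (Place.coordRing_mem hx m)).trans hs') zero_le
  have hmax : p.IsMaximal := hpp.isMaximal hp0
  let := Ideal.Quotient.field p
  have : Algebra.FiniteType k (CoordRing a b) :=
    Algebra.FiniteType.trans (S := Polynomial k) inferInstance inferInstance
  -- By the Nullstellensatz the residue field is finite over `k`, so the residue of `n` has a
  -- minimal polynomial.
  have : Module.Finite k (CoordRing a b ⧸ p) :=
    finite_of_finite_type_of_isJacobsonRing k (CoordRing a b ⧸ p)
  have hint : IsIntegral k (Ideal.Quotient.mk p n) := Algebra.IsIntegral.isIntegral _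
  refine ⟨minpoly k (Ideal.Quotient.mk p n), minpoly.ne_zero hint, ?_⟩
  rw [Polynomial.aeval_algebraMap_apply, ← hp, ← Ideal.Quotient.eq_zero_iff_mem]
  have h1 := minpoly.aeval k (Ideal.Quotient.mk p n)
  rwa [← Ideal.Quotient.mkₐ_eq_mk k, Polynomial.aeval_algHom_apply] at h1

end Affine
end SYCurve

namespace SYCurve

/-! ### Local conditions on `β` at affine points and at infinity. -/

section Torsor

variable {k : Type*} [Field k] [CharP k 2] {a b : k}

local notation "d" => KaehlerDifferential.D k (FunField a b)

section Perfect

variable [PerfectField k]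

/-- At an affine point `dτ` is a regular multiple of `dx`, so `dx/dτ` is a unit and `x` behaves like
a uniformizer as far as the symbol is concerned. -/
theorem Place.exists_expansion_xCoord {P : Place k (FunField a b)} (hx : xCoord a b ∈ P.localRing)
    {τ : FunField a b} (hτ : P.IsUniformizerOn ⊤ τ) : ∃ c, IsExpansion (xCoord a b) τ c ∧
      P.localRing.valuation (c 1 ^ 2 + c 3 ^ 2 * τ) = 1 ∧
      P.localRing.valuation (symbolCoeff τ c) ≤ 1 := by
  have hτD := hτ.mem_separableMorphisms_top (sqGenerates_xCoord a b)
    (xCoord_mem_separableMorphisms a b)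
  obtain ⟨c, hc⟩ := (sqGenerates_xCoord a b).exists_expansion hτD (xCoord a b)
  obtain ⟨r, hr, hD⟩ := Place.exists_D_eq_smul_xCoord hx hτ.mem_localRing
  exact ⟨c, hc, hτ.val_symbolCoeff_le_one_of_D_eq hτD (fun _ => trivial) hc hx hr hD⟩

theorem Place.isExactAt_symbol_xCoord {P : Place k (FunField a b)}
    (hx : xCoord a b ∈ P.localRing) {τ : FunField a b} (hτ : P.IsUniformizerOn ⊤ τ) :
    P.IsExactAt (symbol (xCoord a b) τ) := by
  obtain ⟨c, hc, -, h⟩ := Place.exists_expansion_xCoord hx hτ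
  rw [hc.symbol_eq (hτ.mem_separableMorphisms_top (sqGenerates_xCoord a b)
    (xCoord_mem_separableMorphisms a b))]
  exact P.isExactAt_sq_smul hτ.mem_localRing h

omit [PerfectField k] in
-- The numerator `y + x (x² + a)` of the derivative equals `y² + b` by the curve equation, which is
-- the square of `y + e`.
theorem D_xCoord_div_yCoord (hy : yCoord a b ≠ 0) {e : k} (he : e ^ 2 = b) :
    d (xCoord a b / yCoord a b) =
      (1 + algebraMap k _ e / yCoord a b) ^ 2 • d (xCoord a b) := by
  have h2 : (2 : FunField a b) = 0 := CharTwo.two_eq_zero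
  have hw := weierstrass_equation a b
  have hb := congrArg (algebraMap k (FunField a b)) he
  rw [map_pow] at hb
  rw [← hb] at hw
  rw [D_div _ _ hy, D_yCoord, smul_smul, ← sub_smul, smul_smul]
  congr 1
  field_simp
  linear_combination hw - (yCoord a b ^ 2 + yCoord a b * algebraMap k _ e) * h2

/-- `dx` is a global generator of the differentials of the curve. -/
theorem Place.exists_D_xCoord_eq (P : Place k (FunField a b)) :
    ∃ τ ε : FunField a b, P.IsUniformizerOn ⊤ τ ∧ P.localRing.valuation ε = 1 ∧
      d (xCoord a b) = ε ^ 2 • d τ := by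
  by_cases hx : xCoord a b ∈ P.localRing
  · obtain ⟨τ, hτ⟩ := Place.IsUniformizerOn.exists_isUniformizerOn_top P
    obtain ⟨c, hc, h, -⟩ := Place.exists_expansion_xCoord hx hτ
    exact ⟨τ, _, hτ, h, hc.D_eq⟩
  · obtain ⟨e, he⟩ := exists_sq_eq b
    have hτ := Place.isUniformizerOn_infinity hx
    obtain ⟨-, -, -, hvy⟩ := valuation_uniformizer_infinity P.algebraMap_mem hx
    have hy : yCoord a b ≠ 0 := fun h0 => hτ.ne_zero (by rw [h0, div_zero])
    have hlt : P.localRing.valuation (algebraMap k _ e / yCoord a b) < 1 := by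
      rw [map_div₀, hvy, zpow_neg, div_inv_eq_mul]
      refine mul_lt_one_of_nonneg_of_lt_one_right ((P.mem_iff _).1 (P.algebraMap_mem e)) zero_le ?_
      have := hτ.zpow_lt_zpow_iff (m := 3) (n := 0)
      rw [zpow_zero] at this
      exact this.2 (by norm_num)
    have h1 : P.localRing.valuation (1 + algebraMap k _ e / yCoord a b) = 1 := by
      rw [Valuation.map_add_eq_of_lt_left] <;> simp [hlt, -map_div₀]
    have h0 : 1 + algebraMap k _ e / yCoord a b ≠ 0 := fun h0 => by simp [h0] at h1
    refine ⟨_, (1 + algebraMap k _ e / yCoord a b)⁻¹, hτ, by rw [map_inv₀, h1, inv_one], ?_⟩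
    rw [D_xCoord_div_yCoord hy he, smul_smul, ← mul_pow, inv_mul_cancel₀ h0, one_pow, one_smul]

theorem Place.isExactAt_sq_smul_D_xCoord_iff (P : Place k (FunField a b)) (β : FunField a b) :
    P.IsExactAt (β ^ 2 • d (xCoord a b)) ↔ P.localRing.valuation β ≤ 1 := by
  obtain ⟨τ, ε, hτ, hε, e⟩ := P.exists_D_xCoord_eq
  have hτD := hτ.mem_separableMorphisms_top (sqGenerates_xCoord a b)
    (xCoord_mem_separableMorphisms a b)
  rw [e, smul_smul, ← mul_pow, hτ.isExactAt_iff ((sqGenerates_xCoord a b).of_D_ne_zero trivial hτD)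
    hτD, map_mul, hε, mul_one]

/-- The symbol of a pseudotame `f` with respect to `x` is exact here, by comparison with a
uniformizer, so only `β² dx` matters. -/
theorem Place.isExactAt_affine_iff {P : Place k (FunField a b)} (hx : xCoord a b ∈ P.localRing)
    {f : FunField a b} (hf : f ∈ separableMorphisms k (K := FunField a b))
    (hpt : IsPseudotameAt P f) (β : FunField a b) :
    P.IsExactAt (β ^ 2 • d (xCoord a b) + symbol f (xCoord a b)) ↔
      P.localRing.valuation β ≤ 1 := by
  have hK := sqGenerates_xCoord a b
  have hxD := xCoord_mem_separableMorphisms a b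
  obtain ⟨τ, hτ⟩ := Place.IsUniformizerOn.exists_isUniformizerOn_top P
  have hτD := hτ.mem_separableMorphisms_top hK hxD
  rw [Place.IsExactAt.add_iff_left, Place.isExactAt_sq_smul_D_xCoord_iff]
  rw [← hK.cocycle hf hτD hxD, ← hK.symm hxD hτD]
  exact (hτ.isExactAt_symbol_of_pseudotame hK hxD hf hpt).add (Place.isExactAt_symbol_xCoord hx hτ)

omit [PerfectField k] in
variable (a b) in
theorem yCoord_pow_four : yCoord a b ^ 4 = yCoord a b ^ 2 + xCoord a b ^ 6 +
    algebraMap k _ a ^ 2 * xCoord a b ^ 2 + algebraMap k _ b ^ 2 := by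
  have h2 : (2 : FunField a b) = 0 := CharTwo.two_eq_zero
  have hy2 : yCoord a b ^ 2 = yCoord a b + xCoord a b ^ 3 + algebraMap k _ a * xCoord a b +
      algebraMap k _ b := by linear_combination weierstrass_equation a b - yCoord a b * h2
  have h4 : yCoord a b ^ 4 = (yCoord a b ^ 2) ^ 2 := by ring
  rw [h4]
  conv_lhs => rw [hy2]
  rw [add_pow_char _ _ 2, add_pow_char _ _ 2, add_pow_char _ _ 2]
  ring

omit [PerfectField k] in
-- Used to compute SY(y,x): its coefficient is the square of `x + α² + α / (x + α²)`, that is, `x`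
-- plus a function regular at infinity.
theorem isExpansion_yCoord {α β : k} (hα : α ^ 4 = a) (hβ : β ^ 4 = b + b ^ 2) :
    IsExpansion (yCoord a b) (xCoord a b) ![yCoord a b + algebraMap k _ β, algebraMap k _ α,
      algebraMap k _ α ^ 2 + xCoord a b, 1] := by
  have h2 : (2 : FunField a b) = 0 := CharTwo.two_eq_zero
  have hw := weierstrass_equation a b
  have hα' := congrArg (algebraMap k (FunField a b)) hα
  have hβ' := congrArg (algebraMap k (FunField a b)) hβ
  have fourth : ∀ u w : FunField a b, (u + w) ^ 4 = u ^ 4 + w ^ 4 := fun u w => by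
    simpa using add_pow_char_pow (R := FunField a b) (p := 2) (n := 2) u w
  have hy2 : yCoord a b ^ 2 = yCoord a b + xCoord a b ^ 3 + algebraMap k _ a * xCoord a b +
      algebraMap k _ b := by linear_combination hw - yCoord a b * h2
  have hy4 := yCoord_pow_four a b
  simp only [map_pow, map_add] at hα' hβ'
  simp only [IsExpansion, Matrix.cons_val, fourth]
  rw [hβ', hy4, hy2, ← pow_mul, show 2 * 4 = 4 * 2 by norm_num, pow_mul, hα']
  linear_combination (-xCoord a b ^ 3 - algebraMap k _ a * xCoord a b - algebraMap k _ b -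
    algebraMap k _ b ^ 2 - algebraMap k _ a ^ 2 * xCoord a b ^ 2 - xCoord a b ^ 6) * h2

omit [CharP k 2] [PerfectField k] in
theorem xCoord_add_algebraMap_ne_zero (c : k) : xCoord a b + algebraMap k _ c ≠ 0 := by
  have := aeval_xCoord_ne_zero a b (Polynomial.X_add_C_ne_zero c)
  simpa using this

theorem yCoord_mem_separableMorphisms :
    yCoord a b ∈ separableMorphisms k (K := FunField a b) := by
  obtain ⟨e, he⟩ := exists_sq_eq a
  change d (yCoord a b) ≠ 0
  have ha := congrArg (algebraMap k (FunField a b)) he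
  rw [map_pow] at ha
  rw [D_yCoord, ← ha, ← add_pow_char (xCoord a b) (algebraMap k _ e) 2]
  exact smul_ne_zero (pow_ne_zero _ (xCoord_add_algebraMap_ne_zero e))
    (xCoord_mem_separableMorphisms a b)

/-- Since `y` has the odd order -3, SY(f,y) is exact at infinity. Inserting `y` between `f` and `x`
leaves SY(y,x), whose main part `x² dx` shifts `β` by `x`. -/
theorem Place.isExactAt_infinity_iff {P : Place k (FunField a b)}
    (hx : xCoord a b ∉ P.localRing) {f : FunField a b}
    (hf : f ∈ separableMorphisms k (K := FunField a b)) (hpt : IsPseudotameAt P f)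
    (β : FunField a b) :
    P.IsExactAt (β ^ 2 • d (xCoord a b) + symbol f (xCoord a b)) ↔
      P.localRing.valuation (β + xCoord a b) ≤ 1 := by
  have hK := sqGenerates_xCoord a b
  have hxD := xCoord_mem_separableMorphisms a b
  have hyD := yCoord_mem_separableMorphisms (a := a) (b := b)
  have hτ := Place.isUniformizerOn_infinity hx
  have hτD := hτ.mem_separableMorphisms_top hK hxD
  obtain ⟨-, -, -, hvy⟩ := valuation_uniformizer_infinity P.algebraMap_mem hx
  have hfy : P.IsExactAt (symbol f (yCoord a b)) := by
    rw [← hK.cocycle hf hτD hyD, ← hK.symm hyD hτD]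
    refine (hτ.isExactAt_symbol_of_pseudotame hK hxD hf hpt).add
      (hτ.isExactAt_symbol_of_odd hK hxD (z := 0) (M := -3) (by decide) ?_)
    simpa using hvy
  obtain ⟨α, hα⟩ := exists_fourth_eq a
  obtain ⟨γ, hγ⟩ := exists_fourth_eq (b + b ^ 2)
  rw [← hK.cocycle hf hyD hxD, add_left_comm, add_comm, hfy.add_iff_left,
    (isExpansion_yCoord hα hγ).symbol_eq hxD, sq_smul_add, P.isExactAt_sq_smul_D_xCoord_iff]
  have h2 : (2 : FunField a b) = 0 := CharTwo.two_eq_zero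
  have hne := xCoord_add_algebraMap_ne_zero (a := a) (b := b) (α ^ 2)
  rw [map_pow] at hne
  have hx1 : 1 < P.localRing.valuation (xCoord a b) := by
    rw [← not_le, ← P.mem_iff]; exact hx
  have hvx : 1 < P.localRing.valuation (xCoord a b + algebraMap k _ α ^ 2) := by
    rw [Valuation.map_add_eq_of_lt_left]
    · exact hx1
    · exact lt_of_le_of_lt ((P.mem_iff _).1 (pow_mem (P.algebraMap_mem α) 2)) hx1
  have hmem : algebraMap k _ α ^ 2 + algebraMap k _ α / (xCoord a b + algebraMap k _ α ^ 2) ∈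
      P.localRing := by
    refine add_mem (pow_mem (P.algebraMap_mem α) 2) ?_
    rw [P.mem_iff, map_div₀]
    exact div_le_one_of_le₀ (((P.mem_iff _).1 (P.algebraMap_mem α)).trans hvx.le) zero_le
  have e : β + symbolCoeff (xCoord a b) ![yCoord a b + algebraMap k _ γ, algebraMap k _ α,
      algebraMap k _ α ^ 2 + xCoord a b, 1] = (β + xCoord a b) +
      (algebraMap k _ α ^ 2 + algebraMap k _ α / (xCoord a b + algebraMap k _ α ^ 2)) := by
    simp only [symbolCoeff, Matrix.cons_val, mul_one, one_pow, one_mul,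
      add_comm (algebraMap k _ α ^ 2) (xCoord a b)]
    field_simp
    ring
  rw [e, ← P.mem_iff, ← P.mem_iff]
  exact ⟨fun h => by simpa using sub_mem h hmem, fun h => add_mem h hmem⟩

omit [PerfectField k] in
-- Write `β = p(x) + q(x) y`. Without cancellation at infinity, regularity of `β + x` there forces
-- `q = 0` and `p + X` constant.
theorem exists_eq_xCoord_add {β : FunField a b}
    (hβ : ∀ P : Place k (FunField a b), xCoord a b ∈ P.localRing → β ∈ P.localRing)
    {P : Place k (FunField a b)} (hx : xCoord a b ∉ P.localRing)
    (hP : P.localRing.valuation (β + xCoord a b) ≤ 1) :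
    ∃ c : k, β = xCoord a b + algebraMap k _ c := by
  have h2 : (2 : FunField a b) = 0 := CharTwo.two_eq_zero
  obtain ⟨n, rfl⟩ := exists_algebraMap_eq_of_forall_mem hβ
  obtain ⟨p, q, e⟩ := exists_algebraMap_coordRing_eq a b n
  have hτ := Place.isUniformizerOn_infinity hx
  have e' : algebraMap (CoordRing a b) (FunField a b) n + xCoord a b =
      Polynomial.aeval (xCoord a b) (p + Polynomial.X) +
        Polynomial.aeval (xCoord a b) q * yCoord a b := by
    rw [e, map_add, Polynomial.aeval_X]; ring
  rw [e', valuation_add_infinity P.algebraMap_mem hx, max_le_iff] at hP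
  have hq : q = 0 := by
    by_contra hq
    have := hP.2
    rw [valuation_aeval_mul_yCoord_infinity P.algebraMap_mem hx hq,
      ← zpow_zero (P.localRing.valuation (xCoord a b / yCoord a b)), hτ.zpow_le_zpow_iff] at this
    omega
  have hp : (p + Polynomial.X).natDegree = 0 := by
    by_contra hp
    have hp0 : p + Polynomial.X ≠ 0 := fun h0 => hp (by rw [h0, Polynomial.natDegree_zero])
    have := hP.1
    rw [valuation_aeval_infinity P.algebraMap_mem hx hp0,
      ← zpow_zero (P.localRing.valuation (xCoord a b / yCoord a b)), hτ.zpow_le_zpow_iff] at this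
    omega
  obtain ⟨c, hc⟩ := Polynomial.natDegree_eq_zero.1 hp
  refine ⟨c, ?_⟩
  rw [← hc, hq, Polynomial.aeval_C, map_zero, zero_mul, add_zero] at e'
  linear_combination e' - xCoord a b * h2

end Perfect
end Torsor
end SYCurve

namespace SYCurve

/-! ### The tame morphism. -/

section Tame

variable {k : Type*} [Field k] [CharP k 2] {a b : k}

local notation "d" => KaehlerDifferential.D k (FunField a b)

variable (a b) in
/-- The tame function `x⁴ y + a x⁵ + x + a² y² + a⁴ x²`. -/
noncomputable def tameFunction : FunField a b :=
  xCoord a b ^ 4 * yCoord a b + algebraMap k _ a * xCoord a b ^ 5 + xCoord a b +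
    algebraMap k _ a ^ 2 * yCoord a b ^ 2 + algebraMap k _ a ^ 4 * xCoord a b ^ 2

/-- The function is `x + x¹⁰ + x⁷` plus a fourth power; `[1 : x² : x]` is a point of the conic for
`c = 0`. The fourth power is chosen to cancel the poles of `x¹⁰` and `x⁷` at infinity, leaving `x⁴
y` as the leading term. -/
theorem exists_isExpansion_tameFunction [PerfectField k] : ∃ c₀ : FunField a b,
    IsExpansion (tameFunction a b) (xCoord a b) ![c₀, 1, xCoord a b ^ 2, xCoord a b] := by
  obtain ⟨α, hα⟩ := exists_sq_eq a
  obtain ⟨δ, hδ⟩ := exists_sq_eq b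
  obtain ⟨β, hβ⟩ := exists_fourth_eq (b + b ^ 2)
  have hα' := congrArg (algebraMap k (FunField a b)) hα
  have hβ' := congrArg (algebraMap k (FunField a b)) hβ
  have hδ' := congrArg (algebraMap k (FunField a b)) hδ
  simp only [map_pow, map_add] at hα' hβ' hδ'
  have hα4 : algebraMap k (FunField a b) α ^ 4 = algebraMap k _ a ^ 2 := by rw [← hα']; ring
  have hδ4 : algebraMap k (FunField a b) δ ^ 4 = algebraMap k _ b ^ 2 := by rw [← hδ']; ring
  have fourth : ∀ u w : FunField a b, (u + w) ^ 4 = u ^ 4 + w ^ 4 := fun u w => by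
    simpa using add_pow_char_pow (R := FunField a b) (p := 2) (n := 2) u w
  have h2 : (2 : FunField a b) = 0 := CharTwo.two_eq_zero
  refine ⟨xCoord a b * yCoord a b + algebraMap k _ β * xCoord a b +
    algebraMap k _ α * yCoord a b + algebraMap k _ α * algebraMap k _ δ, ?_⟩
  simp only [IsExpansion, Matrix.cons_val, tameFunction, fourth, mul_pow, hα4, hδ4, hβ',
    yCoord_pow_four]
  linear_combination (-xCoord a b ^ 4) * weierstrass_equation a b +
    (xCoord a b ^ 4 * yCoord a b - xCoord a b ^ 10 - algebraMap k _ a ^ 2 * xCoord a b ^ 6 -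
      algebraMap k _ b ^ 2 * xCoord a b ^ 4 - algebraMap k _ b * xCoord a b ^ 4 -
      algebraMap k _ a ^ 2 * algebraMap k _ b ^ 2 - xCoord a b ^ 7) * h2

theorem D_tameFunction [PerfectField k] : d (tameFunction a b) =
    (xCoord a b ^ 3 + 1) ^ 2 • d (xCoord a b) := by
  obtain ⟨c₀, hc⟩ := exists_isExpansion_tameFunction (a := a) (b := b)
  rw [hc.D_eq]
  simp only [Matrix.cons_val]
  congr 2
  ring

omit [CharP k 2] in
theorem xCoord_cube_add_one_ne_zero : xCoord a b ^ 3 + 1 ≠ 0 := by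
  have h : (Polynomial.X ^ 3 + Polynomial.C 1 : Polynomial k) ≠ 0 :=
    Polynomial.X_pow_add_C_ne_zero (by norm_num) 1
  simpa using aeval_xCoord_ne_zero a b h

theorem tameFunction_mem_separableMorphisms [PerfectField k] :
    tameFunction a b ∈ separableMorphisms k (K := FunField a b) := by
  change d (tameFunction a b) ≠ 0
  rw [D_tameFunction]
  exact smul_ne_zero (pow_ne_zero _ xCoord_cube_add_one_ne_zero)
    (xCoord_mem_separableMorphisms a b)

theorem symbol_tameFunction [PerfectField k] : (symbol (tameFunction a b) (xCoord a b) :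
    Ω[FunField a b⁄k]) = xCoord a b ^ 2 • d (xCoord a b) := by
  obtain ⟨c₀, hc⟩ := exists_isExpansion_tameFunction (a := a) (b := b)
  rw [hc.symbol_eq (xCoord_mem_separableMorphisms a b)]
  congr 2
  simp only [symbolCoeff, Matrix.cons_val]
  rw [div_eq_iff]
  · ring
  · convert xCoord_cube_add_one_ne_zero (a := a) (b := b) using 1
    ring

theorem isTameAt_of_odd_order {K : Type*} [Field K] [Algebra k K] {P : Place k K} {f t τ : K}
    (h : P.IsTargetUniformizer f t) (hτ : P.IsUniformizerOn ⊤ τ) {e : ℕ} (he : Odd e)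
    (hv : P.localRing.valuation t = P.localRing.valuation τ ^ e) : IsTameAt P f := by
  refine ⟨e, h.pullbackIdeal_eq hτ hv, ?_⟩
  rw [ringChar.eq k 2]
  exact fun h2 => (Nat.not_even_iff_odd.2 he) (even_iff_two_dvd.2 h2)

theorem isTameAt_tameFunction_infinity {P : Place k (FunField a b)}
    (hx : xCoord a b ∉ P.localRing) : IsTameAt P (tameFunction a b) := by
  have hτ := Place.isUniformizerOn_infinity hx
  obtain ⟨p, hp⟩ : ∃ p : Polynomial k, p = Polynomial.C (a ^ 2) * (Polynomial.X ^ 3 +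
    Polynomial.C a * Polynomial.X + Polynomial.C b) + Polynomial.C a * Polynomial.X ^ 5 +
    Polynomial.X + Polynomial.C (a ^ 4) * Polynomial.X ^ 2 := ⟨_, rfl⟩
  have hpd : p.natDegree ≤ 5 := by
    rw [hp]
    compute_degree
  -- Rewriting `y²` by the curve equation puts the function in the form p(x) + q(x)y with `deg q =
  -- 4` and `deg p ≤ 5`; the pole orders are then 11 and at most 10.
  have e : tameFunction a b = Polynomial.aeval (xCoord a b) p +
      Polynomial.aeval (xCoord a b) (Polynomial.X ^ 4 - Polynomial.C (a ^ 2)) * yCoord a b := by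
    rw [hp]
    simp only [tameFunction, map_add, map_mul, map_sub, map_pow, Polynomial.aeval_X,
      Polynomial.aeval_C]
    linear_combination algebraMap k (FunField a b) a ^ 2 * weierstrass_equation a b
  have hq : (Polynomial.X ^ 4 - Polynomial.C (a ^ 2) : Polynomial k).natDegree = 4 :=
    Polynomial.natDegree_X_pow_sub_C
  have hq0 : (Polynomial.X ^ 4 - Polynomial.C (a ^ 2) : Polynomial k) ≠ 0 :=
    Polynomial.X_pow_sub_C_ne_zero (by norm_num) _
  have hv : P.localRing.valuation (tameFunction a b) =
      P.localRing.valuation (xCoord a b / yCoord a b) ^ (-11 : ℤ) := by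
    rw [e, valuation_add_infinity P.algebraMap_mem hx,
      valuation_aeval_mul_yCoord_infinity P.algebraMap_mem hx hq0, hq]
    refine max_eq_right ?_
    rcases eq_or_ne p 0 with rfl | hp0
    · rw [map_zero, map_zero]
      exact zero_le
    · rw [valuation_aeval_infinity P.algebraMap_mem hx hp0, hτ.zpow_le_zpow_iff]
      omega
  have hf : tameFunction a b ∉ P.localRing := by
    rw [P.mem_iff, hv, ← zpow_zero (P.localRing.valuation (xCoord a b / yCoord a b)),
      hτ.zpow_le_zpow_iff]
    norm_num
  refine isTameAt_of_odd_order (P.isTargetUniformizer_inv hf) hτ (e := 11) (by decide) ?_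
  rw [map_inv₀, hv, zpow_neg, inv_inv]
  rfl

omit [CharP k 2] in
-- An algebraic `f` would have a separable minimal polynomial `m` over the perfect field, and `0 =
-- m'(f) df` would give `df = 0`.
theorem aeval_ne_zero_of_D_ne_zero {K : Type*} [Field K] [Algebra k K] [PerfectField k] {f : K}
    (hf : f ∈ separableMorphisms k (K := K)) {q : Polynomial k} (hq : q ≠ 0) :
    Polynomial.aeval f q ≠ 0 := by
  intro h0
  have hint : IsIntegral k f := IsAlgebraic.isIntegral ⟨q, hq, h0⟩
  have hsep := PerfectField.separable_of_irreducible (minpoly.irreducible hint)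
  have h1 := D_aeval (minpoly k f) f
  rw [minpoly.aeval, map_zero] at h1
  exact smul_ne_zero (hsep.aeval_derivative_ne_zero (minpoly.aeval k f)) hf h1.symm

/-- The zeros of `x³ + 1` are simple. At a multiple zero its differential `x² dx`, a unit square
times `x² dτ`, would force `x` to vanish, and then `x³ + 1` would be a unit. -/
theorem Place.valuation_xCoord_cube_add_one [PerfectField k] {P : Place k (FunField a b)}
    (hx : xCoord a b ∈ P.localRing) {τ : FunField a b} (hτ : P.IsUniformizerOn ⊤ τ) :
    P.localRing.valuation τ ≤ P.localRing.valuation (xCoord a b ^ 3 + 1) := by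
  by_contra! hlt
  have hτD := hτ.mem_separableMorphisms_top (sqGenerates_xCoord a b)
    (xCoord_mem_separableMorphisms a b)
  have hK := (sqGenerates_xCoord a b).of_D_ne_zero trivial hτD
  obtain ⟨c, hc, h1, -⟩ := Place.exists_expansion_xCoord hx hτ
  obtain ⟨u, -, w, -, e⟩ := hK.2 (xCoord a b ^ 3 + 1) trivial
  have hD := congrArg d e
  rw [D_sq_add_sq_mul, map_add, Derivation.map_one_eq_zero, add_zero,
    show xCoord a b ^ 3 = xCoord a b ^ 2 * xCoord a b by ring, D_sq_mul, hc.D_eq, smul_smul,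
    ← mul_pow] at hD
  have hw := sq_smul_D_injective (k := k) hτD hD
  have h2 := (hτ.le_zpow_succ_iff (z := xCoord a b ^ 3 + 1) trivial 1).2 (by simpa using hlt)
  rw [e] at h2
  have h3 := ((hτ.le_even_iff trivial trivial 1).1 (by simpa using h2)).2
  rw [← hw, map_mul, h1, mul_one, zpow_one] at h3
  have hx1 : P.localRing.valuation (xCoord a b) < 1 := h3.trans_lt hτ.lt_one
  have hx3 : P.localRing.valuation (xCoord a b ^ 3) < 1 := by
    rw [map_pow]; exact pow_lt_one₀ zero_le hx1 (by norm_num)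
  have h4 : P.localRing.valuation (xCoord a b ^ 3 + 1) = 1 := by
    rw [Valuation.map_add_eq_of_lt_right, map_one]
    rwa [map_one]
  rw [h4] at hlt
  exact absurd hτ.lt_one hlt.not_gt

theorem isTameAt_tameFunction_affine [PerfectField k] {P : Place k (FunField a b)}
    (hx : xCoord a b ∈ P.localRing) : IsTameAt P (tameFunction a b) := by
  have hK := sqGenerates_xCoord a b
  have hxD := xCoord_mem_separableMorphisms a b
  have hfD := tameFunction_mem_separableMorphisms (a := a) (b := b)
  obtain ⟨τ, hτ⟩ := Place.IsUniformizerOn.exists_isUniformizerOn_top P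
  have hτD := hτ.mem_separableMorphisms_top hK hxD
  obtain ⟨n, hn⟩ : ∃ n : CoordRing a b, algebraMap _ _ n = tameFunction a b := by
    refine exists_algebraMap_eq_of_forall_mem fun Q hQ => ?_
    have hy := Place.yCoord_mem hQ
    exact add_mem (add_mem (add_mem (add_mem (mul_mem (pow_mem hQ 4) hy)
      (mul_mem (Q.algebraMap_mem a) (pow_mem hQ 5))) hQ)
      (mul_mem (pow_mem (Q.algebraMap_mem a) 2) (pow_mem hy 2)))
      (mul_mem (pow_mem (Q.algebraMap_mem a) 4) (pow_mem hQ 2))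
  have hfO : tameFunction a b ∈ P.localRing := by rw [← hn]; exact Place.coordRing_mem hx n
  -- A polynomial relation for `f` in the residue field provides a nonzero element of `k(f)`
  -- vanishing at `P`, hence a uniformizer `t` of the target.
  obtain ⟨q, hq, hlt⟩ := Place.exists_polynomial_valuation_lt_one hx n
  rw [hn] at hlt
  have hmem : Polynomial.aeval (tameFunction a b) q ∈ k⟮tameFunction a b⟯ :=
    IntermediateField.algebra_adjoin_le_adjoin k _ (Polynomial.aeval_mem_adjoin_singleton k _)
  obtain ⟨t, ht0, ht⟩ := P.exists_isTargetUniformizer hmem (aeval_ne_zero_of_D_ne_zero hfD hq) hlt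
  have htU := ht.isUniformizerOn ht0
  have hF := sqGenerates_adjoin_simple (k := k) (tameFunction a b)
  have htD := htU.mem_separableMorphisms hF hfD
  obtain ⟨c, hc⟩ := hK.exists_expansion hτD t
  -- The symbol is decomposed as SY(t,f) + SY(f,x) + SY(x,τ). The outer terms are exact, and the
  -- middle one is `x² dx` with `x` regular.
  have hex : P.IsExactAt (symbol t τ) := by
    rw [← hK.cocycle htD hfD hτD, ← hK.symm hfD htD, ← hK.cocycle hfD hxD hτD, symbol_tameFunction]
    exact (P.isExactAt_symbol_target hfD hfO htU).add
      (((P.isExactAt_sq_smul hx ((P.mem_iff _).1 hx))).add (Place.isExactAt_symbol_xCoord hx hτ))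
  rw [hc.symbol_eq hτD, hτ.isExactAt_iff (hK.of_D_ne_zero trivial hτD) hτD] at hex
  obtain ⟨ε, hε, hDf⟩ : ∃ ε, P.localRing.valuation ε = 1 ∧ d (tameFunction a b) = ε ^ 2 • d t := by
    obtain ⟨c', hcF, hc'⟩ := (hF.of_D_ne_zero htU.mem htD).expansion
      (IntermediateField.mem_adjoin_simple_self k _)
    obtain ⟨r, hr, hD⟩ := P.exists_D_eq_smul hfO htU.mem htU.mem_localRing
    exact ⟨_, (htU.val_symbolCoeff_le_one_of_D_eq htD hcF hc' hfO hr hD).1, hc'.D_eq⟩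
  obtain ⟨p, hp, hp1, -⟩ := Place.exists_expansion_xCoord hx hτ
  rw [D_tameFunction, hp.D_eq, hc.D_eq, smul_smul, smul_smul, ← mul_pow, ← mul_pow] at hDf
  -- Both `df/dt` and `dx/dτ` are squares of units, so `dt/dτ` has the order of `(x³ + 1)²`, at most
  -- two.
  have hρ := congrArg P.localRing.valuation (sq_smul_D_injective (k := k) hτD hDf)
  rw [map_mul, map_mul, hp1, hε, mul_one, one_mul] at hρ
  obtain ⟨e, he, hv⟩ := hτ.exists_odd_order hc htU.lt_one hex
    (hρ ▸ Place.valuation_xCoord_cube_add_one hx hτ)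
  exact isTameAt_of_odd_order ht hτ he hv

theorem isTame_tameFunction [PerfectField k] : IsTame k (tameFunction a b) :=
  ⟨tameFunction_mem_separableMorphisms, fun P => by
    by_cases hx : xCoord a b ∈ P.localRing
    · exact isTameAt_tameFunction_affine hx
    · exact isTameAt_tameFunction_infinity hx⟩

end Tame
end SYCurve

namespace SYCurve

/-! ### Points of the conic from symbols, and vanishing of the class. -/

section Conic

universe u

theorem conicForm_symbolCoeff {K : Type*} [Field K] [CharP K 2] {g : K} {c : Fin 4 → K}
    (h0 : c 1 ^ 2 + c 3 ^ 2 * g ≠ 0) :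
    conicForm (symbolCoeff g c) g ![c 1, c 2, c 3] = 0 := by
  rw [conicForm_apply]
  simp only [Matrix.cons_val, symbolCoeff, mul_comm g]
  rw [div_mul_cancel₀ _ h0, CharTwo.add_self_eq_zero]

theorem syClassVanishes_of_isSYSection {k K : Type u} [Field k] [Field K] [Algebra k K]
    [CharP K 2] {n : ℕ} {P : PseudotameCover k K n} {ω : Fin n → Ω[K⁄k]} {s : K}
    (h : IsSYSection P ω s) : SYClassVanishes P ω := fun i => by
  obtain ⟨β, c, hβ, -, hne, h0⟩ := h i
  exact ⟨β, hβ, hasTrivialBrauerClass_even _ _ hne h0⟩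

end Conic

/-! ### Determination of the torsor and the explicit sections. -/

section Main

variable {k : Type*} [Field k] [CharP k 2] {a b : k}

local notation "d" => KaehlerDifferential.D k (FunField a b)

theorem D_xCoord_cube_add (c : k) :
    d (xCoord a b ^ 3 + algebraMap k _ c ^ 2 * xCoord a b) =
      (xCoord a b + algebraMap k _ c) ^ 2 • d (xCoord a b) := by
  rw [map_add, show xCoord a b ^ 3 = xCoord a b ^ 2 * xCoord a b by ring, D_sq_mul, D_sq_mul,
    sq_smul_add]

variable [PerfectField k]

theorem isSYCochain_of_forall_eq {n : ℕ} (P : PseudotameCover k (FunField a b) n)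
    {ω : Fin n → Ω[FunField a b⁄k]} {c : k}
    (h : ∀ i, ω i = (xCoord a b + algebraMap k _ c) ^ 2 • d (xCoord a b) +
      symbol (P.f i) (xCoord a b)) : IsSYCochain P ω := by
  have hK := sqGenerates_xCoord a b
  have hxD := xCoord_mem_separableMorphisms a b
  refine ⟨fun i => mem_sectionsB_iff.2 fun Q hQ => ?_, fun i j => ?_⟩
  · rw [h i]
    by_cases hx : xCoord a b ∈ Q.localRing
    · rw [Place.isExactAt_affine_iff hx (P.mem_separable i) (P.pseudotame i Q hQ), ← Q.mem_iff]
      exact add_mem hx (Q.algebraMap_mem c)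
    -- The shift by `x` required at infinity cancels the `x` in `β = x + c`, leaving the constant.
    · rw [Place.isExactAt_infinity_iff hx (P.mem_separable i) (P.pseudotame i Q hQ), ← Q.mem_iff,
        add_right_comm, CharTwo.add_self_eq_zero, zero_add]
      exact Q.algebraMap_mem c
  · rw [h i, h j, add_add_add_comm, two_smul_differential, zero_add,
      ← hK.cocycle (P.mem_separable i) hxD (P.mem_separable j),
      hK.symm hxD (P.mem_separable j)]

/-- The coboundary condition and the cocycle relation make ω_i + SY(f_i,x) independent of `i`, so a
single `β` meets the local conditions at all points of the curve. -/
theorem IsSYCochain.exists_eq {n : ℕ} {P : PseudotameCover k (FunField a b) n}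
    {ω : Fin n → Ω[FunField a b⁄k]} (h : IsSYCochain P ω) :
    ∃ c : k, ∀ i, ω i = (xCoord a b + algebraMap k _ c) ^ 2 • d (xCoord a b) +
      symbol (P.f i) (xCoord a b) := by
  have hK := sqGenerates_xCoord a b
  have hxD := xCoord_mem_separableMorphisms a b
  obtain ⟨Q, hQ⟩ := exists_place_infinity a b
  obtain ⟨i₀, hi₀⟩ := P.covers Q
  have hcancel : ∀ i, ω i = ω i + symbol (P.f i) (xCoord a b) + symbol (P.f i) (xCoord a b) :=
    fun i => by rw [add_assoc, two_smul_differential, add_zero]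
  have hconst : ∀ i, ω i + symbol (P.f i) (xCoord a b) =
      ω i₀ + symbol (P.f i₀) (xCoord a b) := by
    intro i
    apply differential_eq_of_add_eq_zero
    rw [add_add_add_comm, ← h.2 i i₀, hK.symm (P.mem_separable i₀) hxD,
      hK.cocycle (P.mem_separable i) hxD (P.mem_separable i₀), two_smul_differential]
  obtain ⟨β, hβ⟩ : ∃ β, ω i₀ + symbol (P.f i₀) (xCoord a b) = β ^ 2 • d (xCoord a b) := by
    obtain ⟨s, -, hs⟩ := h.1 i₀ Q hi₀
    obtain ⟨u, -, w, -, rfl⟩ := hK.2 s trivial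
    obtain ⟨c, hc⟩ := hK.exists_expansion hxD (P.f i₀)
    exact ⟨_, by rw [← hs, D_sq_add_sq_mul, hc.symbol_eq hxD, sq_smul_add]⟩
  have hω : ∀ i, ω i = β ^ 2 • d (xCoord a b) + symbol (P.f i) (xCoord a b) := fun i => by
    rw [← hβ, ← hconst i]
    exact hcancel i
  have haff : ∀ R : Place k (FunField a b), xCoord a b ∈ R.localRing → β ∈ R.localRing := by
    intro R hR
    obtain ⟨i, hi⟩ := P.covers R
    rw [R.mem_iff, ← Place.isExactAt_affine_iff hR (P.mem_separable i) (P.pseudotame i R hi), ← hω]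
    exact h.1 i R hi
  obtain ⟨c, rfl⟩ := exists_eq_xCoord_add haff hQ (by
    rw [← Place.isExactAt_infinity_iff hQ (P.mem_separable i₀) (P.pseudotame i₀ Q hi₀), ← hω]
    exact h.1 i₀ Q hi₀)
  exact ⟨c, hω⟩

/-- The conic equation is the definition of the symbol with its denominator cleared; the point is
nonzero because that denominator is. -/
theorem exists_isExpansion_of_symbol_eq {s : FunField a b}
    (hs : s ∈ separableMorphisms k (K := FunField a b)) {f : FunField a b}
    (hf : f ∈ separableMorphisms k (K := FunField a b)) :
    ∃ (β : FunField a b) (c : Fin 4 → FunField a b), β ^ 2 • d f = symbol s f ∧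
      IsExpansion s f c ∧ ![c 1, c 2, c 3] ≠ 0 ∧ conicForm β f ![c 1, c 2, c 3] = 0 := by
  obtain ⟨c, hc⟩ := (sqGenerates_xCoord a b).exists_expansion hf s
  have h0 := hc.denom_ne_zero hs
  refine ⟨symbolCoeff f c, c, (hc.symbol_eq hf).symm, hc, fun h => h0 ?_,
    conicForm_symbolCoeff h0⟩
  have h1 : c 1 = 0 := congrFun h 0
  have h3 : c 3 = 0 := congrFun h 2
  rw [h1, h3]
  ring

/-- The function representing the section of the bundle given by `c = e ^ 4`. -/
theorem isSYSection_of_pow_four_eq {n : ℕ} (P : PseudotameCover k (FunField a b) n)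
    {ω : Fin n → Ω[FunField a b⁄k]} {c e : k} (he : e ^ 4 = c)
    (h : ∀ i, ω i = (xCoord a b + algebraMap k _ c) ^ 2 • d (xCoord a b) +
      symbol (P.f i) (xCoord a b)) :
    IsSYSection P ω ((algebraMap k _ e ^ 2) ^ 4 * xCoord a b +
      (algebraMap k _ e + algebraMap k _ c + xCoord a b) ^ 4 * xCoord a b ^ 2 +
        xCoord a b ^ 3) := by
  have hK := sqGenerates_xCoord a b
  have hxD := xCoord_mem_separableMorphisms a b
  have hc := congrArg (algebraMap k (FunField a b)) he
  rw [map_pow] at hc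
  set s := (algebraMap k _ e ^ 2) ^ 4 * xCoord a b +
      (algebraMap k _ e + algebraMap k _ c + xCoord a b) ^ 4 * xCoord a b ^ 2 +
        xCoord a b ^ 3 with hs
  have hexp : IsExpansion s (xCoord a b) ![0, algebraMap k _ e ^ 2,
      algebraMap k _ e + algebraMap k _ c + xCoord a b, 1] := by
    simp only [IsExpansion, Matrix.cons_val, hs]
    ring
  have hden : (algebraMap k (FunField a b) e ^ 2) ^ 2 + 1 ^ 2 * xCoord a b ≠ 0 := by
    have := xCoord_add_algebraMap_ne_zero (a := a) (b := b) c
    rw [← hc] at this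
    convert this using 1
    ring
  have hsD : s ∈ separableMorphisms k (K := FunField a b) := by
    change d s ≠ 0
    rw [hexp.D_eq]
    exact smul_ne_zero (pow_ne_zero _ hden) hxD
  -- The numerator is `e² + (e + c + x)² = (x + c)²` and the denominator is `e⁴ + x = x + c`, so the
  -- quotient is `x + c`.
  have hsym : (symbol s (xCoord a b) : Ω[FunField a b⁄k]) =
      (xCoord a b + algebraMap k _ c) ^ 2 • d (xCoord a b) := by
    rw [hexp.symbol_eq hxD]
    congr 2
    have h2 : (2 : FunField a b) = 0 := CharTwo.two_eq_zero
    simp only [symbolCoeff, Matrix.cons_val]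
    rw [div_eq_iff hden]
    linear_combination (-(xCoord a b + algebraMap k _ c)) * hc + (algebraMap k _ e ^ 2 +
      algebraMap k _ e * algebraMap k _ c + algebraMap k _ e * xCoord a b) * h2
  intro i
  rw [h i, ← hsym, hK.symm (P.mem_separable i) hxD,
    hK.cocycle hsD hxD (P.mem_separable i)]
  exact exists_isExpansion_of_symbol_eq hsD (P.mem_separable i)

end Main
end SYCurve

theorem theorem7p3 {k : Type*} [Field k] [CharP k 2] [PerfectField k] (a b : k) :
    -- every SY class of `X` vanishes, and every SY bundle has a section
    (∀ (n : ℕ) (P : PseudotameCover k (FunField a b) n) (ω : Fin n → Ω[FunField a b⁄k]),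
      IsSYCochain P ω → SYClassVanishes P ω ∧ ∃ s, IsSYSection P ω s) ∧
    -- the elements of the SY torsor, written on the affine model with the coordinate `g = x`
    (∀ (n : ℕ) (P : PseudotameCover k (FunField a b) n) (ω : Fin n → Ω[FunField a b⁄k]),
      IsSYCochain P ω ↔ ∃ c : k, ∀ i, ω i =
        KaehlerDifferential.D k (FunField a b)
          (xCoord a b ^ 3 + algebraMap k (FunField a b) c ^ 2 * xCoord a b) +
        symbol (P.f i) (xCoord a b)) ∧
    -- the explicit rational point of the conic of the torsor element `c = d⁴`, and the section of
    -- the SY bundle that it defines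
    (∀ c d : k, d ^ 4 = c →
      (xCoord a b + algebraMap k (FunField a b) c) ^ 2 •
          KaehlerDifferential.D k (FunField a b) (xCoord a b) =
        KaehlerDifferential.D k (FunField a b)
          (xCoord a b ^ 3 + algebraMap k (FunField a b) c ^ 2 * xCoord a b) ∧
      conicForm (xCoord a b + algebraMap k (FunField a b) c) (xCoord a b)
        ![algebraMap k (FunField a b) d ^ 2,
          algebraMap k (FunField a b) d + algebraMap k (FunField a b) c + xCoord a b, 1] = 0 ∧
      ∀ (n : ℕ) (P : PseudotameCover k (FunField a b) n) (ω : Fin n → Ω[FunField a b⁄k]),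
        (∀ i, ω i = KaehlerDifferential.D k (FunField a b)
          (xCoord a b ^ 3 + algebraMap k (FunField a b) c ^ 2 * xCoord a b) +
            symbol (P.f i) (xCoord a b)) →
        IsSYSection P ω ((algebraMap k (FunField a b) d ^ 2) ^ 4 * xCoord a b +
          (algebraMap k (FunField a b) d + algebraMap k (FunField a b) c + xCoord a b) ^ 4 *
            xCoord a b ^ 2 + xCoord a b ^ 3)) ∧
    -- `X` admits a tame morphism to the projective line
    (∃ f : FunField a b, IsTame k f) := by
  refine ⟨fun n P ω h => ?_, fun n P ω => ?_, fun c d hd => ⟨?_, ?_, fun n P ω h => ?_⟩,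
    tameFunction a b, isTame_tameFunction⟩
  · obtain ⟨c, hc⟩ := h.exists_eq
    obtain ⟨e, he⟩ := exists_fourth_eq c
    have hs := isSYSection_of_pow_four_eq P he hc
    exact ⟨syClassVanishes_of_isSYSection hs, _, hs⟩
  · simp only [D_xCoord_cube_add]
    exact ⟨fun h => h.exists_eq, fun ⟨c, hc⟩ => isSYCochain_of_forall_eq P hc⟩
  · exact (D_xCoord_cube_add c).symm
  · have h2 : (2 : FunField a b) = 0 := CharTwo.two_eq_zero
    have hc := congrArg (algebraMap k (FunField a b)) hd
    rw [map_pow] at hc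
    rw [conicForm_apply]
    simp only [Matrix.cons_val]
    linear_combination (xCoord a b + algebraMap k (FunField a b) c) * hc +
      (algebraMap k (FunField a b) d ^ 2 + algebraMap k _ d * algebraMap k _ c +
        algebraMap k _ d * xCoord a b + (algebraMap k _ c + xCoord a b) ^ 2) * h2
  · simp only [D_xCoord_cube_add] at h
    exact isSYSection_of_pow_four_eq P hd h
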